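/- **Setting.** Let $\{x\in\mathbb R^3: r=|x|>R_0\}$, $R_0>0$, be an asymptotic end of a 3-manifold in asymptotically Cartesian coordinates, carrying smooth vacuum initial data $(h_{ij},K_{ij})$ with $h$ negative definite. Here $K$ is the pull-back of $-h_\mu{}^\lambda h_\nu{}^\rho\nabla_\lambda\tau_\rho$ for the normal $\tau$ with $\tau_\mu\tau^\mu=2$, so the vacuum constraints are $-2\mathcal R-(K_a{}^a)^2+K_{ab}K^{ab}=0$ and $D^aK_{ab}-D_bK_a{}^a=0$, with $\mathcal R$ the scalar curvature of the Riemannian metric $-h$. Write $u=o_\infty(r^\delta)$ if, near infinity, $u$ is smooth and $\int |D^ku|^2\sigma^{-2(\delta-k)-3}\,dx<\infty$ for all $k\ge 0$, where $\sigma=(1+r^2)^{1/2}$; tensors and spinors are treated componentwise. Let $E$ and $p_i$ be the ADM energy and momentum of the end, that is, with $n^i=x^i/r$ and $g=-h$, $$E=\lim_{r\to\infty}\frac1{16\pi}\int_{S_r}\delta^{ij}(\partial_ig_{jk}-\partial_kg_{ij})n^k\,dS,\qquad p_i=\lim_{r\to\infty}\frac1{8\pi}\int_{S_r}(K_{ij}-K_a{}^ah_{ij})n^j\,dS.$$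 Assume that $m^2:=E^2-\delta^{ij}p_ip_j>0$, with $m>0$, and that, with $x_i=\delta_{ij}x^j$ and $n\cdot p=n^ip_i$, $$h_{ij}=-\Bigl(1+\frac{2E}{r}\Bigr)\delta_{ij}-\frac{\alpha}{r}\Bigl(\frac{2x_ix_j}{r^2}-\delta_{ij}\Bigr)+o_\infty(r^{-3/2}),\qquad K_{ij}=\frac{\beta}{r^2}\Bigl(\frac{2x_ix_j}{r^2}-\delta_{ij}\Bigr)+o_\infty(r^{-5/2}),$$ $$\alpha=\frac{2m^2+4(n\cdot p)^2}{\sqrt{m^2+(n\cdot p)^2}}-2E,\qquad \beta=\frac{(n\cdot p)E\,(3m^2+2(n\cdot p)^2)}{(m^2+(n\cdot p)^2)^{3/2}}.$$ Spinor indices are moved by $\xi^A=\epsilon^{AB}\xi_B$, $\xi_B=\xi^A\epsilon_{AB}$, $\epsilon_{01}=\epsilon^{01}=1$. Let $\mathring\sigma^a{}_{AB}$ be the constant symbols with $$\mathring\sigma^a{}_{AB}v_a=\frac1{\sqrt2}\begin{pmatrix}-v_1-\mathrm i v_2&v_3\\v_3&v_1-\mathrm i v_2\end{pmatrix}.$$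 Take any asymptotically Cartesian spin frame: its soldering form is $\sigma^i{}_{AB}=e_a{}^i\mathring\sigma^a{}_{AB}$, where $e_a$ is a smooth frame on the end with $h(e_a,e_b)=-\delta_{ab}$ and $e_a{}^i=\delta_a{}^i+o_\infty(r^{-1/2})$. Let $D_{AB}=\sigma^i{}_{AB}D_i$ be the spin Levi-Civita derivative of $h$. The Sen derivative of a symmetric spinor is $$\nabla_{AB}\kappa_{CD}=D_{AB}\kappa_{CD}+\tfrac12K_{ABC}{}^F\kappa_{FD}+\tfrac12K_{ABD}{}^F\kappa_{CF},\qquad K_{ABCD}=\tau_D{}^{C'}\nabla_{AB}\tau_{CC'}=-\sigma^i{}_{AB}\sigma^j{}_{CD}K_{ij}.$$ Put $\xi=\nabla^{AB}\kappa_{AB}$, $\xi_{AB}=\tfrac32\nabla_{(A}{}^D\kappa_{B)D}$, $\xi_{ABCD}=\nabla_{(AB}\kappa_{CD)}$ and $p_{AB}=\mathring\sigma^i{}_{AB}p_i$. **Theorem.** For each choice of the sign $\pm$ (one sign being attached to each end), there exists a smooth symmetric spinor field $\kappa_{AB}=o_\infty(r^{3/2})$ on the end such that $$\xi_{ABCD}=o_\infty(r^{-3/2}),\qquad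 \xi_{AB}=\pm\frac{\sqrt2\,p_{AB}}{m}+o_\infty(r^{-1/2}),\qquad \xi=\pm\frac{\sqrt2\,E}{m}+o_\infty(r^{-1/2}).$$ Moreover $\kappa_{AB}$ is unique up to order $o_\infty(r^{-1/2})$, apart from a complex constant term: if $\kappa$ and $\kappa'$ are two such spinor fields (for the same sign), there is a constant symmetric complex $C_{AB}$ with $\kappa_{AB}-\kappa'_{AB}=C_{AB}+o_\infty(r^{-1/2})$. -/

import Mathlib

open MeasureTheory Filter Topology
open scoped ContDiff

noncomputable section

namespace KillingSpinorEnd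

/-! ## The asymptotic end and weighted Sobolev decay -/

/-- Coordinate space of an asymptotic end. -/
abbrev E3 := EuclideanSpace ℝ (Fin 3)

/-- An asymptotic end in asymptotically Cartesian coordinates: the complement of a closed ball. -/
def endRegion (R₀ : ℝ) : Set E3 := {x | R₀ < ‖x‖}

/-- The coordinate partial derivative `∂_i f`. -/
def pd {F : Type*} [NormedAddCommGroup F] [NormedSpace ℝ F]
    (i : Fin 3) (f : E3 → F) (x : E3) : F :=
  fderiv ℝ f x (EuclideanSpace.single i 1)

/-- The weight `σ(x) = (1 + |x|²)^{1/2}`. -/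
def weight (x : E3) : ℝ := Real.sqrt (1 + ‖x‖ ^ 2)

/-- `f = o_∞(r^δ)`: near infinity `f` is smooth and belongs to the weighted Sobolev spaces
`H^s_δ` for all `s`, where (in the convention of Bartnik)
`‖u‖_{s,δ} = ∑_{k ≤ s} ‖D^k u‖_{δ-k}` and `‖u‖_δ² = ∫ |u|² σ^{-2δ-3} dx`. -/
def IsLittleInf {F : Type*} [NormedAddCommGroup F] [NormedSpace ℝ F]
    (δ : ℝ) (f : E3 → F) : Prop :=
  ∃ R : ℝ, 0 < R ∧ ContDiffOn ℝ ∞ f (endRegion R) ∧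
    ∀ k : ℕ, IntegrableOn
      (fun x => ‖iteratedFDeriv ℝ k f x‖ ^ 2 * weight x ^ (-2 * (δ - k) - 3)) (endRegion R)

/-! ## Initial data

The 3-metric `h` is negative definite; `h x i j` and `K x i j` are the coordinate components of
`h_{ij}` and `K_{ij}` at `x`. -/

/-- Christoffel symbols `Γ^k_{ij}` of `h`. -/
def christoffel (h : E3 → Matrix (Fin 3) (Fin 3) ℝ) (k i j : Fin 3) (x : E3) : ℝ :=
  (1 / 2) * ∑ l, (h x)⁻¹ k l *
    (pd i (fun y => h y l j) x + pd j (fun y => h y l i) x - pd l (fun y => h y i j) x)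

/-- The Ricci tensor `R_{ij} = ∂_k Γ^k_{ij} - ∂_j Γ^k_{ik} + Γ^k_{kl} Γ^l_{ij} - Γ^k_{jl} Γ^l_{ik}`
(it is the same for `h` and for the positive definite metric `-h`). -/
def ricci (h : E3 → Matrix (Fin 3) (Fin 3) ℝ) (i j : Fin 3) (x : E3) : ℝ :=
  ∑ k, (pd k (christoffel h k i j) x - pd j (christoffel h k i k) x
    + ∑ l, (christoffel h k k l x * christoffel h l i j x
      - christoffel h k j l x * christoffel h l i k x))

/-- The Ricci scalar in the sign convention
`∇_μ∇_ν ξ_ζ - ∇_ν∇_μ ξ_ζ = R_{νμζ}^η ξ_η`, `R_{μν} = R_{μλν}^λ`; for the negative definite `h`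
it is the usual scalar curvature of the Riemannian metric `-h`. -/
def ricciScalar (h : E3 → Matrix (Fin 3) (Fin 3) ℝ) (x : E3) : ℝ :=
  - ∑ i, ∑ j, (h x)⁻¹ i j * ricci h i j x

/-- The trace `K = K_a^a = h^{ij} K_{ij}`. -/
def trK (h K : E3 → Matrix (Fin 3) (Fin 3) ℝ) (x : E3) : ℝ :=
  ∑ i, ∑ j, (h x)⁻¹ i j * K x i j

/-- The Levi-Civita derivative `D_c K_{ab}`. -/
def covDerivK (h K : E3 → Matrix (Fin 3) (Fin 3) ℝ) (c a b : Fin 3) (x : E3) : ℝ :=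
  pd c (fun y => K y a b) x
    - ∑ l, (christoffel h l c a x * K x l b + christoffel h l c b x * K x a l)

/-- Smooth vacuum initial data `(h, K)` on an asymptotic end, with `h` negative definite and
`K = - (∇τ)` for the normal `τ` normalised by `τ_μ τ^μ = 2` (whence the coefficients in the
constraint equations). -/
structure IsVacuumData (R₀ : ℝ) (h K : E3 → Matrix (Fin 3) (Fin 3) ℝ) : Prop where
  smooth_h : ∀ i j, ContDiffOn ℝ ∞ (fun x => h x i j) (endRegion R₀)
  smooth_K : ∀ i j, ContDiffOn ℝ ∞ (fun x => K x i j) (endRegion R₀)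
  negDef : ∀ x ∈ endRegion R₀, (-(h x)).PosDef
  symm_K : ∀ x ∈ endRegion R₀, (K x).IsSymm
  /-- `-2 r - K_a^a K_b^b + K_{ab} K^{ab} = 0`. -/
  hamiltonian : ∀ x ∈ endRegion R₀,
    -2 * ricciScalar h x - trK h K x ^ 2
      + ∑ a, ∑ b, ∑ c, ∑ d, (h x)⁻¹ a c * (h x)⁻¹ b d * K x a b * K x c d = 0
  /-- `D^a K_{ab} - D_b K_a^a = 0`. -/
  momentum : ∀ x ∈ endRegion R₀, ∀ b,
    (∑ a, ∑ c, (h x)⁻¹ a c * covDerivK h K c a b x) - pd b (trK h K) x = 0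

/-! ## ADM energy and momentum, and the boosted decay conditions -/

/-- `∫_{|x| = r} f(x, n) dS` with `n = x / r`. -/
def sphereIntegral (r : ℝ) (f : E3 → E3 → ℝ) : ℝ :=
  r ^ 2 * ∫ n : Metric.sphere (0 : E3) 1, f (r • (n : E3)) n ∂((volume : Measure E3).toSphere)

/-- `E` is the ADM energy (the integrand is `(∂_j g_{jk} - ∂_k g_{jj}) n^k` for the Riemannian
metric `g = -h`). -/
def HasADMEnergy (h : E3 → Matrix (Fin 3) (Fin 3) ℝ) (E : ℝ) : Prop :=
  Tendsto (fun r : ℝ => 1 / (16 * Real.pi) * sphereIntegral r (fun x n =>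
    ∑ j, ∑ k, (pd k (fun y => h y j j) x - pd j (fun y => h y j k) x) * n k)) atTop (𝓝 E)

/-- `p_i` is the ADM momentum: the flux of `K_{ij} - K h_{ij}`. -/
def HasADMMomentum (h K : E3 → Matrix (Fin 3) (Fin 3) ℝ) (p : Fin 3 → ℝ) : Prop :=
  ∀ i, Tendsto (fun r : ℝ => 1 / (8 * Real.pi) * sphereIntegral r (fun x n =>
    ∑ j, (K x i j - trK h K x * h x i j) * n j)) atTop (𝓝 (p i))

/-- `p_μ p^μ = E² - δ^{ij} p_i p_j`. -/
def massSq (E : ℝ) (p : Fin 3 → ℝ) : ℝ := E ^ 2 - ∑ i, p i ^ 2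

/-- The ADM mass `m = √(p_μ p^μ)`. -/
def mass (E : ℝ) (p : Fin 3 → ℝ) : ℝ := Real.sqrt (massSq E p)

/-- `n · p = r⁻¹ x^i p_i`. -/
def nDot (p : Fin 3 → ℝ) (x : E3) : ℝ := (∑ i, x i * p i) / ‖x‖

/-- `α = (2m² + 4(n·p)²)/√(m² + (n·p)²) - 2E`. -/
def alphaBoost (E : ℝ) (p : Fin 3 → ℝ) (x : E3) : ℝ :=
  (2 * massSq E p + 4 * nDot p x ^ 2) / Real.sqrt (massSq E p + nDot p x ^ 2) - 2 * E

/-- `β = (n·p) E (3m² + 2(n·p)²)/(m² + (n·p)²)^{3/2}`. -/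
def betaBoost (E : ℝ) (p : Fin 3 → ℝ) (x : E3) : ℝ :=
  nDot p x * E * (3 * massSq E p + 2 * nDot p x ^ 2)
    / Real.sqrt (massSq E p + nDot p x ^ 2) ^ 3

/-- The Kronecker delta. -/
def kron (i j : Fin 3) : ℝ := if i = j then 1 else 0

/-- The boosted decay conditions, with `A = E` and `α`, `β` those of boosted Schwarzschild:
`h_{ij} = -(1 + 2A/r) δ_{ij} - (α/r)(2 x_i x_j/r² - δ_{ij}) + o_∞(r^{-3/2})`,
`K_{ij} = (β/r²)(2 x_i x_j/r² - δ_{ij}) + o_∞(r^{-5/2})`. -/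
structure BoostedDecay (h K : E3 → Matrix (Fin 3) (Fin 3) ℝ) (E : ℝ) (p : Fin 3 → ℝ) : Prop where
  metric : ∀ i j, IsLittleInf (-3 / 2) (fun x => h x i j -
    (-(1 + 2 * E / ‖x‖) * kron i j
      - alphaBoost E p x / ‖x‖ * (2 * x i * x j / ‖x‖ ^ 2 - kron i j)))
  extrinsic : ∀ i j, IsLittleInf (-5 / 2) (fun x => K x i j -
    betaBoost E p x / ‖x‖ ^ 2 * (2 * x i * x j / ‖x‖ ^ 2 - kron i j))

/-! ## Space spinors

Spinor indices run over `Fin 2`. Indices are moved with `ε` by `ξ^A = ε^{AB} ξ_B`,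
`ξ_B = ξ^A ε_{AB}`, where `ε_{01} = ε^{01} = 1`. -/

/-- The antisymmetric spinor; the same components serve for `ε_{AB}` and `ε^{AB}`. -/
def eps : Matrix (Fin 2) (Fin 2) ℂ := !![0, 1; -1, 0]

/-- The constant spatial Infeld-van der Waerden symbols, so that `ξ_{AB} = σ^i_{AB} ξ_i` is
`2^{-1/2}` times the matrix with rows `(-ξ_1 - i ξ_2, ξ_3)`, `(ξ_3, ξ_1 - i ξ_2)`. -/
def sigma0 : Fin 3 → Matrix (Fin 2) (Fin 2) ℂ :=
  ![((1 / Real.sqrt 2 : ℝ) : ℂ) • !![-1, 0; 0, 1],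
    ((1 / Real.sqrt 2 : ℝ) : ℂ) • !![-Complex.I, 0; 0, -Complex.I],
    ((1 / Real.sqrt 2 : ℝ) : ℂ) • !![0, 1; 1, 0]]

/-- `p_{AB} = σ^i_{AB} p_i` for a constant covector. -/
def constSpinor (p : Fin 3 → ℝ) (A B : Fin 2) : ℂ := ∑ i, (p i : ℂ) * sigma0 i A B

/-- An asymptotically Cartesian frame on the end: a smooth `h`-orthonormal frame
`e_a = e_a^i ∂_i` (`e x a i` is `e_a^i` at `x`) with `e_a^i = δ_a^i + o_∞(r^{-1/2})`.
The associated spin frame is the one in which the soldering form is `e_a^i σ^a_{AB}`. -/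
structure IsCartesianFrame (R₀ : ℝ) (h e : E3 → Matrix (Fin 3) (Fin 3) ℝ) : Prop where
  smooth : ∀ a i, ContDiffOn ℝ ∞ (fun x => e x a i) (endRegion R₀)
  orthonormal : ∀ x ∈ endRegion R₀, ∀ a b,
    ∑ i, ∑ j, h x i j * e x a i * e x b j = -kron a b
  asymptotic : ∀ a i, IsLittleInf (-1 / 2) (fun x => e x a i - kron a i)

/-- The spatial soldering form `σ^i_{AB}` in the spin frame of `e`. -/
def solder (e : E3 → Matrix (Fin 3) (Fin 3) ℝ) (i : Fin 3) (A B : Fin 2) (x : E3) : ℂ :=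
  ∑ a, (e x a i : ℂ) * sigma0 a A B

/-- `σ_j^{AB} = h_{jk} ε^{AC} ε^{BD} σ^k_{CD}`. -/
def solderUp (h e : E3 → Matrix (Fin 3) (Fin 3) ℝ) (j : Fin 3) (A B : Fin 2) (x : E3) : ℂ :=
  ∑ k, ∑ C, ∑ D, (h x j k : ℂ) * eps A C * eps B D * solder e k C D x

/-- The coefficients `γ_{iA}^C = ½ σ_j^{CB} (∂_i σ^j_{AB} + Γ^j_{ik} σ^k_{AB})` of the spin
connection `D_i π_A = ∂_i π_A - γ_{iA}^C π_C` of `h`: the unique trace-free solution of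
`D_i σ^j_{AB} = 0`. -/
def spinConn (h e : E3 → Matrix (Fin 3) (Fin 3) ℝ) (i : Fin 3) (A C : Fin 2) (x : E3) : ℂ :=
  (1 / 2) * ∑ j, ∑ B, solderUp h e j C B x *
    (pd i (solder e j A B) x + ∑ k, (christoffel h j i k x : ℂ) * solder e k A B x)

/-- `D_i κ_{CD}`. -/
def covDeriv (h e : E3 → Matrix (Fin 3) (Fin 3) ℝ) (κ : E3 → Matrix (Fin 2) (Fin 2) ℂ)
    (i : Fin 3) (C D : Fin 2) (x : E3) : ℂ :=
  pd i (fun y => κ y C D) x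
    - ∑ F, (spinConn h e i C F x * κ x F D + spinConn h e i D F x * κ x C F)

/-- `K_{ABCD} = τ_D^{C'} ∇_{AB} τ_{CC'}`. Since `K_{μν} = - h_μ^λ h_ν^ρ ∇_λ τ_ρ`, this is
`- σ^i_{AB} σ^j_{CD} K_{ij}`. -/
def spinK (K e : E3 → Matrix (Fin 3) (Fin 3) ℝ) (A B C D : Fin 2) (x : E3) : ℂ :=
  - ∑ i, ∑ j, solder e i A B x * solder e j C D x * (K x i j : ℂ)

/-- `K_{ABC}^D = ε^{DF} K_{ABCF}`. -/
def spinKUp (K e : E3 → Matrix (Fin 3) (Fin 3) ℝ) (A B C D : Fin 2) (x : E3) : ℂ :=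
  ∑ F, eps D F * spinK K e A B C F x

/-- The Sen derivative
`∇_{AB} κ_{CD} = D_{AB} κ_{CD} + ½ K_{ABC}^F κ_{FD} + ½ K_{ABD}^F κ_{CF}`,
where `D_{AB} = σ^i_{AB} D_i`. -/
def sen (h K e : E3 → Matrix (Fin 3) (Fin 3) ℝ) (κ : E3 → Matrix (Fin 2) (Fin 2) ℂ)
    (A B C D : Fin 2) (x : E3) : ℂ :=
  (∑ i, solder e i A B x * covDeriv h e κ i C D x)
    + (1 / 2) * ∑ F, (spinKUp K e A B C F x * κ x F D + spinKUp K e A B D F x * κ x C F)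

/-- `ξ = ∇^{AB} κ_{AB}`. -/
def xi0 (h K e : E3 → Matrix (Fin 3) (Fin 3) ℝ) (κ : E3 → Matrix (Fin 2) (Fin 2) ℂ)
    (x : E3) : ℂ :=
  ∑ A, ∑ B, ∑ C, ∑ D, eps A C * eps B D * sen h K e κ C D A B x

/-- `∇_F^D κ_{BD}`. -/
def senContr (h K e : E3 → Matrix (Fin 3) (Fin 3) ℝ) (κ : E3 → Matrix (Fin 2) (Fin 2) ℂ)
    (F B : Fin 2) (x : E3) : ℂ :=
  ∑ D, ∑ G, eps D G * sen h K e κ F G B D x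

/-- `ξ_{AB} = (3/2) ∇_{(A}^D κ_{B)D}`. -/
def xi2 (h K e : E3 → Matrix (Fin 3) (Fin 3) ℝ) (κ : E3 → Matrix (Fin 2) (Fin 2) ℂ)
    (A B : Fin 2) (x : E3) : ℂ :=
  (3 / 2) * ((1 / 2) * (senContr h K e κ A B x + senContr h K e κ B A x))

/-- `ξ_{ABCD} = ∇_{(AB} κ_{CD)}`, with indices `a 0, a 1, a 2, a 3`. -/
def xi4 (h K e : E3 → Matrix (Fin 3) (Fin 3) ℝ) (κ : E3 → Matrix (Fin 2) (Fin 2) ℂ)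
    (a : Fin 4 → Fin 2) (x : E3) : ℂ :=
  (1 / 24) * ∑ π : Equiv.Perm (Fin 4),
    sen h K e κ (a (π 0)) (a (π 1)) (a (π 2)) (a (π 3)) x

/-- `κ` is a smooth symmetric spinor `κ_{AB}` on the end with `κ_{AB} = o_∞(r^{3/2})`,
`ξ_{ABCD} = o_∞(r^{-3/2})`, `ξ_{AB} = s √2 p_{AB}/m + o_∞(r^{-1/2})` and
`ξ = s √2 E/m + o_∞(r^{-1/2})`; `s = ±1` is the sign attached to the end. -/
structure HasKillingSpinorAsymptotics (R₀ : ℝ) (h K e : E3 → Matrix (Fin 3) (Fin 3) ℝ)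
    (E : ℝ) (p : Fin 3 → ℝ) (s : ℝ) (κ : E3 → Matrix (Fin 2) (Fin 2) ℂ) : Prop where
  smooth : ∀ A B, ContDiffOn ℝ ∞ (fun x => κ x A B) (endRegion R₀)
  symm : ∀ x ∈ endRegion R₀, (κ x).IsSymm
  decay : ∀ A B, IsLittleInf (3 / 2) (fun x => κ x A B)
  decay_xi4 : ∀ a, IsLittleInf (-3 / 2) (xi4 h K e κ a)
  asymp_xi2 : ∀ A B, IsLittleInf (-1 / 2) (fun x => xi2 h K e κ A B x -
    ((s * Real.sqrt 2 / mass E p : ℝ) : ℂ) * constSpinor p A B)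
  asymp_xi0 : IsLittleInf (-1 / 2) (fun x => xi0 h K e κ x -
    ((s * Real.sqrt 2 * E / mass E p : ℝ) : ℂ))

end KillingSpinorEnd

end

open scoped ENNReal

noncomputable section

namespace KillingSpinorEnd

/-! ## The exterior regions and the weight -/

section Calculus

/-! A symmetric spinor is the same thing as a complex covector, `κ_{CD} = k_j σ^j_{CD}`. The
soldering form is parallel, so in the frame `e` the Sen derivative of `κ` becomes the tensor `T_{ab}
= D_a k_b + (i/√2) (K_a × k)_b`, with `K_a` the rows of the frame components of `K` (`sen_eq`). Then
`ξ` is minus the trace of `T`, `ξ_{AB}` is its antisymmetric part and `ξ_{ABCD}` its trace-free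
symmetric part. The theorem is therefore about covectors that are asymptotically conformal Killing
up to a term in `K`.

Existence. Let `k` be the `h`-dual of `v = c (E x - i√2 p × x - E α n)` with `c = s√2/(3m)`. The
linear part of `v` produces the required limits of `ξ` and `ξ_{AB}`. The trace-free symmetric part
of `T` has to vanish at order `r⁻¹`. By `covGrad_add_swap` the symmetrised gradient of `k` is the
Lie derivative of `h` along `v`. The `r⁻¹` part of `h` is homogeneous of degree `-1` and invariant
under rotations about `p`, so the dilation in `v` reproduces it and the rotation contributes
nothing. In the `K`-term the dilation drops out on symmetrising, and the rotation gives a real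
tensor because the two factors `i` multiply to `-1`. This tensor is matched by the gradient of `α
n`, up to multiples of `δ`, thanks to the relation `E α' = 2β`, where `α'` is the derivative of `α`
in `n·p` (`mul_alphaSlope`, `leading_real`).

Uniqueness. For the difference of two solutions, `T = o_∞(r^{-1/2})` and its trace-free symmetric
part is `o_∞(r^{-3/2})`. Two passes through `D k = ∂k - Γ k` bring this to flat space
(`exists_const_of_senTensor`). There the Saint-Venant identities control the Hessian of the trace of
the symmetrised gradient, hence all second derivatives of `k`, and integrating from infinity leaves
only a constant (`exists_const_of_symGrad`).

Analysis. The classes `o_∞(r^δ)` are weighted `L²` conditions, which do not multiply well by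
themselves. A weighted Sobolev embedding (`IsLittleInf.isSymbol`) turns them into pointwise symbol
bounds, and a symbol times an `o_∞` function is `o_∞`. A weighted Hardy inequality together with the
existence of limits at infinity inverts differentiation (`isLittleInf_of_pd`,
`exists_const_isLittleInf_of_pd`). -/

lemma endRegion_anti {R R' : ℝ} (h : R ≤ R') : endRegion R' ⊆ endRegion R := fun _ hx => lt_of_le_of_lt h hx

/-- Phrasing "near infinity" by a filter on radii lets conditions valid beyond different radii be
combined. -/
lemma eventuallyEq_iff {X : Type*} {f g : E3 → X} : (∃ R, Set.EqOn f g (endRegion R)) ↔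
    ∀ᶠ R in atTop, Set.EqOn f g (endRegion R) := by
  constructor
  · rintro ⟨R, h⟩
    filter_upwards [eventually_ge_atTop R] with R' hR' using h.mono (endRegion_anti hR')
  · exact fun h => h.exists

variable {F G : Type*} [NormedAddCommGroup F] [NormedSpace ℝ F]
  [NormedAddCommGroup G] [NormedSpace ℝ G] {δ δ' R R' : ℝ} {f g : E3 → F}

lemma isOpen_endRegion (R : ℝ) : IsOpen (endRegion R) := isOpen_lt continuous_const continuous_norm

lemma measurableSet_endRegion (R : ℝ) : MeasurableSet (endRegion R) :=
  (isOpen_endRegion R).measurableSet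

lemma one_le_weight (x : E3) : 1 ≤ weight x :=
  Real.one_le_sqrt.2 (by nlinarith [sq_nonneg ‖x‖])

lemma weight_pos (x : E3) : 0 < weight x := zero_lt_one.trans_le (one_le_weight x)

lemma norm_le_weight (x : E3) : ‖x‖ ≤ weight x :=
  Real.le_sqrt_of_sq_le (by linarith)

lemma weight_le_one_add_norm (x : E3) : weight x ≤ 1 + ‖x‖ :=
  Real.sqrt_le_iff.2 ⟨by positivity, by nlinarith [norm_nonneg x]⟩

lemma one_add_norm_le_weight (x : E3) : (1 + ‖x‖) / 2 ≤ weight x :=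
  by linarith [one_le_weight x, norm_le_weight x]

lemma continuous_weight : Continuous weight := by unfold weight; fun_prop

lemma continuous_weight_rpow (a : ℝ) : Continuous fun x => weight x ^ a :=
  continuous_weight.rpow_const fun x => Or.inl (weight_pos x).ne'

/-- Smooth on `|x| > R` with all weighted `L²` norms finite there. -/
def LittleOn (δ : ℝ) (f : E3 → F) (R : ℝ) : Prop :=
  ContDiffOn ℝ ∞ f (endRegion R) ∧ ∀ k : ℕ, IntegrableOn
      (fun x => ‖iteratedFDeriv ℝ k f x‖ ^ 2 * weight x ^ (-2 * (δ - k) - 3)) (endRegion R)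

/-- Smooth on `|x| > R` with `|D^k f| ≤ C_k σ^{δ-k}` there. -/
def SymbolOn (δ : ℝ) (f : E3 → F) (R : ℝ) : Prop :=
  ContDiffOn ℝ ∞ f (endRegion R) ∧ ∀ k : ℕ, ∃ C, 0 ≤ C ∧ ∀ x ∈ endRegion R,
    ‖iteratedFDeriv ℝ k f x‖ ≤ C * weight x ^ (δ - k)

/-- `f` is a symbol of order `δ`: near infinity it is smooth and `D^k f = O(r^{δ-k})`. -/
def IsSymbol (δ : ℝ) (f : E3 → F) : Prop := ∀ᶠ R in atTop, SymbolOn δ f R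

lemma LittleOn.mono (hf : LittleOn δ f R) (h : R ≤ R') : LittleOn δ f R' :=
  ⟨hf.1.mono (endRegion_anti h), fun k => (hf.2 k).mono_set (endRegion_anti h)⟩

lemma SymbolOn.mono (hf : SymbolOn δ f R) (h : R ≤ R') : SymbolOn δ f R' :=
  ⟨hf.1.mono (endRegion_anti h), fun k => by
    obtain ⟨C, hC, hb⟩ := hf.2 k
    exact ⟨C, hC, fun x hx => hb x (endRegion_anti h hx)⟩⟩

/-- The condition passes to larger radii, so one good radius yields all large ones; closure
properties can then be proved at a common radius. -/
lemma isLittleInf_iff : IsLittleInf δ f ↔ ∀ᶠ R in atTop, LittleOn δ f R := by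
  constructor
  · rintro ⟨R, _, h1, h2⟩
    filter_upwards [eventually_ge_atTop R] with R' hR'
    exact LittleOn.mono ⟨h1, h2⟩ hR'
  · intro h
    obtain ⟨R, hR, h1, h2⟩ := ((eventually_gt_atTop 0).and h).exists
    exact ⟨R, hR, h1, h2⟩

lemma SymbolOn.isSymbol (h : SymbolOn δ f R) : IsSymbol δ f := by
  filter_upwards [eventually_ge_atTop R] with R' hR' using h.mono hR'

lemma eqOn_iteratedFDeriv (h : Set.EqOn f g (endRegion R)) (k : ℕ) :
    Set.EqOn (iteratedFDeriv ℝ k f) (iteratedFDeriv ℝ k g) (endRegion R) := fun _ hx =>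
  (((h.eventuallyEq_of_mem ((isOpen_endRegion R).mem_nhds hx))).iteratedFDeriv ℝ k).eq_of_nhds

lemma IsLittleInf.congr (hf : IsLittleInf δ f) (h : Set.EqOn f g (endRegion R)) :
    IsLittleInf δ g := by
  rw [isLittleInf_iff] at *
  filter_upwards [hf, eventuallyEq_iff.1 ⟨R, h⟩] with R hf h
  exact ⟨hf.1.congr fun x hx => (h hx).symm, fun k => (hf.2 k).congr_fun
    (fun x hx => by simp only [eqOn_iteratedFDeriv h k hx]) (measurableSet_endRegion R)⟩

lemma IsSymbol.congr (hf : IsSymbol δ f) (h : Set.EqOn f g (endRegion R)) : IsSymbol δ g := by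
  unfold IsSymbol at *
  filter_upwards [hf, eventuallyEq_iff.1 ⟨R, h⟩] with R hf h
  refine ⟨hf.1.congr fun x hx => (h hx).symm, fun k => ?_⟩
  obtain ⟨C, hC, hb⟩ := hf.2 k
  exact ⟨C, hC, fun x hx => by rw [← eqOn_iteratedFDeriv h k hx]; exact hb x hx⟩

lemma continuousOn_iteratedFDeriv_endRegion (hf : ContDiffOn ℝ ∞ f (endRegion R))
    (k : ℕ) : ContinuousOn (iteratedFDeriv ℝ k f) (endRegion R) :=
  (hf.continuousOn_iteratedFDerivWithin (m := k) (by exact_mod_cast le_top)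
    (isOpen_endRegion R).uniqueDiffOn).congr
    fun _ hx => (iteratedFDerivWithin_of_isOpen k (isOpen_endRegion R) hx).symm

lemma aestronglyMeasurable_weighted (hf : ContDiffOn ℝ ∞ f (endRegion R)) (k : ℕ) (a : ℝ) :
    AEStronglyMeasurable (fun x => ‖iteratedFDeriv ℝ k f x‖ ^ 2 * weight x ^ a)
      (volume.restrict (endRegion R)) :=
  (((continuousOn_iteratedFDeriv_endRegion hf k).norm.pow 2).mul
    (continuous_weight_rpow a).continuousOn).aestronglyMeasurable (measurableSet_endRegion R)

lemma contDiffAt_endRegion (hf : ContDiffOn ℝ ∞ f (endRegion R)) {x : E3}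
    (hx : x ∈ endRegion R) : ContDiffAt ℝ ∞ f x :=
  hf.contDiffAt ((isOpen_endRegion R).mem_nhds hx)

/-- Pointwise domination of all derivatives by those of a function in the class. -/
lemma LittleOn.of_le {g : E3 → G} (hf : LittleOn δ f R) (hg : ContDiffOn ℝ ∞ g (endRegion R))
    (C : ℝ) (h : ∀ k : ℕ, ∀ x ∈ endRegion R,
      ‖iteratedFDeriv ℝ k g x‖ ≤ C * ‖iteratedFDeriv ℝ k f x‖) : LittleOn δ g R := by
  refine ⟨hg, fun k => Integrable.mono' ((hf.2 k).const_mul (C ^ 2))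
    (aestronglyMeasurable_weighted hg k _) ?_⟩
  filter_upwards [ae_restrict_mem (measurableSet_endRegion R)] with x hx
  have hw : 0 ≤ weight x ^ (-2 * (δ - k) - 3) := (Real.rpow_pos_of_pos (weight_pos x) _).le
  rw [Real.norm_of_nonneg (by positivity), ← mul_assoc, ← mul_pow]
  gcongr
  exact h k x hx

/-- Covers partial derivatives (evaluation of the differential), negation and the embedding of `ℝ`
into `ℂ` at one stroke. -/
lemma IsLittleInf.clm_comp (hf : IsLittleInf δ f) (L : F →L[ℝ] G) :
    IsLittleInf δ (fun x => L (f x)) := by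
  rw [isLittleInf_iff] at *
  filter_upwards [hf] with R hf
  exact hf.of_le (L.contDiff.comp_contDiffOn hf.1) ‖L‖ fun k x hx =>
    L.norm_iteratedFDeriv_comp_left (contDiffAt_endRegion hf.1 hx)
      (by exact_mod_cast le_top)

lemma IsSymbol.clm_comp (hf : IsSymbol δ f) (L : F →L[ℝ] G) : IsSymbol δ (fun x => L (f x)) := by
  unfold IsSymbol at *
  filter_upwards [hf] with R hf
  refine ⟨L.contDiff.comp_contDiffOn hf.1, fun k => ?_⟩
  obtain ⟨C, hC, hb⟩ := hf.2 k
  refine ⟨‖L‖ * C, by positivity, fun x hx => ?_⟩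
  refine (L.norm_iteratedFDeriv_comp_left (contDiffAt_endRegion hf.1 hx)
      (by exact_mod_cast le_top)).trans ?_
  rw [mul_assoc]
  gcongr
  exact hb x hx

lemma norm_iteratedFDeriv_add_le (hf : ContDiffOn ℝ ∞ f (endRegion R))
    (hg : ContDiffOn ℝ ∞ g (endRegion R)) (k : ℕ) {x : E3} (hx : x ∈ endRegion R) :
    ‖iteratedFDeriv ℝ k (fun x => f x + g x) x‖ ≤
      ‖iteratedFDeriv ℝ k f x‖ + ‖iteratedFDeriv ℝ k g x‖ := by
  rw [show (fun x => f x + g x) = f + g from rfl,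
    iteratedFDeriv_add_apply ((contDiffAt_endRegion hf hx).of_le
      (by exact_mod_cast le_top)) ((contDiffAt_endRegion hg hx).of_le
      (by exact_mod_cast le_top))]
  exact norm_add_le _ _

lemma IsLittleInf.add (hf : IsLittleInf δ f) (hg : IsLittleInf δ g) :
    IsLittleInf δ (fun x => f x + g x) := by
  rw [isLittleInf_iff] at *
  filter_upwards [hf, hg] with R hf hg
  refine ⟨hf.1.add hg.1, fun k => Integrable.mono' (((hf.2 k).add (hg.2 k)).const_mul 2)
    (aestronglyMeasurable_weighted (hf.1.add hg.1) k _) ?_⟩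
  filter_upwards [ae_restrict_mem (measurableSet_endRegion R)] with x hx
  have hw : 0 ≤ weight x ^ (-2 * (δ - k) - 3) := (Real.rpow_pos_of_pos (weight_pos x) _).le
  rw [Real.norm_of_nonneg (by positivity), Pi.add_apply, ← add_mul, ← mul_assoc]
  gcongr
  have h := norm_iteratedFDeriv_add_le hf.1 hg.1 k hx
  exact (pow_le_pow_left₀ (norm_nonneg _) h 2).trans (by
    nlinarith [sq_nonneg (‖iteratedFDeriv ℝ k f x‖ - ‖iteratedFDeriv ℝ k g x‖)])

lemma IsSymbol.add (hf : IsSymbol δ f) (hg : IsSymbol δ g) :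
    IsSymbol δ (fun x => f x + g x) := by
  unfold IsSymbol at *
  filter_upwards [hf, hg] with R hf hg
  refine ⟨hf.1.add hg.1, fun k => ?_⟩
  obtain ⟨C, hC, hb⟩ := hf.2 k
  obtain ⟨C', hC', hb'⟩ := hg.2 k
  refine ⟨C + C', by positivity, fun x hx => ?_⟩
  rw [add_mul]
  exact (norm_iteratedFDeriv_add_le hf.1 hg.1 k hx).trans (add_le_add (hb x hx) (hb' x hx))

lemma IsLittleInf.neg (hf : IsLittleInf δ f) : IsLittleInf δ (fun x => -f x) := by
  simpa using hf.clm_comp (-ContinuousLinearMap.id ℝ F)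

lemma IsSymbol.neg (hf : IsSymbol δ f) : IsSymbol δ (fun x => -f x) := by
  simpa using hf.clm_comp (-ContinuousLinearMap.id ℝ F)

lemma IsLittleInf.sub (hf : IsLittleInf δ f) (hg : IsLittleInf δ g) :
    IsLittleInf δ (fun x => f x - g x) := by
  simpa only [sub_eq_add_neg] using hf.add hg.neg

lemma IsSymbol.sub (hf : IsSymbol δ f) (hg : IsSymbol δ g) :
    IsSymbol δ (fun x => f x - g x) := by
  simpa only [sub_eq_add_neg] using hf.add hg.neg

lemma symbolOn_zero (δ R : ℝ) : SymbolOn δ (fun _ => (0 : F)) R :=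
  ⟨contDiffOn_const, fun k => ⟨0, le_rfl, fun x _ => by simp⟩⟩

lemma isSymbol_zero (δ : ℝ) : IsSymbol δ (fun _ => (0 : F)) := Eventually.of_forall (symbolOn_zero δ)

lemma isLittleInf_zero (δ : ℝ) : IsLittleInf δ (fun _ => (0 : F)) :=
  isLittleInf_iff.2 (Eventually.of_forall fun _ => ⟨contDiffOn_const, fun k => by
    simp⟩)

lemma IsLittleInf.sum {ι : Type*} (s : Finset ι) {f : ι → E3 → F}
    (hf : ∀ i ∈ s, IsLittleInf δ (f i)) : IsLittleInf δ (fun x => ∑ i ∈ s, f i x) := by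
  classical
  induction s using Finset.induction_on with
  | empty => simpa using isLittleInf_zero δ
  | insert a s ha ih =>
    simp only [Finset.sum_insert ha]
    exact (hf a (by simp)).add (ih fun i hi => hf i (by simp [hi]))

lemma IsSymbol.sum {ι : Type*} (s : Finset ι) {f : ι → E3 → F}
    (hf : ∀ i ∈ s, IsSymbol δ (f i)) : IsSymbol δ (fun x => ∑ i ∈ s, f i x) := by
  classical
  induction s using Finset.induction_on with
  | empty => simpa using isSymbol_zero δ
  | insert a s ha ih =>
    simp only [Finset.sum_insert ha]
    exact (hf a (by simp)).add (ih fun i hi => hf i (by simp [hi]))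

lemma symbolOn_const (c : F) (R : ℝ) : SymbolOn 0 (fun _ => c) R := by
  refine ⟨contDiffOn_const, fun k => ⟨‖c‖, norm_nonneg c, fun x _ => ?_⟩⟩
  rcases Nat.eq_zero_or_pos k with rfl | hk
  · simp
  · rw [iteratedFDeriv_const_of_ne hk.ne']
    simpa using mul_nonneg (norm_nonneg c) (inv_nonneg.2 (pow_nonneg (weight_pos x).le k))

lemma isSymbol_const (c : F) : IsSymbol 0 (fun _ : E3 => c) :=
  Eventually.of_forall (symbolOn_const c)

lemma IsSymbol.mono (hf : IsSymbol δ f) (h : δ ≤ δ') : IsSymbol δ' f := by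
  unfold IsSymbol at *
  filter_upwards [hf] with R hf
  refine ⟨hf.1, fun k => ?_⟩
  obtain ⟨C, hC, hb⟩ := hf.2 k
  exact ⟨C, hC, fun x hx => (hb x hx).trans (mul_le_mul_of_nonneg_left
    (Real.rpow_le_rpow_of_exponent_le (one_le_weight x) (by linarith)) hC)⟩

lemma IsLittleInf.mono (hf : IsLittleInf δ f) (h : δ ≤ δ') : IsLittleInf δ' f := by
  rw [isLittleInf_iff] at *
  filter_upwards [hf] with R hf
  refine ⟨hf.1, fun k => Integrable.mono' (hf.2 k) (aestronglyMeasurable_weighted hf.1 k _) ?_⟩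
  filter_upwards with x
  have hw : 0 ≤ weight x ^ (-2 * (δ' - k) - 3) := (Real.rpow_pos_of_pos (weight_pos x) _).le
  rw [Real.norm_of_nonneg (by positivity)]
  exact mul_le_mul_of_nonneg_left (Real.rpow_le_rpow_of_exponent_le (one_le_weight x)
    (by linarith)) (sq_nonneg _)

/-- A symbol of order `δ` is `o_∞(r^{δ'})` for `δ < δ'`. -/
lemma IsSymbol.isLittleInf (hf : IsSymbol δ f) (h : δ < δ') : IsLittleInf δ' f := by
  rw [isLittleInf_iff]
  filter_upwards [hf] with R hf
  refine ⟨hf.1, fun k => ?_⟩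
  obtain ⟨C, hC, hb⟩ := hf.2 k
  -- The exponent exceeds the dimension 3 by `2(δ' - δ) > 0`, which is where the strict inequality
  -- enters.
  have hint : Integrable (fun x : E3 => (1 + ‖x‖) ^ (-(2 * (δ' - δ) + 3))) :=
    integrable_one_add_norm (by simp; linarith)
  refine Integrable.mono' ((hint.integrableOn (s := endRegion R)).const_mul
    (C ^ 2 * 2 ^ (2 * (δ' - δ) + 3))) (aestronglyMeasurable_weighted hf.1 k _) ?_
  filter_upwards [ae_restrict_mem (measurableSet_endRegion R)] with x hx
  have hw : 0 ≤ weight x ^ (-2 * (δ' - k) - 3) := (Real.rpow_pos_of_pos (weight_pos x) _).le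
  rw [Real.norm_of_nonneg (by positivity)]
  calc ‖iteratedFDeriv ℝ k f x‖ ^ 2 * weight x ^ (-2 * (δ' - k) - 3)
      ≤ (C * weight x ^ (δ - k)) ^ 2 * weight x ^ (-2 * (δ' - k) - 3) := by
        gcongr; exact hb x hx
    _ = C ^ 2 * weight x ^ (-(2 * (δ' - δ) + 3)) := by
        rw [mul_pow, ← Real.rpow_natCast (weight x ^ (δ - k)), ← Real.rpow_mul (weight_pos x).le,
          mul_assoc, ← Real.rpow_add (weight_pos x)]
        congr 2; push_cast; ring
    _ ≤ C ^ 2 * ((1 + ‖x‖) / 2) ^ (-(2 * (δ' - δ) + 3)) := by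
        gcongr C ^ 2 * ?_
        exact Real.rpow_le_rpow_of_nonpos (by positivity) (one_add_norm_le_weight x)
          (by linarith)
    _ = C ^ 2 * 2 ^ (2 * (δ' - δ) + 3) * (1 + ‖x‖) ^ (-(2 * (δ' - δ) + 3)) := by
        rw [Real.div_rpow (by positivity) (by norm_num), Real.rpow_neg (by norm_num : (0:ℝ) ≤ 2)]
        field_simp

/-! ### Derivatives -/

lemma LittleOn.fderiv (hf : LittleOn δ f R) : LittleOn (δ - 1) (fderiv ℝ f) R := by
  refine ⟨hf.1.fderiv_of_isOpen (isOpen_endRegion R) (by simp), fun k => ?_⟩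
  have := hf.2 (k + 1)
  simp only [norm_iteratedFDeriv_fderiv]
  convert this using 5
  push_cast; ring

lemma SymbolOn.fderiv (hf : SymbolOn δ f R) : SymbolOn (δ - 1) (fderiv ℝ f) R := by
  refine ⟨hf.1.fderiv_of_isOpen (isOpen_endRegion R) (by simp), fun k => ?_⟩
  obtain ⟨C, hC, hb⟩ := hf.2 (k + 1)
  refine ⟨C, hC, fun x hx => ?_⟩
  rw [norm_iteratedFDeriv_fderiv]
  convert hb x hx using 3
  push_cast; ring

lemma IsLittleInf.fderiv (hf : IsLittleInf δ f) : IsLittleInf (δ - 1) (fderiv ℝ f) := by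
  rw [isLittleInf_iff] at *
  exact hf.mono fun _ hf => hf.fderiv

lemma IsSymbol.fderiv (hf : IsSymbol δ f) : IsSymbol (δ - 1) (fderiv ℝ f) :=
  Eventually.mono hf fun _ hf => hf.fderiv

lemma IsLittleInf.pd (hf : IsLittleInf δ f) (i : Fin 3) : IsLittleInf (δ - 1) (pd i f) :=
  hf.fderiv.clm_comp (ContinuousLinearMap.apply ℝ F (EuclideanSpace.single i 1))

lemma IsSymbol.pd (hf : IsSymbol δ f) (i : Fin 3) : IsSymbol (δ - 1) (pd i f) :=
  hf.fderiv.clm_comp (ContinuousLinearMap.apply ℝ F (EuclideanSpace.single i 1))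

/-- The differential in terms of the partial derivatives. -/
lemma fderiv_eq_sum_pd (f : E3 → F) (x : E3) :
    _root_.fderiv ℝ f x = ∑ i, ContinuousLinearMap.smulRightL ℝ E3 F
      (EuclideanSpace.proj i : E3 →L[ℝ] ℝ) (KillingSpinorEnd.pd i f x) := by
  ext v
  have hv : v = ∑ i, v i • EuclideanSpace.single i (1 : ℝ) := by
    ext j; simp [Finset.sum_apply, Pi.single_apply]
  conv_lhs => rw [hv]
  simp [KillingSpinorEnd.pd]

lemma isLittleInf_fderiv_of_pd (h : ∀ i, IsLittleInf δ (KillingSpinorEnd.pd i f)) :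
    IsLittleInf δ (_root_.fderiv ℝ f) := by
  rw [show _root_.fderiv ℝ f = fun x => _ from funext (fderiv_eq_sum_pd f)]
  exact IsLittleInf.sum _ fun i _ => (h i).clm_comp _

/-- The norms of order `k + 1` of `f` are those of order `k` of its differential, so only the
undifferentiated norm is an independent condition. The Hardy inequality is what supplies it. -/
lemma LittleOn.of_fderiv (hf : ContDiffOn ℝ ∞ f (endRegion R))
    (h0 : IntegrableOn (fun x => ‖f x‖ ^ 2 * weight x ^ (-2 * δ - 3)) (endRegion R))
    (h1 : LittleOn (δ - 1) (_root_.fderiv ℝ f) R) : LittleOn δ f R := by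
  refine ⟨hf, fun k => ?_⟩
  cases k with
  | zero => simpa using h0
  | succ k =>
    have := h1.2 k
    simp only [norm_iteratedFDeriv_fderiv] at this
    convert this using 5
    push_cast; ring

end Calculus

/-! ### Products -/

section Products

variable {A : Type*} [NormedRing A] [NormedAlgebra ℝ A] {δ δ' R : ℝ} {f g : E3 → A}

lemma norm_iteratedFDeriv_mul_le_endRegion (hf : ContDiffOn ℝ ∞ f (endRegion R))
    (hg : ContDiffOn ℝ ∞ g (endRegion R)) (n : ℕ) {x : E3} (hx : x ∈ endRegion R) :
    ‖iteratedFDeriv ℝ n (fun y => f y * g y) x‖ ≤ ∑ i ∈ Finset.range (n + 1),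
      (n.choose i : ℝ) * ‖iteratedFDeriv ℝ i f x‖ * ‖iteratedFDeriv ℝ (n - i) g x‖ := by
  have := norm_iteratedFDerivWithin_mul_le hf hg (isOpen_endRegion R).uniqueDiffOn hx
    (n := n) (by exact_mod_cast le_top)
  simpa only [iteratedFDerivWithin_of_isOpen _ (isOpen_endRegion R) hx] using this

lemma SymbolOn.mul (hf : SymbolOn δ f R) (hg : SymbolOn δ' g R) :
    SymbolOn (δ + δ') (fun x => f x * g x) R := by
  refine ⟨hf.1.mul hg.1, fun n => ?_⟩
  choose C hC hCb using hf.2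
  choose C' hC' hCb' using hg.2
  refine ⟨∑ i ∈ Finset.range (n + 1), (n.choose i : ℝ) * C i * C' (n - i),
    Finset.sum_nonneg fun i _ => mul_nonneg (mul_nonneg (by positivity) (hC i)) (hC' _),
    fun x hx => (norm_iteratedFDeriv_mul_le_endRegion hf.1 hg.1 n hx).trans ?_⟩
  rw [Finset.sum_mul]
  refine Finset.sum_le_sum fun i hi => ?_
  have hi' : i ≤ n := by simpa [Nat.lt_succ_iff] using hi
  have hw : weight x ^ (δ + δ' - n) = weight x ^ (δ - i) * weight x ^ (δ' - (n - i : ℕ)) := by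
    rw [← Real.rpow_add (weight_pos x)]
    congr 1; push_cast [hi']; ring
  calc (n.choose i : ℝ) * ‖iteratedFDeriv ℝ i f x‖ * ‖iteratedFDeriv ℝ (n - i) g x‖
      ≤ (n.choose i : ℝ) * (C i * weight x ^ (δ - i)) * (C' (n - i) * weight x ^ (δ' - (n - i : ℕ))) := by
        have := hC i
        have := (Real.rpow_pos_of_pos (weight_pos x) (δ - i)).le
        gcongr
        · exact hCb i x hx
        · exact hCb' _ x hx
    _ = _ := by rw [hw]; ring

/-- Leibniz rule, pointwise bounds on the symbol factor, and Cauchy–Schwarz over the `n + 1` terms.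
The square of the symbol bound turns the weight of order `δ + δ' - n` into that of order `δ - i`. -/
lemma LittleOn.mul (hf : LittleOn δ f R) (hg : SymbolOn δ' g R) :
    LittleOn (δ + δ') (fun x => f x * g x) R := by
  refine ⟨hf.1.mul hg.1, fun n => ?_⟩
  choose C hC hCb using hg.2
  have hint : Integrable (fun x => ((n + 1 : ℕ) : ℝ) * ∑ i ∈ Finset.range (n + 1),
      ((n.choose i : ℝ) * C (n - i)) ^ 2 * (‖iteratedFDeriv ℝ i f x‖ ^ 2 *
        weight x ^ (-2 * (δ - i) - 3))) (volume.restrict (endRegion R)) :=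
    (integrable_finsetSum _ fun i _ => (hf.2 i).const_mul _).const_mul _
  refine Integrable.mono' hint (aestronglyMeasurable_weighted (hf.1.mul hg.1) n _) ?_
  filter_upwards [ae_restrict_mem (measurableSet_endRegion R)] with x hx
  have hw : 0 ≤ weight x ^ (-2 * (δ + δ' - n) - 3) := (Real.rpow_pos_of_pos (weight_pos x) _).le
  rw [Real.norm_of_nonneg (by positivity)]
  have h1 := norm_iteratedFDeriv_mul_le_endRegion hf.1 hg.1 n hx
  calc _ ≤ (∑ i ∈ Finset.range (n + 1),
      (n.choose i : ℝ) * ‖iteratedFDeriv ℝ i f x‖ * ‖iteratedFDeriv ℝ (n - i) g x‖) ^ 2 *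
        weight x ^ (-2 * (δ + δ' - n) - 3) := by gcongr
    _ ≤ (((n + 1 : ℕ) : ℝ) * ∑ i ∈ Finset.range (n + 1), ((n.choose i : ℝ) *
      ‖iteratedFDeriv ℝ i f x‖ * ‖iteratedFDeriv ℝ (n - i) g x‖) ^ 2) *
        weight x ^ (-2 * (δ + δ' - n) - 3) := by
        gcongr
        simpa using sq_sum_le_card_mul_sum_sq (s := Finset.range (n + 1)) (f := fun i =>
          (n.choose i : ℝ) * ‖iteratedFDeriv ℝ i f x‖ * ‖iteratedFDeriv ℝ (n - i) g x‖)
    _ ≤ _ := by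
        rw [mul_assoc, Finset.sum_mul]
        refine mul_le_mul_of_nonneg_left (Finset.sum_le_sum fun i hi => ?_) (by positivity)
        have hi' : i ≤ n := by simpa [Nat.lt_succ_iff] using hi
        have hw' : weight x ^ (-2 * (δ - i) - 3) =
            (weight x ^ (δ' - (n - i : ℕ))) ^ 2 * weight x ^ (-2 * (δ + δ' - n) - 3) := by
          rw [← Real.rpow_natCast (weight x ^ (δ' - (n - i : ℕ))),
            ← Real.rpow_mul (weight_pos x).le, ← Real.rpow_add (weight_pos x)]
          congr 1; push_cast [hi']; ring
        calc ((n.choose i : ℝ) * ‖iteratedFDeriv ℝ i f x‖ * ‖iteratedFDeriv ℝ (n - i) g x‖) ^ 2 *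
              weight x ^ (-2 * (δ + δ' - n) - 3)
            ≤ ((n.choose i : ℝ) * ‖iteratedFDeriv ℝ i f x‖ *
              (C (n - i) * weight x ^ (δ' - (n - i : ℕ)))) ^ 2 *
              weight x ^ (-2 * (δ + δ' - n) - 3) := by
              gcongr
              exact hCb _ x hx
          _ = _ := by rw [hw']; ring

lemma IsSymbol.mul (hf : IsSymbol δ f) (hg : IsSymbol δ' g) :
    IsSymbol (δ + δ') (fun x => f x * g x) := by
  unfold IsSymbol at *
  filter_upwards [hf, hg] with R hf hg using hf.mul hg

lemma IsLittleInf.mul_isSymbol (hf : IsLittleInf δ f) (hg : IsSymbol δ' g) :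
    IsLittleInf (δ + δ') (fun x => f x * g x) := by
  unfold IsSymbol at *
  rw [isLittleInf_iff] at *
  filter_upwards [hf, hg] with R hf hg using hf.mul hg

end Products

/-! ## Homogeneous functions -/

/-- Comparable positive quantities have comparable powers; `|b|` treats both signs of the exponent.
It is used to exchange `‖x‖`, `weight x` and a local radius. -/
lemma rpow_le_mul_rpow {u v c : ℝ} (hu : 0 < u) (hv : 0 < v) (hc : 1 ≤ c) (h1 : u ≤ c * v)
    (h2 : v ≤ c * u) (b : ℝ) : u ^ b ≤ c ^ |b| * v ^ b := by
  have hc0 : 0 < c := by linarith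
  rcases le_total 0 b with hb | hb
  · rw [abs_of_nonneg hb, ← Real.mul_rpow hc0.le hv.le]
    exact Real.rpow_le_rpow hu.le h1 hb
  · have h3 : v / c ≤ u := by rwa [div_le_iff₀' hc0]
    rw [abs_of_nonpos hb, Real.rpow_neg hc0.le, ← div_eq_inv_mul, ← Real.div_rpow hv.le hc0.le]
    exact Real.rpow_le_rpow_of_nonpos (by positivity) h3 hb

lemma weight_le_two_mul_norm {x : E3} (hx : 1 ≤ ‖x‖) : weight x ≤ 2 * ‖x‖ :=
  (weight_le_one_add_norm x).trans (by linarith)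

section Homogeneous

universe u

/-- All derivatives of a homogeneous function of degree `a` decay like powers of `|x|`. -/
lemma exists_norm_iteratedFDeriv_le_of_homogeneous (k : ℕ) :
    ∀ {F : Type u} [NormedAddCommGroup F] [NormedSpace ℝ F] {f : E3 → F} {a : ℝ},
    ContDiffOn ℝ ∞ f {0}ᶜ → (∀ c : ℝ, 0 < c → ∀ x ≠ 0, f (c • x) = c ^ a • f x) →
    ∃ C, 0 ≤ C ∧ ∀ x ≠ 0, ‖iteratedFDeriv ℝ k f x‖ ≤ C * ‖x‖ ^ (a - k) := by
  induction k with
  | zero =>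
    intro F _ _ f a hf hh
    obtain ⟨C, hC⟩ := (isCompact_sphere (0 : E3) 1).exists_bound_of_continuousOn
      (hf.continuousOn.mono fun x hx => by
        rintro rfl; simp at hx)
    refine ⟨max C 0, le_max_right _ _, fun x hx => ?_⟩
    have hx' : 0 < ‖x‖ := norm_pos_iff.2 hx
    have hs : ‖x‖⁻¹ • x ∈ Metric.sphere (0 : E3) 1 := by
      simp [norm_smul, hx'.ne']
    have h1 : f x = ‖x‖ ^ a • f (‖x‖⁻¹ • x) := by
      rw [← hh _ hx' _ (smul_ne_zero (inv_ne_zero hx'.ne') hx), smul_inv_smul₀ hx'.ne']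
    rw [norm_iteratedFDeriv_zero, h1, norm_smul,
      Real.norm_of_nonneg (Real.rpow_nonneg hx'.le _), mul_comm]
    simp only [CharP.cast_eq_zero, sub_zero]
    gcongr
    exact (hC _ hs).trans (le_max_left _ _)
  | succ k ih =>
    intro F _ _ f a hf hh
    have ho : IsOpen ({0}ᶜ : Set E3) := isOpen_compl_singleton
    obtain ⟨C, hC, hb⟩ := ih (f := fderiv ℝ f) (a := a - 1) (hf.fderiv_of_isOpen ho (by simp)) (by
      -- Differentiating `f (c x) = c^a f x` shows that the differential is homogeneous of degree `a
      -- - 1`. The induction is over all codomains because the differential takes values in a new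
      -- space.
      intro c hc x hx
      have h1 : (fun y => f (c • y)) =ᶠ[𝓝 x] fun y => c ^ a • f y := by
        filter_upwards [ho.mem_nhds hx] with y hy using hh c hc y hy
      have h2 := h1.fderiv_eq (𝕜 := ℝ)
      have h3 : fderiv ℝ (fun y => f (c • y)) x = c • fderiv ℝ f (c • x) :=
        fderiv_comp_smul (f := f) (x := x) c
      rw [h3, fderiv_fun_const_smul ((hf.contDiffAt (ho.mem_nhds hx)).differentiableAt
        (by simp))] at h2
      rw [Real.rpow_sub hc, Real.rpow_one, div_eq_inv_mul, mul_smul, ← h2,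
        inv_smul_smul₀ hc.ne'])
    refine ⟨C, hC, fun x hx => ?_⟩
    rw [← norm_iteratedFDeriv_fderiv]
    convert hb x hx using 3
    push_cast; ring

/-- A smooth homogeneous function of degree `a` is a symbol of order `a`. -/
lemma isSymbol_of_homogeneous {F : Type u} [NormedAddCommGroup F] [NormedSpace ℝ F] {f : E3 → F}
    {a : ℝ} (hf : ContDiffOn ℝ ∞ f {0}ᶜ) (hh : ∀ c : ℝ, 0 < c → ∀ x ≠ 0, f (c • x) = c ^ a • f x) :
    IsSymbol a f := by
  refine SymbolOn.isSymbol (R := 1) ⟨hf.mono fun x hx => ?_, fun k => ?_⟩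
  · rintro rfl; simp [endRegion] at hx; linarith
  · obtain ⟨C, hC, hb⟩ := exists_norm_iteratedFDeriv_le_of_homogeneous k hf hh
    refine ⟨C * 2 ^ |a - k|, by positivity, fun x (hx : 1 < ‖x‖) => ?_⟩
    have hx0 : x ≠ 0 := by rintro rfl; simp at hx; linarith
    refine (hb x hx0).trans ?_
    rw [mul_assoc]
    gcongr
    exact rpow_le_mul_rpow (by linarith) (weight_pos x) (by norm_num)
      (by linarith [norm_le_weight x]) (weight_le_two_mul_norm hx.le) _

end Homogeneous

/-! ## Polar coordinates -/

open scoped ENNReal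

/-- Transport along the homeomorphism of the punctured space with sphere times half-line; `t ^ 2` is
`t` to the dimension minus one. The Lebesgue form avoids integrability hypotheses. -/
lemma lintegral_polar {f : E3 → ℝ≥0∞} (hf : Measurable f) :
    ∫⁻ x, f x = ∫⁻ z : Metric.sphere (0 : E3) 1, (∫⁻ t in Set.Ioi (0 : ℝ),
      ENNReal.ofReal (t ^ 2) * f (t • (z : E3))) ∂((volume : Measure E3).toSphere) := by
  have hmp := (volume : Measure E3).measurePreserving_homeomorphUnitSphereProd
  have hm2 : Measurable fun z : Metric.sphere (0 : E3) 1 × Set.Ioi (0 : ℝ) =>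
      f ((z.2 : ℝ) • (z.1 : E3)) := hf.comp (by fun_prop)
  calc ∫⁻ x, f x = ∫⁻ x in ({0}ᶜ : Set E3), f x := by rw [restrict_compl_singleton]
    _ = ∫⁻ x : ({0}ᶜ : Set E3), f x ∂(Measure.comap Subtype.val volume) :=
        (lintegral_subtype_comap (measurableSet_singleton _).compl f).symm
    _ = ∫⁻ z, f ((z.2 : ℝ) • (z.1 : E3)) ∂((volume : Measure E3).toSphere.prod
          (Measure.volumeIoiPow (Module.finrank ℝ E3 - 1))) := by
        rw [← hmp.lintegral_comp hm2]
        refine lintegral_congr fun x => ?_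
        congr 1
        have hx : ‖(x : E3)‖ ≠ 0 := norm_ne_zero_iff.2 x.2
        simp [homeomorphUnitSphereProd, smul_smul, hx]
    _ = _ := by
        rw [lintegral_prod _ hm2.aemeasurable]
        refine lintegral_congr fun z => ?_
        have hm1 : Measurable fun t : Set.Ioi (0 : ℝ) => f ((t : ℝ) • (z : E3)) :=
          hf.comp (by fun_prop)
        rw [Measure.volumeIoiPow, lintegral_withDensity_eq_lintegral_mul _ (by fun_prop) hm1]
        simp only [Pi.mul_apply]
        rw [lintegral_subtype_comap measurableSet_Ioi (fun t : ℝ =>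
          ENNReal.ofReal (t ^ (Module.finrank ℝ E3 - 1)) * f (t • (z : E3)))]
        simp

/-! ## The weighted Sobolev embedding -/

lemma hasDerivAt_comp_add_smul {F : Type*} [NormedAddCommGroup F] [NormedSpace ℝ F] {f : E3 → F}
    {x z : E3} {t : ℝ} {f' : E3 →L[ℝ] F}
    (hf : HasFDerivAt f f' (x + t • z)) : HasDerivAt (fun s : ℝ => f (x + s • z)) (f' z) t := by
  have h : HasDerivAt (fun s : ℝ => x + s • z) z t := by
    simpa using ((hasDerivAt_id t).smul_const z).const_add x
  exact hf.comp_hasDerivAt t h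

lemma norm_iteratedFDeriv_fderiv_apply_le {F : Type*} [NormedAddCommGroup F] [NormedSpace ℝ F]
    {f : E3 → F} {x z : E3} (hf : ContDiffAt ℝ ∞ (fderiv ℝ f) x) (hz : ‖z‖ = 1) (k : ℕ) :
    ‖iteratedFDeriv ℝ k (fun y => fderiv ℝ f y z) x‖ ≤ ‖iteratedFDeriv ℝ (k + 1) f x‖ := by
  have h1 := (ContinuousLinearMap.apply ℝ F z).norm_iteratedFDeriv_comp_left hf (n := k)
    (by exact_mod_cast le_top)
  have h2 : ‖ContinuousLinearMap.apply ℝ F z‖ ≤ 1 :=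
    ContinuousLinearMap.opNorm_le_bound _ zero_le_one fun L => by
      simpa [hz] using L.le_opNorm z
  rw [norm_iteratedFDeriv_fderiv] at h1
  exact h1.trans (mul_le_of_le_one_left (norm_nonneg _) h2)

section Sobolev

variable {F : Type*} [NormedAddCommGroup F] [NormedSpace ℝ F] [CompleteSpace F]

/-- Multiply `w` by the cutoff `(1 - t/a)^3`, which vanishes to third order at `a`, and integrate
the third derivative of the product against `t²/2`. The factor `t²` is the radial density in
dimension three, so integrating over directions gives a volume integral. -/
lemma norm_le_integral_of_hasDerivAt {w w₁ w₂ w₃ : ℝ → F} {a : ℝ} (ha : 0 < a)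
    (h0 : ∀ t ∈ Set.Icc 0 a, HasDerivAt w (w₁ t) t) (h1 : ∀ t ∈ Set.Icc 0 a, HasDerivAt w₁ (w₂ t) t)
    (h2 : ∀ t ∈ Set.Icc 0 a, HasDerivAt w₂ (w₃ t) t) (h3 : ContinuousOn w₃ (Set.Icc 0 a)) :
    ‖w 0‖ ≤ ∫ t in (0 : ℝ)..a, t ^ 2 *
      (9 * (a⁻¹ ^ 3 * ‖w t‖ + a⁻¹ ^ 2 * ‖w₁ t‖ + a⁻¹ * ‖w₂ t‖ + ‖w₃ t‖)) := by
  set φ : ℝ → ℝ := fun t => (1 - t * a⁻¹) ^ 3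
  set φ₁ : ℝ → ℝ := fun t => -3 * a⁻¹ * (1 - t * a⁻¹) ^ 2
  set φ₂ : ℝ → ℝ := fun t => 6 * a⁻¹ ^ 2 * (1 - t * a⁻¹)
  have hl (t : ℝ) : HasDerivAt (fun t => 1 - t * a⁻¹) (-a⁻¹) t := by
    simpa using ((hasDerivAt_id t).mul_const a⁻¹).const_sub 1
  have hφ (t : ℝ) : HasDerivAt φ (φ₁ t) t := by
    refine ((hl t).pow 3).congr_deriv ?_; simp only [φ₁]; push_cast; ring
  have hφ₁ (t : ℝ) : HasDerivAt φ₁ (φ₂ t) t := by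
    refine (((hl t).pow 2).const_mul (-3 * a⁻¹)).congr_deriv ?_; simp only [φ₂]; push_cast; ring
  have hφ₂ (t : ℝ) : HasDerivAt φ₂ (-6 * a⁻¹ ^ 3) t := by
    refine ((hl t).const_mul (6 * a⁻¹ ^ 2)).congr_deriv ?_; ring
  set g : ℝ → F := fun t => φ t • w t
  set g₁ : ℝ → F := fun t => φ t • w₁ t + φ₁ t • w t
  set g₂ : ℝ → F := fun t => (φ t • w₂ t + φ₁ t • w₁ t) + (φ₁ t • w₁ t + φ₂ t • w t)
  set g₃ : ℝ → F := fun t => ((φ t • w₃ t + φ₁ t • w₂ t) + (φ₁ t • w₂ t + φ₂ t • w₁ t)) +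
    ((φ₁ t • w₂ t + φ₂ t • w₁ t) + (φ₂ t • w₁ t + (-6 * a⁻¹ ^ 3) • w t))
  -- The derivative telescopes to `(t²/2) g₃`, with `P 0 = w 0` and `P a = 0`.
  set P : ℝ → F := fun t => (t ^ 2 / 2) • g₂ t - t • g₁ t + g t
  have hP : ∀ t ∈ Set.uIcc 0 a, HasDerivAt P ((t ^ 2 / 2) • g₃ t) t := by
    intro t ht
    rw [Set.uIcc_of_le ha.le] at ht
    have hg : HasDerivAt g (g₁ t) t := (hφ t).smul (h0 t ht)
    have hg₁ : HasDerivAt g₁ (g₂ t) t :=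
      ((hφ t).smul (h1 t ht)).add ((hφ₁ t).smul (h0 t ht))
    have hg₂ : HasDerivAt g₂ (g₃ t) t :=
      (((hφ t).smul (h2 t ht)).add ((hφ₁ t).smul (h1 t ht))).add
        (((hφ₁ t).smul (h1 t ht)).add ((hφ₂ t).smul (h0 t ht)))
    have ht2 : HasDerivAt (fun t : ℝ => t ^ 2 / 2) t t := by
      refine (((hasDerivAt_id t).pow 2).div_const 2).congr_deriv ?_; simp
    refine (((ht2.smul hg₂).sub ((hasDerivAt_id t).smul hg₁)).add hg).congr_deriv ?_
    simp only [id]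
    module
  have hc0 : ContinuousOn w (Set.Icc 0 a) := fun t ht => (h0 t ht).continuousAt.continuousWithinAt
  have hc1 : ContinuousOn w₁ (Set.Icc 0 a) := fun t ht => (h1 t ht).continuousAt.continuousWithinAt
  have hc2 : ContinuousOn w₂ (Set.Icc 0 a) := fun t ht => (h2 t ht).continuousAt.continuousWithinAt
  have hint : IntervalIntegrable (fun t => (t ^ 2 / 2) • g₃ t) volume 0 a := by
    apply ContinuousOn.intervalIntegrable
    rw [Set.uIcc_of_le ha.le]
    fun_prop
  have key := intervalIntegral.integral_eq_sub_of_hasDerivAt hP hint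
  have hPa : P a = 0 := by
    have : 1 - a * a⁻¹ = 0 := by field_simp; ring
    simp [P, g, g₁, g₂, φ, φ₁, φ₂, this]
  have hP0 : P 0 = w 0 := by simp [P, g, φ]
  rw [hPa, hP0, zero_sub] at key
  rw [← norm_neg, ← key]
  refine intervalIntegral.norm_integral_le_of_norm_le ha.le ?_ ?_
  · filter_upwards with t ht
    have hs0 : 0 ≤ 1 - t * a⁻¹ := by
      rw [sub_nonneg, ← div_eq_mul_inv, div_le_one ha]; exact ht.2
    have hs1 : 1 - t * a⁻¹ ≤ 1 := by
      have := ht.1; simp; positivity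
    have ha' : 0 < a⁻¹ := by positivity
    have hn : ‖φ t‖ ≤ 1 := by
      rw [Real.norm_of_nonneg (by positivity)]; exact pow_le_one₀ hs0 hs1
    have hn1 : ‖φ₁ t‖ ≤ 3 * a⁻¹ := by
      simp only [φ₁, norm_mul, norm_neg, norm_pow, Real.norm_of_nonneg hs0,
        Real.norm_of_nonneg ha'.le]
      norm_num
      exact mul_le_of_le_one_right (by positivity) (pow_le_one₀ hs0 hs1)
    have hn2 : ‖φ₂ t‖ ≤ 6 * a⁻¹ ^ 2 := by
      simp only [φ₂, norm_mul, norm_pow, Real.norm_of_nonneg hs0, Real.norm_of_nonneg ha'.le]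
      norm_num
      exact mul_le_of_le_one_right (by positivity) hs1
    have hn3 : ‖-6 * a⁻¹ ^ 3‖ = 6 * a⁻¹ ^ 3 := by
      simp [abs_of_pos ha]
    -- By Leibniz the coefficients are `6, 3·6, 3·3, 1`; after the factor `1/2` all are at most the
    -- `9` of the statement.
    have hg₃ : ‖g₃ t‖ ≤ 6 * a⁻¹ ^ 3 * ‖w t‖ + 18 * a⁻¹ ^ 2 * ‖w₁ t‖ + 9 * a⁻¹ * ‖w₂ t‖ + ‖w₃ t‖ := by
      have e : g₃ t = φ t • w₃ t + (3 : ℝ) • φ₁ t • w₂ t + (3 : ℝ) • φ₂ t • w₁ t +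
        (-6 * a⁻¹ ^ 3) • w t := by simp only [g₃]; module
      rw [e]
      refine norm_add₄_le.trans ?_
      simp only [norm_smul, hn3]
      have e1 : ‖φ t‖ * ‖w₃ t‖ ≤ 1 * ‖w₃ t‖ := by gcongr
      have e2 : ‖(3 : ℝ)‖ * (‖φ₁ t‖ * ‖w₂ t‖) ≤ 3 * (3 * a⁻¹ * ‖w₂ t‖) := by
        rw [Real.norm_of_nonneg (by norm_num)]; gcongr
      have e3 : ‖(3 : ℝ)‖ * (‖φ₂ t‖ * ‖w₁ t‖) ≤ 3 * (6 * a⁻¹ ^ 2 * ‖w₁ t‖) := by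
        rw [Real.norm_of_nonneg (by norm_num)]; gcongr
      linarith
    rw [norm_smul, Real.norm_of_nonneg (by positivity), div_mul_eq_mul_div, mul_div_assoc]
    gcongr
    have q0 : 0 ≤ a⁻¹ ^ 3 * ‖w t‖ := by positivity
    have q1 : 0 ≤ a⁻¹ ^ 2 * ‖w₁ t‖ := by positivity
    have q2 : 0 ≤ a⁻¹ * ‖w₂ t‖ := by positivity
    have q3 : 0 ≤ ‖w₃ t‖ := by positivity
    linarith
  · apply ContinuousOn.intervalIntegrable
    rw [Set.uIcc_of_le ha.le]
    fun_prop

/-- A quantitative local Sobolev inequality in three dimensions. -/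
lemma norm_le_integral_ball {f : E3 → F} {U : Set E3} (hU : IsOpen U) (hf : ContDiffOn ℝ ∞ f U)
    {x : E3} {a : ℝ} (ha : 0 < a) (hx : Metric.closedBall x a ⊆ U) :
    ‖f x‖ * (volume : Measure E3).toSphere.real Set.univ ≤ ∫ y in Metric.closedBall x a,
      9 * (a⁻¹ ^ 3 * ‖iteratedFDeriv ℝ 0 f y‖ + a⁻¹ ^ 2 * ‖iteratedFDeriv ℝ 1 f y‖ +
        a⁻¹ * ‖iteratedFDeriv ℝ 2 f y‖ + ‖iteratedFDeriv ℝ 3 f y‖) := by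
  set Φ : E3 → ℝ := fun y => 9 * (a⁻¹ ^ 3 * ‖iteratedFDeriv ℝ 0 f y‖ +
    a⁻¹ ^ 2 * ‖iteratedFDeriv ℝ 1 f y‖ + a⁻¹ * ‖iteratedFDeriv ℝ 2 f y‖ + ‖iteratedFDeriv ℝ 3 f y‖)
  have hc (k : ℕ) : ContinuousOn (iteratedFDeriv ℝ k f) U :=
    (hf.continuousOn_iteratedFDerivWithin (m := k) (by exact_mod_cast le_top)
      hU.uniqueDiffOn).congr fun _ hy => (iteratedFDerivWithin_of_isOpen k hU hy).symm
  have hΦc : ContinuousOn Φ (Metric.closedBall x a) := by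
    have h0 := (hc 0).mono hx
    have h1 := (hc 1).mono hx
    have h2 := (hc 2).mono hx
    have h3 := (hc 3).mono hx
    fun_prop
  have hΦ0 (y : E3) : 0 ≤ Φ y := by positivity
  have hΦi : IntegrableOn Φ (Metric.closedBall x a) :=
    hΦc.integrableOn_compact (isCompact_closedBall x a)
  set Ψ : E3 → ℝ≥0∞ := (Metric.closedBall x a).indicator fun y => ENNReal.ofReal (Φ y)
  have hΨm : Measurable Ψ := by
    classical
    rw [show Ψ = _ from (Set.piecewise_eq_indicator).symm]
    exact (ENNReal.continuous_ofReal.comp_continuousOn hΦc).measurable_piecewise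
      continuousOn_const Metric.isClosed_closedBall.measurableSet
  have hΨ : ∫⁻ y, Ψ y = ENNReal.ofReal (∫ y in Metric.closedBall x a, Φ y) := by
    rw [ofReal_integral_eq_lintegral_ofReal hΦi (Eventually.of_forall hΦ0),
      ← lintegral_indicator Metric.isClosed_closedBall.measurableSet]
  -- The one-dimensional estimate along the ray from `x` in direction `z`, with directional
  -- derivatives dominated by the full ones.
  have hray (z : Metric.sphere (0 : E3) 1) : ENNReal.ofReal ‖f x‖ ≤
      ∫⁻ t in Set.Ioi (0 : ℝ), ENNReal.ofReal (t ^ 2) * Ψ (x + t • (z : E3)) := by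
    have hz : ‖(z : E3)‖ = 1 := by simp
    have hmem (t : ℝ) (ht : t ∈ Set.Icc 0 a) : x + t • (z : E3) ∈ Metric.closedBall x a := by
      simp [norm_smul, hz, abs_of_nonneg ht.1, ht.2]
    have hdf (t : ℝ) (ht : t ∈ Set.Icc 0 a) : ContDiffAt ℝ ∞ f (x + t • (z : E3)) :=
      hf.contDiffAt (hU.mem_nhds (hx (hmem t ht)))
    set f₁ : E3 → F := fun y => fderiv ℝ f y z
    set f₂ : E3 → F := fun y => fderiv ℝ f₁ y z
    set f₃ : E3 → F := fun y => fderiv ℝ f₂ y z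
    have hd {g : E3 → F} (hg : ContDiffOn ℝ ∞ g U) : ContDiffOn ℝ ∞ (fun y => fderiv ℝ g y z) U :=
      (hg.fderiv_of_isOpen hU (by simp)).clm_apply contDiffOn_const
    have hd1 : ContDiffOn ℝ ∞ f₁ U := hd hf
    have hd2 : ContDiffOn ℝ ∞ f₂ U := hd hd1
    have hd3 : ContDiffOn ℝ ∞ f₃ U := hd hd2
    have hdiff {g : E3 → F} (hg : ContDiffOn ℝ ∞ g U) (t : ℝ) (ht : t ∈ Set.Icc 0 a) :
        HasDerivAt (fun s : ℝ => g (x + s • (z : E3))) (fderiv ℝ g (x + t • (z : E3)) z) t :=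
      hasDerivAt_comp_add_smul
        ((hg.contDiffAt (hU.mem_nhds (hx (hmem t ht)))).differentiableAt (by simp)).hasFDerivAt
    have hcont {g : E3 → F} (hg : ContDiffOn ℝ ∞ g U) :
        ContinuousOn (fun t : ℝ => g (x + t • (z : E3))) (Set.Icc 0 a) :=
      hg.continuousOn.comp (by fun_prop) fun t ht => hx (hmem t ht)
    have key := norm_le_integral_of_hasDerivAt ha (hdiff hf) (hdiff hd1) (hdiff hd2) (hcont hd3)
    have hle {g : E3 → F} (hg : ContDiffOn ℝ ∞ g U) (k : ℕ) (t : ℝ) (ht : t ∈ Set.Icc 0 a) :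
        ‖iteratedFDeriv ℝ k (fun y => fderiv ℝ g y z) (x + t • (z : E3))‖ ≤
          ‖iteratedFDeriv ℝ (k + 1) g (x + t • (z : E3))‖ :=
      norm_iteratedFDeriv_fderiv_apply_le ((hg.fderiv_of_isOpen (m := ∞) hU (by simp)).contDiffAt
        (hU.mem_nhds (hx (hmem t ht)))) hz k
    have hb (t : ℝ) (ht : t ∈ Set.Icc 0 a) : t ^ 2 * (9 * (a⁻¹ ^ 3 * ‖f (x + t • (z : E3))‖ +
        a⁻¹ ^ 2 * ‖f₁ (x + t • (z : E3))‖ + a⁻¹ * ‖f₂ (x + t • (z : E3))‖ +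
        ‖f₃ (x + t • (z : E3))‖)) ≤ t ^ 2 * Φ (x + t • (z : E3)) := by
      have e1 : ‖f₁ (x + t • (z : E3))‖ ≤ ‖iteratedFDeriv ℝ 1 f (x + t • (z : E3))‖ := by
        simpa using hle hf 0 t ht
      have e2 : ‖f₂ (x + t • (z : E3))‖ ≤ ‖iteratedFDeriv ℝ 2 f (x + t • (z : E3))‖ := by
        simpa using (hle hd1 0 t ht).trans (hle hf 1 t ht)
      have e3 : ‖f₃ (x + t • (z : E3))‖ ≤ ‖iteratedFDeriv ℝ 3 f (x + t • (z : E3))‖ := by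
        simpa using ((hle hd2 0 t ht).trans (hle hd1 1 t ht)).trans (hle hf 2 t ht)
      simp only [Φ, norm_iteratedFDeriv_zero]
      gcongr
    have hcomp : ContinuousOn (fun t : ℝ => t ^ 2 * Φ (x + t • (z : E3))) (Set.Icc 0 a) := by
      have : ContinuousOn (fun t : ℝ => Φ (x + t • (z : E3))) (Set.Icc 0 a) :=
        hΦc.comp (by fun_prop) hmem
      exact (continuousOn_id.pow 2).mul this
    have key2 : ‖f x‖ ≤ ∫ t in Set.Ioc 0 a, t ^ 2 * Φ (x + t • (z : E3)) := by
      rw [← intervalIntegral.integral_of_le ha.le]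
      have h0 : f x = (fun t : ℝ => f (x + t • (z : E3))) 0 := by simp
      rw [h0]
      refine key.trans (intervalIntegral.integral_mono_on ha.le ?_ ?_ hb)
      · apply ContinuousOn.intervalIntegrable
        rw [Set.uIcc_of_le ha.le]
        exact (continuousOn_id.pow 2).mul (continuousOn_const.mul
          ((((continuousOn_const.mul (hcont hf).norm).add
          (continuousOn_const.mul (hcont hd1).norm)).add
          (continuousOn_const.mul (hcont hd2).norm)).add (hcont hd3).norm))
      · apply ContinuousOn.intervalIntegrable
        rwa [Set.uIcc_of_le ha.le]
    calc ENNReal.ofReal ‖f x‖ ≤ ENNReal.ofReal (∫ t in Set.Ioc 0 a, t ^ 2 * Φ (x + t • (z : E3))) :=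
          ENNReal.ofReal_le_ofReal key2
      _ = ∫⁻ t in Set.Ioc 0 a, ENNReal.ofReal (t ^ 2 * Φ (x + t • (z : E3))) :=
          ofReal_integral_eq_lintegral_ofReal ((hcomp.integrableOn_Icc).mono_set
            Set.Ioc_subset_Icc_self) (Eventually.of_forall fun t => mul_nonneg (sq_nonneg _) (hΦ0 _))
      _ = ∫⁻ t in Set.Ioc 0 a, ENNReal.ofReal (t ^ 2) * Ψ (x + t • (z : E3)) := by
          refine setLIntegral_congr_fun measurableSet_Ioc fun t ht => ?_
          have : Ψ (x + t • (z : E3)) = ENNReal.ofReal (Φ (x + t • (z : E3))) :=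
            Set.indicator_of_mem (hmem t (Set.Ioc_subset_Icc_self ht)) _
          simp only [this]
          rw [ENNReal.ofReal_mul (sq_nonneg t)]
      _ ≤ _ := lintegral_mono_set fun t ht => ht.1
  -- Polar coordinates centred at `x`; the translation is removed by invariance of the measure.
  have hpolar := lintegral_polar (f := fun y => Ψ (x + y)) (hΨm.comp (by fun_prop))
  rw [lintegral_add_left_eq_self Ψ x, hΨ] at hpolar
  have hfin : ENNReal.ofReal ‖f x‖ * (volume : Measure E3).toSphere Set.univ ≤
      ENNReal.ofReal (∫ y in Metric.closedBall x a, Φ y) := by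
    rw [hpolar, ← lintegral_const]
    exact lintegral_mono hray
  have h2 := ENNReal.toReal_mono ENNReal.ofReal_ne_top hfin
  rwa [ENNReal.toReal_mul, ENNReal.toReal_ofReal (norm_nonneg _),
    ENNReal.toReal_ofReal (integral_nonneg hΦ0)] at h2

end Sobolev

/-! ### Pointwise decay from weighted square integrability -/

section Embedding

universe u

/-- Apply the local Sobolev inequality on a ball around `x` of radius proportional to `‖x‖`. The
weight is comparable to that radius throughout the ball, so the scaling of the local inequality
becomes the factor `weight x ^ δ`. -/
lemma LittleOn.exists_norm_le {F : Type*} [NormedAddCommGroup F] [NormedSpace ℝ F]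
    [CompleteSpace F] {f : E3 → F} {δ R : ℝ} (hR : 1 ≤ R) (hf : LittleOn δ f R) :
    ∃ C, 0 ≤ C ∧ ∀ x ∈ endRegion (2 * R), ‖f x‖ ≤ C * weight x ^ δ := by
  set S := (volume : Measure E3).toSphere.real Set.univ
  have hS : 0 < S := by
    refine ENNReal.toReal_pos ?_ (measure_ne_top _ _)
    rw [Ne, Measure.measure_univ_eq_zero]
    exact Measure.toSphere_ne_zero _
  set V := (volume : Measure E3).real (Metric.closedBall 0 1)
  set I : ℕ → ℝ := fun j =>
    ∫ y in endRegion R, ‖iteratedFDeriv ℝ j f y‖ ^ 2 * weight y ^ (-2 * (δ - j) - 3)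
  set c : ℕ → ℝ := fun j => 9 ^ |-(-2 * (δ - j) - 3)|
  have hI (j : ℕ) : 0 ≤ I j := integral_nonneg fun y =>
    mul_nonneg (sq_nonneg _) (Real.rpow_pos_of_pos (weight_pos y) _).le
  set C₀ := 9 * (2 * V + (c 0 * I 0 + c 1 * I 1 + c 2 * I 2 + c 3 * I 3) / 2)
  have hC₀ : 0 ≤ C₀ := by
    have := hI 0; have := hI 1; have := hI 2; have := hI 3
    positivity
  refine ⟨S⁻¹ * (C₀ * 9 ^ |δ|), by positivity, fun x (hx : 2 * R < ‖x‖) => ?_⟩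
  -- On the ball of radius `a` one has `3a ≤ ‖y‖ ≤ 5a`, so it stays in `endRegion R`; and `a > 1/2`
  -- gives `weight y ≤ 7a`, whence the crude comparison constant 9.
  set a := ‖x‖ / 4 with ha'
  have ha : 0 < a := by linarith
  have hxa : ‖x‖ = 4 * a := by linarith
  have hball (y) (hy : y ∈ Metric.closedBall x a) : 3 * a ≤ ‖y‖ ∧ ‖y‖ ≤ 5 * a := by
    rw [mem_closedBall_iff_norm] at hy
    have h1 := norm_sub_norm_le x y
    have h2 := norm_sub_norm_le y x
    rw [norm_sub_rev] at h1
    constructor <;> linarith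
  have hsub : Metric.closedBall x a ⊆ endRegion R := fun y hy => by
    have := (hball y hy).1
    simp only [endRegion, Set.mem_ofPred_eq]; linarith
  have key := norm_le_integral_ball (isOpen_endRegion R) hf.1 ha hsub
  set w : ℕ → E3 → ℝ := fun j y => ‖iteratedFDeriv ℝ j f y‖ ^ 2 * weight y ^ (-2 * (δ - j) - 3)
  -- The inequality `t ≤ (1 + t²)/2` with `t = a^{j-δ} ‖D^j f‖` replaces Cauchy–Schwarz. The term
  -- `a^{-3}` integrates over the ball to the scale-free volume `V`.
  have hpt (j : ℕ) (y) (hy : y ∈ Metric.closedBall x a) :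
      a ^ (j - 3 : ℝ) * ‖iteratedFDeriv ℝ j f y‖ ≤ a ^ δ * (a ^ (-3 : ℝ) / 2 + c j * w j y / 2) := by
    have hb := hball y hy
    have hw1 := norm_le_weight y
    have hw2 := weight_le_one_add_norm y
    have hcmp := rpow_le_mul_rpow (c := 9) ha (weight_pos y) (by norm_num) (by linarith)
      (by linarith) (-(-(-2 * (δ - j) - 3)))
    rw [neg_neg] at hcmp
    have hc' : c j = 9 ^ |(-2 * (δ - j) - 3)| := by simp only [c, abs_neg]
    rw [← hc'] at hcmp
    set N := ‖iteratedFDeriv ℝ j f y‖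
    have e1 : a ^ (-2 * (δ - j) - 3) * N ^ 2 ≤ c j * w j y := by
      calc a ^ (-2 * (δ - j) - 3) * N ^ 2 ≤ c j * weight y ^ (-2 * (δ - j) - 3) * N ^ 2 := by gcongr
        _ = c j * w j y := by simp only [w, N]; ring
    have e2 : a ^ (-2 * (δ - j) - 3) = (a ^ (j - δ : ℝ)) ^ 2 * a ^ (-3 : ℝ) := by
      rw [← Real.rpow_natCast, ← Real.rpow_mul ha.le, ← Real.rpow_add ha]
      congr 1; push_cast; ring
    have e3 : a ^ (j - 3 : ℝ) = a ^ δ * (a ^ (j - δ : ℝ) * a ^ (-3 : ℝ)) := by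
      rw [← Real.rpow_add ha, ← Real.rpow_add ha]
      congr 1; ring
    rw [e3, mul_assoc]
    refine mul_le_mul_of_nonneg_left ?_ (Real.rpow_nonneg ha.le _)
    rw [e2] at e1
    have h3 : 0 ≤ a ^ (-3 : ℝ) := Real.rpow_nonneg ha.le _
    nlinarith [mul_nonneg h3 (sq_nonneg (a ^ (j - δ : ℝ) * N - 1))]
  have hwi (j : ℕ) : IntegrableOn (w j) (Metric.closedBall x a) := (hf.2 j).mono_set hsub
  have hwI (j : ℕ) : ∫ y in Metric.closedBall x a, w j y ≤ I j :=
    setIntegral_mono_set (hf.2 j) (Eventually.of_forall fun y =>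
      mul_nonneg (sq_nonneg _) (Real.rpow_pos_of_pos (weight_pos y) _).le)
      (Eventually.of_forall hsub)
  have hvol : (volume : Measure E3).real (Metric.closedBall x a) = a ^ 3 * V := by
    rw [Measure.real, Measure.addHaar_closedBall volume x ha.le, ENNReal.toReal_mul,
      ENNReal.toReal_ofReal (by positivity)]
    simp [V, Measure.real, Measure.addHaar_unitClosedBall_eq_addHaar_unitBall]
  have hbound : ‖f x‖ * S ≤ a ^ δ * C₀ := by
    refine key.trans ?_
    calc _ ≤ ∫ y in Metric.closedBall x a, a ^ δ * (9 * (2 * a ^ (-3 : ℝ) +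
          (c 0 * w 0 y + c 1 * w 1 y + c 2 * w 2 y + c 3 * w 3 y) / 2)) := by
          refine integral_mono_of_nonneg (Eventually.of_forall fun y => by positivity) ?_ ?_
          · have hk : IntegrableOn (fun _ : E3 => 2 * a ^ (-3 : ℝ)) (Metric.closedBall x a) :=
              integrableOn_const (isCompact_closedBall x a).measure_lt_top.ne
            exact ((hk.add (((((hwi 0).const_mul _).add ((hwi 1).const_mul _)).add
              ((hwi 2).const_mul _)).add ((hwi 3).const_mul _) |>.div_const 2)).const_mul
              9).const_mul _
          · filter_upwards [ae_restrict_mem Metric.isClosed_closedBall.measurableSet] with y hy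
            have p0 := hpt 0 y hy
            have p1 := hpt 1 y hy
            have p2 := hpt 2 y hy
            have p3 := hpt 3 y hy
            have q0 : a⁻¹ ^ 3 = a ^ ((0 : ℕ) - 3 : ℝ) := by
              rw [Nat.cast_zero, zero_sub, Real.rpow_neg ha.le, inv_pow]; norm_cast
            have q1 : a⁻¹ ^ 2 = a ^ ((1 : ℕ) - 3 : ℝ) := by
              rw [show (((1 : ℕ) : ℝ) - 3) = -(2 : ℕ) by norm_num, Real.rpow_neg ha.le, inv_pow]
              norm_cast
            have q2 : a⁻¹ = a ^ ((2 : ℕ) - 3 : ℝ) := by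
              rw [show (((2 : ℕ) : ℝ) - 3) = -1 by norm_num, Real.rpow_neg ha.le, Real.rpow_one]
            have q3 : a ^ ((3 : ℕ) - 3 : ℝ) = 1 := by norm_num
            rw [← q0] at p0; rw [← q1] at p1; rw [← q2] at p2; rw [q3] at p3
            linarith
      _ = a ^ δ * (9 * (2 * (a ^ 3 * a ^ (-3 : ℝ)) * V +
          (c 0 * ∫ y in Metric.closedBall x a, w 0 y) / 2 +
          (c 1 * ∫ y in Metric.closedBall x a, w 1 y) / 2 +
          (c 2 * ∫ y in Metric.closedBall x a, w 2 y) / 2 +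
          (c 3 * ∫ y in Metric.closedBall x a, w 3 y) / 2)) := by
          have hk : IntegrableOn (fun _ : E3 => 2 * a ^ (-3 : ℝ)) (Metric.closedBall x a) :=
              integrableOn_const (isCompact_closedBall x a).measure_lt_top.ne
          have hJ (j) : IntegrableOn (fun y => c j * w j y) (Metric.closedBall x a) :=
            (hwi j).const_mul _
          have A1 : IntegrableOn (fun y => c 0 * w 0 y + c 1 * w 1 y) (Metric.closedBall x a) :=
            (hJ 0).add (hJ 1)
          have A2 : IntegrableOn (fun y => c 0 * w 0 y + c 1 * w 1 y + c 2 * w 2 y)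
            (Metric.closedBall x a) := A1.add (hJ 2)
          have A3 : IntegrableOn (fun y => c 0 * w 0 y + c 1 * w 1 y + c 2 * w 2 y + c 3 * w 3 y)
            (Metric.closedBall x a) := A2.add (hJ 3)
          rw [integral_const_mul, integral_const_mul, integral_add hk (A3.div_const 2),
            integral_div, integral_add A2 (hJ 3), integral_add A1 (hJ 2), integral_add (hJ 0) (hJ 1),
            setIntegral_const, hvol, integral_const_mul,
            integral_const_mul, integral_const_mul, integral_const_mul, smul_eq_mul]
          ring
      _ ≤ a ^ δ * C₀ := by
          have e : a ^ 3 * a ^ (-3 : ℝ) = 1 := by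
            rw [Real.rpow_neg ha.le]
            have : a ^ (3 : ℝ) = a ^ 3 := by norm_cast
            rw [this]; field_simp
          rw [e]
          refine mul_le_mul_of_nonneg_left ?_ (Real.rpow_nonneg ha.le _)
          have m (j) : c j * ∫ y in Metric.closedBall x a, w j y ≤ c j * I j :=
            mul_le_mul_of_nonneg_left (hwI j) (by positivity)
          have := m 0; have := m 1; have := m 2; have := m 3
          simp only [C₀]
          linarith
  have hax : a ^ δ ≤ 9 ^ |δ| * weight x ^ δ := by
    have hw1 := norm_le_weight x
    have hw2 := weight_le_one_add_norm x
    exact rpow_le_mul_rpow ha (weight_pos x) (by norm_num) (by linarith) (by linarith) _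
  calc ‖f x‖ = S⁻¹ * (‖f x‖ * S) := by field_simp
    _ ≤ S⁻¹ * (9 ^ |δ| * weight x ^ δ * C₀) := by
        gcongr S⁻¹ * ?_
        exact hbound.trans (mul_le_mul_of_nonneg_right hax hC₀)
    _ = _ := by ring

/-- Induction through the differential, which lies in the class of order `δ - 1` with another
codomain; the radius `2R` does not grow with `k`. -/
lemma LittleOn.exists_norm_iteratedFDeriv_le (k : ℕ) : ∀ {F : Type u} [NormedAddCommGroup F]
    [NormedSpace ℝ F] [CompleteSpace F] {f : E3 → F} {δ R : ℝ}, 1 ≤ R → LittleOn δ f R →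
    ∃ C, 0 ≤ C ∧ ∀ x ∈ endRegion (2 * R), ‖iteratedFDeriv ℝ k f x‖ ≤ C * weight x ^ (δ - k) := by
  induction k with
  | zero =>
    intro F _ _ _ f δ R hR hf
    simpa using hf.exists_norm_le hR
  | succ k ih =>
    intro F _ _ _ f δ R hR hf
    obtain ⟨C, hC, hb⟩ := ih hR hf.fderiv
    refine ⟨C, hC, fun x hx => ?_⟩
    rw [← norm_iteratedFDeriv_fderiv]
    convert hb x hx using 3
    push_cast; ring

/-- The weighted Sobolev embedding: `o_∞(r^δ)` functions are symbols of order `δ`. -/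
lemma IsLittleInf.isSymbol {F : Type u} [NormedAddCommGroup F] [NormedSpace ℝ F] [CompleteSpace F]
    {f : E3 → F} {δ : ℝ} (hf : IsLittleInf δ f) : IsSymbol δ f := by
  obtain ⟨R, h1, hR⟩ := ((isLittleInf_iff.1 hf).and (eventually_ge_atTop 1)).exists
  exact SymbolOn.isSymbol (R := 2 * R) ⟨h1.1.mono (endRegion_anti (by linarith)),
    fun k => LittleOn.exists_norm_iteratedFDeriv_le k hR h1⟩

end Embedding

open scoped ENNReal

/-! ### The weighted Hardy inequality -/

section Hardy

variable {F : Type*} [NormedAddCommGroup F] [InnerProductSpace ℝ F]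

/-- The one-dimensional weighted Hardy inequality on a bounded interval. -/
lemma hardy_interval {G G' : ℝ → F} {δ R T B : ℝ} (hR : 0 < R) (hRT : R ≤ T)
    (hG : ∀ t ∈ Set.Icc R T, HasDerivAt G (G' t) t) (hG' : ContinuousOn G' (Set.Icc R T))
    (hB : (0 < δ ∧ ‖G R‖ ^ 2 * R ^ (-2 * δ) ≤ B) ∨ (δ < 0 ∧ ‖G T‖ ^ 2 * T ^ (-2 * δ) ≤ B)) :
    ∫ t in R..T, ‖G t‖ ^ 2 * t ^ (-2 * δ - 1) ≤
      |δ|⁻¹ * B + |δ|⁻¹ ^ 2 * ∫ t in R..T, ‖G' t‖ ^ 2 * t ^ (-2 * δ + 1) := by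
  have hpos (t) (ht : t ∈ Set.Icc R T) : 0 < t := hR.trans_le ht.1
  have hu : Set.uIcc R T = Set.Icc R T := Set.uIcc_of_le hRT
  have hGc : ContinuousOn G (Set.Icc R T) := fun t ht => (hG t ht).continuousAt.continuousWithinAt
  have hrc (b : ℝ) : ContinuousOn (fun t : ℝ => t ^ b) (Set.Icc R T) :=
    continuousOn_id.rpow_const fun t ht => Or.inl (hpos t ht).ne'
  -- Integrating `H'` gives `-2δ` times the wanted integral plus a cross term, equal to the boundary
  -- values of `H`.
  set H : ℝ → ℝ := fun t => ‖G t‖ ^ 2 * t ^ (-2 * δ)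
  set H' : ℝ → ℝ := fun t => 2 * inner ℝ (G t) (G' t) * t ^ (-2 * δ) +
    ‖G t‖ ^ 2 * (-2 * δ * t ^ (-2 * δ - 1))
  have hH (t) (ht : t ∈ Set.uIcc R T) : HasDerivAt H (H' t) t := by
    rw [hu] at ht
    refine ((hG t ht).norm_sq.mul (Real.hasDerivAt_rpow_const (p := -2 * δ)
      (Or.inl (hpos t ht).ne')))
  have hci : ContinuousOn (fun t => inner ℝ (G t) (G' t)) (Set.Icc R T) := hGc.inner hG'
  have hi1 : IntervalIntegrable (fun t => 2 * inner ℝ (G t) (G' t) * t ^ (-2 * δ)) volume R T :=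
    ContinuousOn.intervalIntegrable (by
      rw [hu]; exact (continuousOn_const.mul hci).mul (hrc _))
  have hi2 : IntervalIntegrable (fun t => ‖G t‖ ^ 2 * t ^ (-2 * δ - 1)) volume R T :=
    ContinuousOn.intervalIntegrable (by rw [hu]; exact (hGc.norm.pow 2).mul (hrc _))
  have hi3 : IntervalIntegrable (fun t => ‖G' t‖ ^ 2 * t ^ (-2 * δ + 1)) volume R T :=
    ContinuousOn.intervalIntegrable (by rw [hu]; exact (hG'.norm.pow 2).mul (hrc _))
  have hi2' : IntervalIntegrable (fun t => ‖G t‖ ^ 2 * (-2 * δ * t ^ (-2 * δ - 1))) volume R T :=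
    (hi2.const_mul (-2 * δ)).congr fun t _ => by ring
  have key := intervalIntegral.integral_eq_sub_of_hasDerivAt hH (hi1.add hi2')
  rw [intervalIntegral.integral_add hi1 hi2'] at key
  have e2 : ∫ t in R..T, ‖G t‖ ^ 2 * (-2 * δ * t ^ (-2 * δ - 1)) =
      -2 * δ * ∫ t in R..T, ‖G t‖ ^ 2 * t ^ (-2 * δ - 1) := by
    rw [← intervalIntegral.integral_const_mul]
    congr 1; ext t; ring
  rw [e2] at key
  set I := ∫ t in R..T, ‖G t‖ ^ 2 * t ^ (-2 * δ - 1)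
  set J := ∫ t in R..T, ‖G' t‖ ^ 2 * t ^ (-2 * δ + 1)
  set X := ∫ t in R..T, 2 * inner ℝ (G t) (G' t) * t ^ (-2 * δ)
  have hδ : δ ≠ 0 := by rcases hB with h | h <;> [exact h.1.ne'; exact h.1.ne]
  have hδ' : 0 < |δ| := abs_pos.2 hδ
  -- Weighted arithmetic-geometric mean: the share `|δ| I` is half of `2|δ| I` and can be absorbed.
  have hX : |X| ≤ |δ| * I + |δ|⁻¹ * J := by
    rw [← intervalIntegral.integral_const_mul, ← intervalIntegral.integral_const_mul,
      ← intervalIntegral.integral_add (hi2.const_mul _) (hi3.const_mul _), ← Real.norm_eq_abs]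
    refine intervalIntegral.norm_integral_le_of_norm_le hRT ?_
      ((hi2.const_mul _).add (hi3.const_mul _))
    filter_upwards with t ht
    have ht0 : 0 < t := hR.trans ht.1
    have s1 : t ^ (-2 * δ - 1) = t ^ (-2 * δ) * t⁻¹ := by
      rw [Real.rpow_sub ht0, Real.rpow_one, div_eq_mul_inv]
    have s2 : t ^ (-2 * δ + 1) = t ^ (-2 * δ) * t := by
      rw [Real.rpow_add ht0, Real.rpow_one]
    have hp : 0 ≤ t ^ (-2 * δ) := Real.rpow_nonneg ht0.le _
    rw [s1, s2, norm_mul, norm_mul, Real.norm_of_nonneg hp]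
    have hin : ‖(inner ℝ (G t) (G' t) : ℝ)‖ ≤ ‖G t‖ * ‖G' t‖ := norm_inner_le_norm _ _
    have hmid : 2 * (‖G t‖ * ‖G' t‖) ≤ |δ| * (‖G t‖ ^ 2 * t⁻¹) + |δ|⁻¹ * (‖G' t‖ ^ 2 * t) := by
      have h := mul_nonneg (mul_pos (inv_pos.2 hδ') (inv_pos.2 ht0)).le
        (sq_nonneg (|δ| * ‖G t‖ - ‖G' t‖ * t))
      have : |δ|⁻¹ * t⁻¹ * (|δ| * ‖G t‖ - ‖G' t‖ * t) ^ 2 =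
        |δ| * (‖G t‖ ^ 2 * t⁻¹) + |δ|⁻¹ * (‖G' t‖ ^ 2 * t) - 2 * (‖G t‖ * ‖G' t‖) := by
        field_simp; ring
      linarith
    calc ‖(2 : ℝ)‖ * ‖(inner ℝ (G t) (G' t) : ℝ)‖ * t ^ (-2 * δ)
        ≤ 2 * (‖G t‖ * ‖G' t‖) * t ^ (-2 * δ) := by
          rw [Real.norm_of_nonneg (by norm_num : (0 : ℝ) ≤ 2)]; gcongr
      _ ≤ (|δ| * (‖G t‖ ^ 2 * t⁻¹) + |δ|⁻¹ * (‖G' t‖ ^ 2 * t)) * t ^ (-2 * δ) := by gcongr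
      _ = _ := by ring
  -- The boundary term of favourable sign is dropped: the outer one for `δ > 0`, the inner one for
  -- `δ < 0`. The other one is bounded by `B`.
  have hfin : |δ| * I ≤ B + |δ|⁻¹ * J := by
    have hX1 := (abs_le.1 hX).1
    have hX2 := (abs_le.1 hX).2
    rcases hB with ⟨h, hb⟩ | ⟨h, hb⟩
    · have : 0 ≤ H T := mul_nonneg (sq_nonneg _) (Real.rpow_nonneg (hR.le.trans hRT) _)
      rw [abs_of_pos h] at *
      simp only [H] at *
      linarith
    · have : 0 ≤ H R := mul_nonneg (sq_nonneg _) (Real.rpow_nonneg hR.le _)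
      rw [abs_of_neg h] at *
      simp only [H] at *
      linarith
  calc I = |δ|⁻¹ * (|δ| * I) := by field_simp
    _ ≤ |δ|⁻¹ * (B + |δ|⁻¹ * J) := by gcongr
    _ = _ := by ring

/-- The weighted Hardy inequality in exterior regions, qualitative form. -/
lemma integrableOn_of_fderiv {f : E3 → F} {δ R R' : ℝ} (hR : 1 ≤ R') (hRR : R' < R)
    (hf : ContDiffOn ℝ ∞ f (endRegion R'))
    (hD : IntegrableOn (fun x => ‖fderiv ℝ f x‖ ^ 2 * weight x ^ (-2 * (δ - 1) - 3)) (endRegion R))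
    (hB : 0 < δ ∨ (δ < 0 ∧ ∃ C, ∀ x ∈ endRegion R', ‖f x‖ ≤ C * ‖x‖ ^ δ)) :
    IntegrableOn (fun x => ‖f x‖ ^ 2 * weight x ^ (-2 * δ - 3)) (endRegion R) := by
  have hR0 : 0 < R := by linarith
  have hsub : endRegion R ⊆ endRegion R' := endRegion_anti hRR.le
  -- A bound uniform in the direction: from compactness of the sphere of radius `R` when `δ > 0`,
  -- and from the assumed decay, for every `T`, when `δ < 0`.
  obtain ⟨B, hB⟩ : ∃ B, ∀ z : E3, ‖z‖ = 1 → ∀ T ≥ R,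
      (0 < δ ∧ ‖f (R • z)‖ ^ 2 * R ^ (-2 * δ) ≤ B) ∨
      (δ < 0 ∧ ‖f (T • z)‖ ^ 2 * T ^ (-2 * δ) ≤ B) := by
    rcases hB with h | ⟨h, C, hC⟩
    · obtain ⟨M, hM⟩ := (isCompact_sphere (0 : E3) R).exists_bound_of_continuousOn
        (f := f) (hf.continuousOn.mono fun x hx => by
          simp only [mem_sphere_iff_norm, sub_zero] at hx
          simp only [endRegion, Set.mem_ofPred_eq]; linarith)
      refine ⟨M ^ 2 * R ^ (-2 * δ), fun z hz T hT => Or.inl ⟨h, ?_⟩⟩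
      gcongr
      exact hM _ (by simp [norm_smul, hz, abs_of_pos hR0])
    · refine ⟨C ^ 2, fun z hz T hT => Or.inr ⟨h, ?_⟩⟩
      have hT0 : 0 < T := hR0.trans_le hT
      have hn : ‖T • z‖ = T := by simp [norm_smul, hz, abs_of_pos hT0]
      have h1 := hC (T • z) (by simp only [endRegion, Set.mem_ofPred_eq]; linarith)
      rw [hn] at h1
      calc ‖f (T • z)‖ ^ 2 * T ^ (-2 * δ) ≤ (C * T ^ δ) ^ 2 * T ^ (-2 * δ) := by gcongr
        _ = C ^ 2 * (T ^ (2 * δ) * T ^ (-2 * δ)) := by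
          rw [mul_pow, ← Real.rpow_natCast (T ^ δ), ← Real.rpow_mul hT0.le]
          push_cast; rw [mul_comm δ 2]; ring
        _ = C ^ 2 := by rw [← Real.rpow_add hT0]; simp
  set Ψ : (E3 → ℝ) → E3 → ℝ≥0∞ := fun g => (endRegion R).indicator fun x => ENNReal.ofReal (g x)
  have hΨm {g : E3 → ℝ} (hg : ContinuousOn g (endRegion R)) : Measurable (Ψ g) := by
    classical
    rw [show Ψ g = _ from (Set.piecewise_eq_indicator).symm]
    exact (ENNReal.continuous_ofReal.comp_continuousOn hg).measurable_piecewise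
      continuousOn_const (measurableSet_endRegion R)
  set f₀ : E3 → ℝ := fun x => ‖f x‖ ^ 2 * ‖x‖ ^ (-2 * δ - 3)
  set f₁ : E3 → ℝ := fun x => ‖fderiv ℝ f x‖ ^ 2 * ‖x‖ ^ (-2 * (δ - 1) - 3)
  have hnorm (b : ℝ) : ContinuousOn (fun x : E3 => ‖x‖ ^ b) (endRegion R) :=
    continuous_norm.continuousOn.rpow_const fun x hx => Or.inl (hR0.trans hx).ne'
  have hDc : ContinuousOn (fderiv ℝ f) (endRegion R') :=
    (hf.fderiv_of_isOpen (m := ∞) (isOpen_endRegion R') (by simp)).continuousOn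
  have hc0 : ContinuousOn f₀ (endRegion R) := ((hf.continuousOn.mono hsub).norm.pow 2).mul (hnorm _)
  have hc1 : ContinuousOn f₁ (endRegion R) := ((hDc.mono hsub).norm.pow 2).mul (hnorm _)
  have hf1 : ∫⁻ x, Ψ f₁ x < ⊤ := by
    have hi : IntegrableOn f₁ (endRegion R) := by
      refine Integrable.mono' (hD.const_mul (2 ^ |-2 * (δ - 1) - 3|))
        (hc1.aestronglyMeasurable (measurableSet_endRegion R)) ?_
      filter_upwards [ae_restrict_mem (measurableSet_endRegion R)] with x (hx : R < ‖x‖)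
      have h1 := rpow_le_mul_rpow (c := 2) (by linarith) (weight_pos x) (by norm_num)
        (by linarith [norm_le_weight x, weight_pos x]) (weight_le_two_mul_norm (x := x)
          (by linarith)) (-2 * (δ - 1) - 3)
      rw [Real.norm_of_nonneg (by positivity)]
      calc _ ≤ ‖fderiv ℝ f x‖ ^ 2 * (2 ^ |-2 * (δ - 1) - 3| * weight x ^ (-2 * (δ - 1) - 3)) :=
            mul_le_mul_of_nonneg_left h1 (sq_nonneg _)
        _ = _ := by ring
    rw [lintegral_indicator (measurableSet_endRegion R),
      ← ofReal_integral_eq_lintegral_ofReal hi (Eventually.of_forall fun x => by positivity)]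
    exact ENNReal.ofReal_lt_top
  have hf0 : ∫⁻ x, Ψ f₀ x < ⊤ := by
    have hray (z : Metric.sphere (0 : E3) 1) :
        ∫⁻ t in Set.Ioi (0 : ℝ), ENNReal.ofReal (t ^ 2) * Ψ f₀ (t • (z : E3)) ≤
        ENNReal.ofReal (|δ|⁻¹ * |B|) + ENNReal.ofReal (|δ|⁻¹ ^ 2) *
          ∫⁻ t in Set.Ioi (0 : ℝ), ENNReal.ofReal (t ^ 2) * Ψ f₁ (t • (z : E3)) := by
      have hz : ‖(z : E3)‖ = 1 := by simp
      have hn (t : ℝ) (ht : 0 < t) : ‖t • (z : E3)‖ = t := by simp [norm_smul, hz, abs_of_pos ht]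
      have hmem (t : ℝ) (ht : R ≤ t) : t • (z : E3) ∈ endRegion R' := by
        simp only [endRegion, Set.mem_ofPred_eq, hn t (hR0.trans_le ht)]; linarith
      set G : ℝ → F := fun t => f (t • (z : E3))
      set G' : ℝ → F := fun t => fderiv ℝ f (t • (z : E3)) z
      have hGd (t : ℝ) (ht : R ≤ t) : HasDerivAt G (G' t) t := by
        have := hasDerivAt_comp_add_smul (f := f) (x := 0) (z := z) (t := t)
          (f' := fderiv ℝ f (t • (z : E3))) (by
            rw [zero_add]
            exact ((contDiffAt_endRegion hf (hmem t ht)).differentiableAt (by simp)).hasFDerivAt)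
        simpa using this
      have hGc' (T : ℝ) : ContinuousOn G' (Set.Icc R T) := by
        have : ContinuousOn (fun t : ℝ => fderiv ℝ f (t • (z : E3))) (Set.Icc R T) :=
          hDc.comp (by fun_prop) fun t ht => hmem t ht.1
        exact this.clm_apply continuousOn_const
      have hGc (T : ℝ) : ContinuousOn G (Set.Icc R T) :=
        fun t ht => (hGd t ht.1).continuousAt.continuousWithinAt
      have hrc (b T : ℝ) : ContinuousOn (fun t : ℝ => t ^ b) (Set.Icc R T) :=
        continuousOn_id.rpow_const fun t ht => Or.inl (hR0.trans_le ht.1).ne'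
      have hind (g : E3 → ℝ) : ∫⁻ t in Set.Ioi (0 : ℝ), ENNReal.ofReal (t ^ 2) * Ψ g (t • (z : E3)) =
          ∫⁻ t in Set.Ioi R, ENNReal.ofReal (t ^ 2 * g (t • (z : E3))) := by
        rw [← lintegral_indicator measurableSet_Ioi, ← lintegral_indicator measurableSet_Ioi]
        refine lintegral_congr fun t => ?_
        by_cases ht : R < t
        · have ht0 : 0 < t := hR0.trans ht
          have : t • (z : E3) ∈ endRegion R := by
            simp only [endRegion, Set.mem_ofPred_eq, hn t ht0]; exact ht
          simp [ht0, ht, Ψ, this, ENNReal.ofReal_mul (sq_nonneg t)]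
        · by_cases ht0 : 0 < t
          · have : t • (z : E3) ∉ endRegion R := by
              simp only [endRegion, Set.mem_ofPred_eq, hn t ht0]; exact ht
            simp [ht, Ψ, this]
          · simp [ht, ht0]
      rw [hind, hind]
      -- The interval inequality holds on each `[R, T]` with a bound independent of `T`, so it
      -- survives the limit `T → ∞`.
      have hcov : AECover (volume.restrict (Set.Ioi R)) atTop fun T : ℝ => Set.Iic T :=
        (aecover_Iic tendsto_id).mono_ac Measure.restrict_le_self.absolutelyContinuous
      refine le_of_tendsto (hcov.lintegral_tendsto_of_countably_generated ?_) ?_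
      · refine ContinuousOn.aemeasurable (fun t ht => ?_) measurableSet_Ioi
        have h1 := (hGd t (le_of_lt ht)).continuousAt
        have h2 : ContinuousAt (fun t : ℝ => ‖t • (z : E3)‖ ^ (-2 * δ - 3)) t :=
          ContinuousAt.rpow_const (by fun_prop) (Or.inl (by
            rw [hn t (hR0.trans ht)]; exact (hR0.trans ht).ne'))
        exact (ENNReal.continuous_ofReal.continuousAt.comp
          (((continuous_pow 2).continuousAt).mul ((h1.norm.pow 2).mul h2))).continuousWithinAt
      · filter_upwards [eventually_ge_atTop R] with T hT
        have hB' : (0 < δ ∧ ‖G R‖ ^ 2 * R ^ (-2 * δ) ≤ |B|) ∨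
            (δ < 0 ∧ ‖G T‖ ^ 2 * T ^ (-2 * δ) ≤ |B|) :=
          (hB z hz T hT).imp (fun h => ⟨h.1, h.2.trans (le_abs_self B)⟩)
            (fun h => ⟨h.1, h.2.trans (le_abs_self B)⟩)
        have key := hardy_interval hR0 hT (fun t ht => hGd t ht.1) (hGc' T) hB'
        have hi0 : IntegrableOn (fun t => ‖G t‖ ^ 2 * t ^ (-2 * δ - 1)) (Set.Ioc R T) :=
          (((hGc T).norm.pow 2).mul (hrc _ T)).integrableOn_Icc.mono_set Set.Ioc_subset_Icc_self
        have hi1 : IntegrableOn (fun t => ‖G' t‖ ^ 2 * t ^ (-2 * δ + 1)) (Set.Ioc R T) :=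
          (((hGc' T).norm.pow 2).mul (hrc _ T)).integrableOn_Icc.mono_set Set.Ioc_subset_Icc_self
        have hp (b t : ℝ) (ht : t ∈ Set.Ioc R T) : 0 ≤ t ^ b := Real.rpow_nonneg (by
          linarith [ht.1]) b
        rw [intervalIntegral.integral_of_le hT, intervalIntegral.integral_of_le hT] at key
        have e0 : ∫⁻ t in Set.Iic T, ENNReal.ofReal (t ^ 2 * f₀ (t • (z : E3)))
            ∂(volume.restrict (Set.Ioi R)) =
            ENNReal.ofReal (∫ t in Set.Ioc R T, ‖G t‖ ^ 2 * t ^ (-2 * δ - 1)) := by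
          rw [Measure.restrict_restrict measurableSet_Iic, Set.Iic_inter_Ioi,
            ofReal_integral_eq_lintegral_ofReal hi0]
          · refine setLIntegral_congr_fun measurableSet_Ioc fun t ht => ?_
            have ht0 : 0 < t := hR0.trans ht.1
            simp only [f₀, hn t ht0, G]
            congr 1
            rw [show -2 * δ - 1 = (-2 * δ - 3) + (2 : ℕ) by push_cast; ring, Real.rpow_add ht0,
              Real.rpow_natCast]
            ring
          · filter_upwards [ae_restrict_mem measurableSet_Ioc] with t ht
            exact mul_nonneg (sq_nonneg _) (hp _ t ht)
        have e1 : ENNReal.ofReal (∫ t in Set.Ioc R T, ‖G' t‖ ^ 2 * t ^ (-2 * δ + 1)) ≤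
            ∫⁻ t in Set.Ioi R, ENNReal.ofReal (t ^ 2 * f₁ (t • (z : E3))) := by
          rw [ofReal_integral_eq_lintegral_ofReal hi1]
          · refine (setLIntegral_mono' measurableSet_Ioc fun t ht => ?_).trans
              (lintegral_mono_set Set.Ioc_subset_Ioi_self)
            have ht0 : 0 < t := hR0.trans ht.1
            refine ENNReal.ofReal_le_ofReal ?_
            simp only [f₁, hn t ht0]
            rw [show -2 * δ + 1 = (-2 * (δ - 1) - 3) + (2 : ℕ) by push_cast; ring,
              Real.rpow_add ht0, Real.rpow_natCast]
            have : ‖G' t‖ ≤ ‖fderiv ℝ f (t • (z : E3))‖ := by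
              simpa [hz] using (fderiv ℝ f (t • (z : E3))).le_opNorm z
            have hp' := hp (-2 * (δ - 1) - 3) t ht
            calc _ = t ^ 2 * (‖G' t‖ ^ 2 * t ^ (-2 * (δ - 1) - 3)) := by ring
              _ ≤ _ := by gcongr
          · filter_upwards [ae_restrict_mem measurableSet_Ioc] with t ht
            exact mul_nonneg (sq_nonneg _) (hp _ t ht)
        rw [e0]
        refine (ENNReal.ofReal_le_ofReal key).trans ?_
        rw [ENNReal.ofReal_add (by positivity) (mul_nonneg (by positivity)
          (setIntegral_nonneg measurableSet_Ioc fun t ht => mul_nonneg (sq_nonneg _) (hp _ t ht))),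
          ENNReal.ofReal_mul (by positivity : 0 ≤ |δ|⁻¹ ^ 2)]
        gcongr
    rw [lintegral_polar (hΨm hc0)]
    refine (lintegral_mono hray).trans_lt ?_
    rw [lintegral_add_left measurable_const, lintegral_const, lintegral_const_mul' _ _
      ENNReal.ofReal_ne_top, ← lintegral_polar (hΨm hc1)]
    exact ENNReal.add_lt_top.2 ⟨ENNReal.mul_lt_top ENNReal.ofReal_lt_top (measure_lt_top _ _),
      ENNReal.mul_lt_top ENNReal.ofReal_lt_top hf1⟩
  have hi : IntegrableOn f₀ (endRegion R) := by
    refine ⟨hc0.aestronglyMeasurable (measurableSet_endRegion R), ?_⟩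
    rw [hasFiniteIntegral_iff_ofReal (Eventually.of_forall fun x => by positivity)]
    rwa [lintegral_indicator (measurableSet_endRegion R)] at hf0
  refine Integrable.mono' (hi.const_mul (2 ^ |-2 * δ - 3|)) ((((hf.continuousOn.mono
    hsub).norm.pow 2).mul (continuous_weight_rpow _).continuousOn).aestronglyMeasurable
    (measurableSet_endRegion R)) ?_
  filter_upwards [ae_restrict_mem (measurableSet_endRegion R)] with x (hx : R < ‖x‖)
  have hx0 : 0 < ‖x‖ := hR0.trans hx
  have h1 := rpow_le_mul_rpow (c := 2) (weight_pos x) hx0 (by norm_num)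
    (weight_le_two_mul_norm (x := x) (by linarith)) (by linarith [norm_le_weight x, weight_pos x])
    (-2 * δ - 3)
  have hw : 0 ≤ weight x ^ (-2 * δ - 3) := (Real.rpow_pos_of_pos (weight_pos x) _).le
  rw [Real.norm_of_nonneg (by positivity)]
  calc _ ≤ ‖f x‖ ^ 2 * (2 ^ |-2 * δ - 3| * ‖x‖ ^ (-2 * δ - 3)) := by gcongr
    _ = _ := by ring

end Hardy

/-! ### Limits at infinity -/

section Limit

variable {F : Type*} [NormedAddCommGroup F] [NormedSpace ℝ F]

/-- When the angle between `x` and `y` is at most a right angle, the segment joining them avoids the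
ball of radius `ρ/2`, so the mean value inequality applies. The length is at most `4ρ`, and `4ρ
(ρ/2)^{δ-1} = 8 (ρ/2)^δ`. -/
lemma norm_sub_le_of_inner_nonneg {f : E3 → F} {δ C ρ : ℝ} (hρ : 0 < ρ) (hδ : δ < 0)
    (hf : ∀ x, ρ / 2 ≤ ‖x‖ → DifferentiableAt ℝ f x)
    (hb : ∀ x, ρ / 2 ≤ ‖x‖ → ‖fderiv ℝ f x‖ ≤ C * ‖x‖ ^ (δ - 1)) {x y : E3}
    (hx : ρ ≤ ‖x‖) (hx' : ‖x‖ ≤ 2 * ρ) (hy : ρ ≤ ‖y‖) (hy' : ‖y‖ ≤ 2 * ρ)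
    (hxy : 0 ≤ inner ℝ x y) : ‖f x - f y‖ ≤ |C| * 8 * 2 ^ (-δ) * ρ ^ δ := by
  have hseg : ∀ w ∈ segment ℝ y x, ρ / 2 ≤ ‖w‖ := by
    rintro w ⟨a, b, ha, hb', hab, rfl⟩
    have h1 : ‖a • y + b • x‖ ^ 2 = a ^ 2 * ‖y‖ ^ 2 + 2 * (a * b * inner ℝ x y) + b ^ 2 * ‖x‖ ^ 2 := by
      rw [norm_add_sq_real, norm_smul, norm_smul, inner_smul_left, inner_smul_right,
        real_inner_comm]
      simp [mul_pow]
      ring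
    have h2 : 0 ≤ a * b * inner ℝ x y := mul_nonneg (mul_nonneg ha hb') hxy
    have h3 : a ^ 2 * ρ ^ 2 ≤ a ^ 2 * ‖y‖ ^ 2 := by gcongr
    have h4 : b ^ 2 * ρ ^ 2 ≤ b ^ 2 * ‖x‖ ^ 2 := by gcongr
    have h5 : (ρ / 2) ^ 2 ≤ ‖a • y + b • x‖ ^ 2 := by
      have hb1 : b = 1 - a := by linarith
      have : 1 / 4 ≤ a ^ 2 + b ^ 2 := by rw [hb1]; nlinarith [sq_nonneg (2 * a - 1)]
      nlinarith [sq_nonneg ρ]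
    exact (pow_le_pow_iff_left₀ (by linarith) (norm_nonneg _) two_ne_zero).1 h5
  have hbd : ∀ w ∈ segment ℝ y x, ‖fderiv ℝ f w‖ ≤ |C| * (ρ / 2) ^ (δ - 1) := fun w hw =>
    (hb w (hseg w hw)).trans <| by
      have hw0 : 0 < ‖w‖ := lt_of_lt_of_le (by linarith) (hseg w hw)
      have := Real.rpow_le_rpow_of_nonpos (by linarith) (hseg w hw) (by linarith : δ - 1 ≤ 0)
      calc C * ‖w‖ ^ (δ - 1) ≤ |C| * ‖w‖ ^ (δ - 1) := by gcongr; exact le_abs_self C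
        _ ≤ _ := by gcongr
  have key := (convex_segment y x).norm_image_sub_le_of_norm_fderiv_le
    (fun w hw => hf w (hseg w hw)) hbd (left_mem_segment ℝ y x) (right_mem_segment ℝ y x)
  have hd : ‖x - y‖ ≤ 4 * ρ := (norm_sub_le x y).trans (by linarith)
  calc ‖f x - f y‖ ≤ |C| * (ρ / 2) ^ (δ - 1) * (4 * ρ) := key.trans (by gcongr)
    _ = |C| * 8 * (ρ / 2) ^ δ := by
      rw [Real.rpow_sub (by linarith), Real.rpow_one]
      field_simp; ring
    _ = _ := by
      rw [div_eq_mul_inv, Real.mul_rpow hρ.le (by norm_num), Real.inv_rpow (by norm_num),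
        Real.rpow_neg (by norm_num)]
      ring

/-- A function whose differential is `O(r^{δ-1})` with `δ < 0` has a limit `c` at infinity, and
`f - c = O(r^δ)`. -/
lemma exists_limit_of_fderiv_bound [CompleteSpace F] {f : E3 → F} {δ C R : ℝ} (hR : 1 ≤ R)
    (hδ : δ < 0)
    (hf : ∀ x ∈ endRegion R, DifferentiableAt ℝ f x)
    (hb : ∀ x ∈ endRegion R, ‖fderiv ℝ f x‖ ≤ C * ‖x‖ ^ (δ - 1)) :
    ∃ c : F, ∃ M R' : ℝ, ∀ x ∈ endRegion R', ‖f x - c‖ ≤ M * ‖x‖ ^ δ := by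
  set M := |C| * 8 * 2 ^ (-δ)
  have hM : 0 ≤ M := by positivity
  set u : E3 := EuclideanSpace.single 0 1
  set v : E3 := EuclideanSpace.single 1 1
  have hu : ‖u‖ = 1 := by simp [u]
  have hv : ‖v‖ = 1 := by simp [v]
  have huv : inner ℝ u v = 0 := by simp [u, v, EuclideanSpace.inner_single_left]
  have hosc : ∀ ρ > 2 * R, ∀ x : E3, ρ ≤ ‖x‖ → ‖x‖ ≤ 2 * ρ →
      ‖f x - f (ρ • v)‖ ≤ 2 * (M * ρ ^ δ) := by
    intro ρ hρ x hx hx'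
    have hρ0 : 0 < ρ := by linarith
    have hin (x : E3) (h : ρ / 2 ≤ ‖x‖) : x ∈ endRegion R := by
      simp only [endRegion, Set.mem_ofPred_eq]; linarith
    have step {x y : E3} (hx : ρ ≤ ‖x‖) (hx' : ‖x‖ ≤ 2 * ρ) (hy : ‖y‖ = ρ)
        (h : 0 ≤ inner ℝ x y) : ‖f x - f y‖ ≤ M * ρ ^ δ :=
      norm_sub_le_of_inner_nonneg hρ0 hδ (fun x h => hf x (hin x h)) (fun x h => hb x (hin x h))
        hx hx' hy.ge (by linarith) h
    -- A point of the shell is joined to `ρ v` in two steps through `w = ±ρ u`, orthogonal to `v`,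
    -- the sign being chosen so that `x` and `w` form no obtuse angle.
    obtain ⟨w, hw, hxw, hwv⟩ : ∃ w : E3, ‖w‖ = ρ ∧ 0 ≤ inner ℝ x w ∧ inner ℝ w (ρ • v) = 0 := by
      rcases le_total 0 (inner ℝ x u) with h | h
      · exact ⟨ρ • u, by simp [norm_smul, hu, abs_of_pos hρ0],
          by rw [inner_smul_right]; positivity, by simp [inner_smul_left, inner_smul_right, huv]⟩
      · exact ⟨-(ρ • u), by simp [norm_smul, hu, abs_of_pos hρ0], by
          rw [inner_neg_right, inner_smul_right]; nlinarith,
          by simp [inner_smul_left, inner_smul_right, huv]⟩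
    have h1 := step hx hx' hw hxw
    have h2 := step (x := w) (y := ρ • v) hw.ge (by linarith)
      (by simp [norm_smul, hv, abs_of_pos hρ0]) hwv.ge
    calc ‖f x - f (ρ • v)‖ = ‖(f x - f w) + (f w - f (ρ • v))‖ := by rw [sub_add_sub_cancel]
      _ ≤ _ := (norm_add_le _ _).trans (by linarith)
  -- Values at the points `2^n ρ₀ v` form a geometric Cauchy sequence with ratio `2^δ < 1`; every
  -- other point is compared with the dyadic shell that contains it.
  set ρ₀ := 3 * R
  have hρ₀ : 0 < ρ₀ := by simp only [ρ₀]; linarith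
  set a : ℕ → F := fun n => f ((2 ^ n * ρ₀) • v)
  have hρn (n : ℕ) : 2 * R < 2 ^ n * ρ₀ := by
    have : (1 : ℝ) ≤ 2 ^ n := one_le_pow₀ (by norm_num)
    simp only [ρ₀]; nlinarith
  set q : ℝ := 2 ^ δ
  have hq : q < 1 := Real.rpow_lt_one_of_one_lt_of_neg (by norm_num) hδ
  have hq0 : 0 < q := by positivity
  have hpow (n : ℕ) : (2 ^ n * ρ₀) ^ δ = ρ₀ ^ δ * q ^ n := by
    rw [Real.mul_rpow (by positivity) hρ₀.le, mul_comm, ← Real.rpow_natCast, ← Real.rpow_mul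
      (by norm_num), mul_comm (n : ℝ) δ, Real.rpow_mul (by norm_num), Real.rpow_natCast]
  have hstep (n : ℕ) : dist (a n) (a (n + 1)) ≤ (2 * M * ρ₀ ^ δ) * q ^ n := by
    have hn : ‖(2 ^ (n + 1) * ρ₀) • v‖ = 2 * (2 ^ n * ρ₀) := by
      rw [norm_smul, hv, Real.norm_of_nonneg (by positivity)]; ring
    have := hosc (2 ^ n * ρ₀) (hρn n) ((2 ^ (n + 1) * ρ₀) • v)
      (by rw [hn]; have := hρn n; linarith) hn.le
    rw [dist_comm, dist_eq_norm]
    calc _ ≤ _ := this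
      _ = _ := by rw [hpow]; ring
  obtain ⟨c, hc⟩ := cauchySeq_tendsto_of_complete (cauchySeq_of_le_geometric q _ hq hstep)
  have hlim (n : ℕ) := dist_le_of_le_geometric_of_tendsto q _ hq hstep hc n
  refine ⟨c, (2 * M + 2 * M / (1 - q)) * q⁻¹, ρ₀, fun x (hx : ρ₀ < ‖x‖) => ?_⟩
  obtain ⟨n, hn1, hn2⟩ := exists_nat_pow_near (x := ‖x‖ / ρ₀) (y := 2)
    (by rw [le_div_iff₀ hρ₀]; linarith) (by norm_num)
  rw [le_div_iff₀ hρ₀] at hn1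
  rw [div_lt_iff₀ hρ₀] at hn2
  have hxx : ‖x‖ ≤ 2 * (2 ^ n * ρ₀) := by rw [pow_succ] at hn2; linarith
  have h1 := hosc _ (hρn n) x hn1 hxx
  have h2 := hlim n
  rw [dist_eq_norm] at h2
  have hx0 : 0 < ‖x‖ := hρ₀.trans hx
  have h3 : (2 ^ n * ρ₀) ^ δ ≤ q⁻¹ * ‖x‖ ^ δ := by
    have := Real.rpow_le_rpow_of_nonpos hx0 hxx hδ.le
    rw [Real.mul_rpow (by norm_num) (by positivity)] at this
    calc _ = q⁻¹ * (q * (2 ^ n * ρ₀) ^ δ) := by field_simp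
      _ ≤ _ := by gcongr
  have hq1 : 0 < 1 - q := by linarith
  calc ‖f x - c‖ = ‖(f x - f ((2 ^ n * ρ₀) • v)) + (a n - c)‖ := by
        simp only [a, sub_add_sub_cancel]
    _ ≤ 2 * (M * (2 ^ n * ρ₀) ^ δ) + 2 * M * ρ₀ ^ δ * q ^ n / (1 - q) :=
        (norm_add_le _ _).trans (add_le_add h1 h2)
    _ = (2 * M + 2 * M / (1 - q)) * (2 ^ n * ρ₀) ^ δ := by rw [hpow]; field_simp
    _ ≤ (2 * M + 2 * M / (1 - q)) * (q⁻¹ * ‖x‖ ^ δ) := by gcongr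
    _ = _ := by ring

end Limit

/-! ### Inverting differentiation in the weighted classes -/

section Integration

variable {F : Type*} [NormedAddCommGroup F] [InnerProductSpace ℝ F]
  {f : E3 → F} {δ : ℝ}

/-- The Hardy inequality recovers the undifferentiated norm. For `δ < 0` the decay hypothesis
excludes a nonzero constant at infinity. -/
lemma isLittleInf_of_fderiv_of_bound {R₁ : ℝ} (hf : ContDiffOn ℝ ∞ f (endRegion R₁))
    (hD : IsLittleInf (δ - 1) (fderiv ℝ f))
    (hB : 0 < δ ∨ (δ < 0 ∧ ∃ C R, ∀ x ∈ endRegion R, ‖f x‖ ≤ C * ‖x‖ ^ δ)) : IsLittleInf δ f := by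
  obtain ⟨R₂, hR₂⟩ : ∃ R₂, 0 < δ ∨ (δ < 0 ∧ ∃ C, ∀ x ∈ endRegion R₂, ‖f x‖ ≤ C * ‖x‖ ^ δ) := by
    rcases hB with h | ⟨h, C, R, hC⟩
    · exact ⟨0, Or.inl h⟩
    · exact ⟨R, Or.inr ⟨h, C, hC⟩⟩
  obtain ⟨R, hDR, h1, h2, h3⟩ := ((isLittleInf_iff.1 hD).and ((eventually_ge_atTop 1).and
    ((eventually_ge_atTop R₁).and (eventually_ge_atTop R₂)))).exists
  have hfR : ContDiffOn ℝ ∞ f (endRegion R) := hf.mono (endRegion_anti h2)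
  refine isLittleInf_iff.2 ?_
  filter_upwards [eventually_gt_atTop R] with R' hR'
  refine LittleOn.of_fderiv (hfR.mono (endRegion_anti hR'.le)) ?_ (hDR.mono hR'.le)
  refine integrableOn_of_fderiv h1 hR' hfR ?_ (hR₂.imp_right fun ⟨h, C, hC⟩ =>
    ⟨h, C, fun x hx => hC x (endRegion_anti h3 hx)⟩)
  simpa using (hDR.mono hR'.le).2 0

/-- For `δ > 0`, a function with partial derivatives in `o_∞(r^{δ-1})` is `o_∞(r^δ)`. -/
lemma isLittleInf_of_pd {R₁ : ℝ} (hδ : 0 < δ) (hf : ContDiffOn ℝ ∞ f (endRegion R₁))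
    (hD : ∀ i, IsLittleInf (δ - 1) (pd i f)) : IsLittleInf δ f :=
  isLittleInf_of_fderiv_of_bound hf (isLittleInf_fderiv_of_pd hD) (Or.inl hδ)

/-- For `δ < 0`, a function with partial derivatives in `o_∞(r^{δ-1})` is a constant plus
`o_∞(r^δ)`. -/
lemma exists_const_isLittleInf_of_pd [CompleteSpace F] {R₁ : ℝ} (hδ : δ < 0) (hf : ContDiffOn ℝ ∞ f (endRegion R₁))
    (hD : ∀ i, IsLittleInf (δ - 1) (pd i f)) : ∃ c : F, IsLittleInf δ fun x => f x - c := by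
  have hD' := isLittleInf_fderiv_of_pd hD
  obtain ⟨R, hS, h1, h2⟩ := (hD'.isSymbol.and ((eventually_ge_atTop 1).and
    (eventually_ge_atTop R₁))).exists
  have hfR : ContDiffOn ℝ ∞ f (endRegion R) := hf.mono (endRegion_anti h2)
  obtain ⟨C, hC, hb⟩ := hS.2 0
  obtain ⟨c, M, R', hM⟩ := exists_limit_of_fderiv_bound (C := C) h1 hδ
    (fun x hx => (contDiffAt_endRegion hfR hx).differentiableAt (by simp)) (fun x hx => by
      have hx0 : 0 < ‖x‖ := lt_of_lt_of_le (by linarith) (le_of_lt (show R < ‖x‖ from hx))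
      have := hb x hx
      simp only [norm_iteratedFDeriv_zero, Nat.cast_zero, sub_zero] at this
      exact this.trans (mul_le_mul_of_nonneg_left
        (Real.rpow_le_rpow_of_nonpos hx0 (norm_le_weight x) (by linarith)) hC))
  refine ⟨c, isLittleInf_of_fderiv_of_bound (hfR.sub contDiffOn_const) ?_
    (Or.inr ⟨hδ, M, R', hM⟩)⟩
  have : fderiv ℝ (fun x => f x - c) = fderiv ℝ f := by
    ext1 x; rw [fderiv_sub_const]
  rwa [this]

/-- A constant which is `o_∞(r^δ)` with `δ ≤ 0` vanishes. -/
lemma eq_zero_of_isLittleInf_const {c : F} (hδ : δ ≤ 0) (h : IsLittleInf δ fun _ : E3 => c) :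
    c = 0 := by
  by_contra hc
  obtain ⟨R, h1, hR⟩ := ((isLittleInf_iff.1 h).and (eventually_ge_atTop 1)).exists
  have h0 := h1.2 0
  have hc' : 0 < ‖c‖ ^ 2 := by positivity
  have hi : IntegrableOn (fun x : E3 => ‖x‖ ^ (-3 : ℝ)) (endRegion R) := by
    refine Integrable.mono' (h0.const_mul ((‖c‖ ^ 2)⁻¹ * 2 ^ |(-3 : ℝ)|)) ?_ ?_
    · exact (continuous_norm.continuousOn.rpow_const fun x hx => Or.inl
        (by have : R < ‖x‖ := hx; linarith)).aestronglyMeasurable (measurableSet_endRegion R)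
    · filter_upwards [ae_restrict_mem (measurableSet_endRegion R)] with x (hx : R < ‖x‖)
      have h1 := rpow_le_mul_rpow (c := 2) (by linarith) (weight_pos x) (by norm_num)
        (by linarith [norm_le_weight x, weight_pos x]) (weight_le_two_mul_norm (x := x)
          (by linarith)) (-3)
      rw [Real.norm_of_nonneg (by positivity)]
      refine h1.trans ?_
      simp only [norm_iteratedFDeriv_zero]
      have h2 : weight x ^ (-3 : ℝ) ≤ weight x ^ (-2 * (δ - (0 : ℕ)) - 3) :=
        Real.rpow_le_rpow_of_exponent_le (one_le_weight x) (by push_cast; linarith)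
      calc _ ≤ 2 ^ |(-3 : ℝ)| * weight x ^ (-2 * (δ - (0 : ℕ)) - 3) := by gcongr
        _ = _ := by field_simp
  have h2 : Integrable ((fun t : ℝ => (Set.Ioi R).indicator (fun t => t ^ (-3 : ℝ)) t) ∘
      fun x : E3 => ‖x‖) := by
    rw [show ((fun t : ℝ => (Set.Ioi R).indicator (fun t => t ^ (-3 : ℝ)) t) ∘
      fun x : E3 => ‖x‖) = (endRegion R).indicator fun x : E3 => ‖x‖ ^ (-3 : ℝ) from rfl]
    rwa [integrable_indicator_iff (measurableSet_endRegion R)]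
  -- In polar coordinates `‖x‖^{-3}` becomes `t^{-1}`, whose integral diverges logarithmically.
  have h3 := (integrable_fun_norm_addHaar (volume : Measure E3)).1 h2
  have h4 : IntegrableOn (fun t : ℝ => t ^ (-1 : ℝ)) (Set.Ioi R) := by
    refine (h3.mono_set (Set.Ioi_subset_Ioi (by linarith : (0 : ℝ) ≤ R))).congr_fun
      (fun t ht => ?_) measurableSet_Ioi
    have ht0 : 0 < t := lt_of_lt_of_le (by linarith) (le_of_lt (show R < t from ht))
    simp only [Set.indicator_of_mem ht, smul_eq_mul, finrank_euclideanSpace, Fintype.card_fin]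
    rw [← Real.rpow_natCast, ← Real.rpow_add ht0]
    norm_num
  have := (integrableOn_Ioi_rpow_iff (by linarith : 0 < R)).1 h4
  linarith

end Integration

/-! ## Spinor algebra -/

section SpinorAlgebra

/-- `2^{-1/2}` as a complex number. -/
def rtHalf : ℂ := ((1 / Real.sqrt 2 : ℝ) : ℂ)

lemma rtHalf_sq : rtHalf ^ 2 = 1 / 2 := by
  have : (1 / Real.sqrt 2) ^ 2 = 1 / 2 := by rw [div_pow, Real.sq_sqrt (by norm_num)]; norm_num
  rw [rtHalf, ← Complex.ofReal_pow, this]; norm_num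

lemma rtHalf_mul_self : rtHalf * rtHalf = 1 / 2 := by rw [← rtHalf_sq, sq]

/-- The symbols `σ^a_{AB}` without their normalising factor. -/
def pauli : Fin 3 → Matrix (Fin 2) (Fin 2) ℂ :=
  ![!![-1, 0; 0, 1], !![-Complex.I, 0; 0, -Complex.I], !![0, 1; 1, 0]]

lemma sigma0_eq (a : Fin 3) (A B : Fin 2) : sigma0 a A B = rtHalf * pauli a A B := by
  fin_cases a <;> fin_cases A <;> fin_cases B <;> simp [sigma0, pauli, rtHalf]

lemma sigma0_symm (a : Fin 3) (A B : Fin 2) : sigma0 a A B = sigma0 a B A := by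
  fin_cases a <;> fin_cases A <;> fin_cases B <;> simp [sigma0]

/-- `σ^{a AB}` with both indices raised. -/
def sigmaUp (b : Fin 3) (C B : Fin 2) : ℂ := ∑ C', ∑ D, eps C C' * eps B D * sigma0 b C' D

/-- The constants relating the frame connection to the spin connection. -/
def connSym (a b : Fin 3) (A C : Fin 2) : ℂ := (1 / 2) * ∑ B, sigmaUp b C B * sigma0 a A B

lemma connSym_eq (a b : Fin 3) (A C : Fin 2) : connSym a b A C =
    (1 / 4) * ∑ B, (∑ C', ∑ D, eps C C' * eps B D * pauli b C' D) * pauli a A B := by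
  have h := rtHalf_mul_self
  simp only [connSym, sigmaUp, sigma0_eq, Fin.sum_univ_two]
  linear_combination ((1 / 2) * (((eps C 0 * eps 0 0 * pauli b 0 0 + eps C 0 * eps 0 1 * pauli b 0 1
    + (eps C 1 * eps 0 0 * pauli b 1 0 + eps C 1 * eps 0 1 * pauli b 1 1)) * pauli a A 0)
    + ((eps C 0 * eps 1 0 * pauli b 0 0 + eps C 0 * eps 1 1 * pauli b 0 1
    + (eps C 1 * eps 1 0 * pauli b 1 0 + eps C 1 * eps 1 1 * pauli b 1 1)) * pauli a A 1))) * h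

/-- The infinitesimal form of the double cover of the rotation group: an antisymmetric `w` acting on
both spinor indices is the action of `w` on the vector components, up to the sign fixed by the
conventions. -/
lemma connSym_action (w : Fin 3 → Fin 3 → ℂ) (hw : ∀ a b, w a b = -w b a) (k : Fin 3 → ℂ)
    (C D : Fin 2) :
    ∑ F, ((∑ a, ∑ b, w a b * connSym a b C F) * (∑ c, k c * sigma0 c F D)
      + (∑ a, ∑ b, w a b * connSym a b D F) * (∑ c, k c * sigma0 c C F)) =
    -∑ a, (∑ b, w a b * k b) * sigma0 a C D := by
  have hk (F D : Fin 2) : ∑ c, k c * sigma0 c F D = rtHalf * ∑ c, k c * pauli c F D := by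
    simp only [sigma0_eq, Finset.mul_sum]; exact Finset.sum_congr rfl fun c _ => by ring
  have hk' : -∑ a, (∑ b, w a b * k b) * sigma0 a C D =
      rtHalf * -∑ a, (∑ b, w a b * k b) * pauli a C D := by
    simp only [sigma0_eq, mul_neg, Finset.mul_sum]
    exact congrArg _ (Finset.sum_congr rfl fun c _ => by ring)
  rw [hk']
  simp only [hk]
  rw [show ∀ f g p q : Fin 2 → ℂ, ∑ F, (f F * (rtHalf * p F) + g F * (rtHalf * q F)) =
    rtHalf * ∑ F, (f F * p F + g F * q F) from fun f g p q => by
      simp only [Fin.sum_univ_two]; ring]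
  congr 1
  have h0 (a) : w a a = 0 := by
    have := hw a a; linear_combination (1 / 2) * this
  have h10 := hw 1 0
  have h20 := hw 2 0
  have h21 := hw 2 1
  have hI := Complex.I_mul_I
  fin_cases C <;> fin_cases D <;>
  simp [connSym_eq, pauli, eps, Fin.sum_univ_three, Fin.sum_univ_two, h0, h10, h20, h21] <;>
  ring_nf <;> simp only [Complex.I_sq] <;> ring

/-- Completeness relation. The right side is built from `ε` alone, so pure traces disappear under
total symmetrisation. -/
lemma sum_sigma0_mul_sigma0 (A B C D : Fin 2) : ∑ a, sigma0 a A B * sigma0 a C D =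
    -(1 / 2) * (eps A C * eps B D + eps A D * eps B C) := by
  have h : ∑ a, sigma0 a A B * sigma0 a C D = (1 / 2) * ∑ a, pauli a A B * pauli a C D := by
    simp only [sigma0_eq, ← rtHalf_mul_self, Finset.mul_sum]
    exact Finset.sum_congr rfl fun c _ => by ring
  rw [h]
  fin_cases A <;> fin_cases B <;> fin_cases C <;> fin_cases D <;>
  simp [pauli, eps, Fin.sum_univ_three] <;> norm_num

/-- The components `k_a` of a symmetric spinor `κ_{AB} = k_a σ^a_{AB}`. -/
def frameComp (κ : Matrix (Fin 2) (Fin 2) ℂ) : Fin 3 → ℂ :=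
  ![rtHalf * (κ 1 1 - κ 0 0), rtHalf * Complex.I * (κ 0 0 + κ 1 1), rtHalf * (κ 0 1 + κ 1 0)]

lemma sum_frameComp {κ : Matrix (Fin 2) (Fin 2) ℂ} (h : κ.IsSymm) (A B : Fin 2) :
    κ A B = ∑ a, frameComp κ a * sigma0 a A B := by
  have hq := rtHalf_mul_self
  have h10 : κ 1 0 = κ 0 1 := h.apply 0 1
  have hI := Complex.I_mul_I
  simp only [sigma0_eq]
  fin_cases A <;> fin_cases B <;>
  simp [frameComp, pauli, Fin.sum_univ_three, h10]
  · linear_combination (-2 * κ 0 0) * hq + rtHalf * rtHalf * (κ 0 0 + κ 1 1) * hI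
  · linear_combination (-2 * κ 0 1) * hq
  · linear_combination (-2 * κ 0 1) * hq
  · linear_combination (-2 * κ 1 1) * hq + rtHalf * rtHalf * (κ 0 0 + κ 1 1) * hI

/-- Multiplication of trace-free `2 × 2` matrices has the cross product as its commutator part. The
factor `i/√2` couples the real and imaginary parts of `k` through `K`. -/
lemma cross_action (K k : Fin 3 → ℂ) (C D : Fin 2) :
    (1 / 2) * ∑ F, ((-∑ G, eps F G * ∑ b, K b * sigma0 b C G) * (∑ c, k c * sigma0 c F D) +
      (-∑ G, eps F G * ∑ b, K b * sigma0 b D G) * (∑ c, k c * sigma0 c C F)) =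
    (rtHalf * Complex.I) * ∑ d, (crossProduct K k) d * sigma0 d C D := by
  simp only [sigma0_eq]
  have hI := Complex.I_mul_I
  fin_cases C <;> fin_cases D <;>
  simp [pauli, eps, Fin.sum_univ_three, Fin.sum_univ_two, cross_apply] <;>
  ring_nf <;> (try simp only [Complex.I_sq]) <;> ring

/-- Permutations are enumerated by splitting off the image of the first index, three times over. -/
lemma sum_perm_fin_four (f : Fin 4 → Fin 4 → Fin 4 → Fin 4 → ℂ) :
    ∑ π : Equiv.Perm (Fin 4), f (π 0) (π 1) (π 2) (π 3) =
      ((f 0 1 2 3 + f 0 1 3 2) + ((f 0 2 1 3 + f 0 2 3 1) + (f 0 3 2 1 + f 0 3 1 2))) +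
      (((f 1 0 2 3 + f 1 0 3 2) + ((f 1 2 0 3 + f 1 2 3 0) + (f 1 3 2 0 + f 1 3 0 2))) +
      (((f 2 1 0 3 + f 2 1 3 0) + ((f 2 0 1 3 + f 2 0 3 1) + (f 2 3 0 1 + f 2 3 1 0))) +
      ((f 3 1 2 0 + f 3 1 0 2) + ((f 3 2 1 0 + f 3 2 0 1) + (f 3 0 2 1 + f 3 0 1 2))))) := by
  rw [← Equiv.sum_comp Equiv.Perm.decomposeFin.symm, Fintype.sum_prod_type]
  simp only [← Equiv.sum_comp (Equiv.Perm.decomposeFin (n := 2)).symm, Fintype.sum_prod_type,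
    ← Equiv.sum_comp (Equiv.Perm.decomposeFin (n := 1)).symm, Fin.sum_univ_succ,
    Finset.univ_unique, Finset.sum_singleton]
  rfl

/-- Symmetry within each pair groups the 24 terms into the six ordered choices of a first pair, each
occurring four times. -/
lemma sum_perm_fin_four_of_symm (f : Fin 4 → Fin 4 → Fin 4 → Fin 4 → ℂ)
    (h₁ : ∀ a b c d, f a b c d = f b a c d) (h₂ : ∀ a b c d, f a b c d = f a b d c) :
    ∑ π : Equiv.Perm (Fin 4), f (π 0) (π 1) (π 2) (π 3) =
      4 * (f 0 1 2 3 + f 0 2 1 3 + f 0 3 1 2 + f 1 2 0 3 + f 1 3 0 2 + f 2 3 0 1) := by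
  rw [sum_perm_fin_four]
  simp only [h₁ 1 0, h₁ 2 0, h₁ 3 0, h₁ 2 1, h₁ 3 1, h₁ 3 2, h₂ _ _ 1 0, h₂ _ _ 2 0, h₂ _ _ 3 0,
    h₂ _ _ 2 1, h₂ _ _ 3 1, h₂ _ _ 3 2]
  ring

/-! ### Trace, antisymmetric and trace-free symmetric parts of a spinor of rank four -/

section Decomposition

variable (T : Fin 3 → Fin 3 → ℂ)

/-- The spinor `T_{ABCD} = σ^a_{AB} σ^b_{CD} T_{ab}`. -/
def spinorOf (T : Fin 3 → Fin 3 → ℂ) (A B C D : Fin 2) : ℂ :=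
  ∑ a, ∑ b, sigma0 a A B * sigma0 b C D * T a b

lemma spinorOf_eq (A B C D : Fin 2) : spinorOf T A B C D =
    (1 / 2) * ∑ a, ∑ b, pauli a A B * pauli b C D * T a b := by
  simp only [spinorOf, sigma0_eq, ← rtHalf_mul_self, Finset.mul_sum]
  exact Finset.sum_congr rfl fun a _ => Finset.sum_congr rfl fun b _ => by ring

lemma spinorOf_swap_left (A B C D : Fin 2) : spinorOf T A B C D = spinorOf T B A C D := by
  simp only [spinorOf, sigma0_symm _ A B]

lemma spinorOf_swap_right (A B C D : Fin 2) : spinorOf T A B C D = spinorOf T A B D C := by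
  simp only [spinorOf, sigma0_symm _ C D]

lemma trace_spinorOf : ∑ A, ∑ B, ∑ C, ∑ D, eps A C * eps B D * spinorOf T C D A B =
    -∑ a, T a a := by
  simp only [spinorOf_eq]
  simp [pauli, eps, Fin.sum_univ_three, Fin.sum_univ_two]
  ring_nf

/-- Contracting one index of each pair and symmetrising the remaining two retains exactly the
antisymmetric part of `T`, written as its dual vector. -/
lemma curl_spinorOf (A B : Fin 2) :
    (3 / 2) * ((1 / 2) * ((∑ D, ∑ G, eps D G * spinorOf T A G B D)
      + (∑ D, ∑ G, eps D G * spinorOf T B G A D))) =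
    -(3 / 2) * (rtHalf * Complex.I) * ((T 1 2 - T 2 1) * sigma0 0 A B + (T 2 0 - T 0 2) * sigma0 1 A B
      + (T 0 1 - T 1 0) * sigma0 2 A B) := by
  have hq : rtHalf * Complex.I * ((T 1 2 - T 2 1) * sigma0 0 A B + (T 2 0 - T 0 2) * sigma0 1 A B
      + (T 0 1 - T 1 0) * sigma0 2 A B) = (1 / 2) * Complex.I * ((T 1 2 - T 2 1) * pauli 0 A B +
      (T 2 0 - T 0 2) * pauli 1 A B + (T 0 1 - T 1 0) * pauli 2 A B) := by
    simp only [sigma0_eq, ← rtHalf_mul_self]; ring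
  rw [mul_assoc, hq, neg_mul]
  simp only [spinorOf_eq]
  fin_cases A <;> fin_cases B <;>
  simp [pauli, eps, Fin.sum_univ_three, Fin.sum_univ_two] <;>
  ring_nf <;> (try simp only [Complex.I_sq]) <;> ring

/-- The totally symmetric part of `T_{ABCD}`. -/
def symmPart (T : Fin 3 → Fin 3 → ℂ) (i : Fin 4 → Fin 2) : ℂ :=
  (1 / 24) * ∑ π : Equiv.Perm (Fin 4), spinorOf T (i (π 0)) (i (π 1)) (i (π 2)) (i (π 3))

lemma symmPart_eq_six (i : Fin 4 → Fin 2) : symmPart T i = (1 / 6) *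
    (spinorOf T (i 0) (i 1) (i 2) (i 3) + spinorOf T (i 0) (i 2) (i 1) (i 3) +
      spinorOf T (i 0) (i 3) (i 1) (i 2) + spinorOf T (i 1) (i 2) (i 0) (i 3) +
      spinorOf T (i 1) (i 3) (i 0) (i 2) + spinorOf T (i 2) (i 3) (i 0) (i 1)) := by
  rw [symmPart, sum_perm_fin_four_of_symm (fun a b c d => spinorOf T (i a) (i b) (i c) (i d))
    (fun _ _ _ _ => spinorOf_swap_left _ _ _ _ _) (fun _ _ _ _ => spinorOf_swap_right _ _ _ _ _)]
  ring

lemma ofReal_kron (a b : Fin 3) : (kron a b : ℂ) = if a = b then 1 else 0 := by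
  unfold kron; split_ifs <;> simp

/-- Subtracting an arbitrary trace `2 l δ` from the symmetric part costs only an `ε` term, by the
completeness relation. -/
lemma spinorOf_add_swap (A B C D : Fin 2) (l : ℂ) :
    spinorOf T A B C D + spinorOf T C D A B = (∑ a, ∑ b, sigma0 a A B * sigma0 b C D *
      (T a b + T b a - 2 * l * kron a b)) - l * (eps A C * eps B D + eps A D * eps B C) := by
  have h1 : spinorOf T C D A B = ∑ a, ∑ b, sigma0 a A B * sigma0 b C D * T b a := by
    rw [spinorOf, Finset.sum_comm]
    exact Finset.sum_congr rfl fun a _ => Finset.sum_congr rfl fun b _ => by ring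
  have h2 : ∑ a, ∑ b, sigma0 a A B * sigma0 b C D * (kron a b : ℂ) =
      ∑ a, sigma0 a A B * sigma0 a C D :=
    Finset.sum_congr rfl fun a _ => by simp [ofReal_kron]
  have h3 := sum_sigma0_mul_sigma0 A B C D
  rw [← h2] at h3
  rw [h1, spinorOf]
  have h4 : ∑ a, ∑ b, sigma0 a A B * sigma0 b C D * (T a b + T b a - 2 * l * kron a b) =
      ∑ a, ∑ b, sigma0 a A B * sigma0 b C D * T a b + ∑ a, ∑ b, sigma0 a A B * sigma0 b C D * T b a
      - 2 * l * ∑ a, ∑ b, sigma0 a A B * sigma0 b C D * (kron a b : ℂ) := by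
    simp only [Finset.mul_sum, ← Finset.sum_add_distrib, ← Finset.sum_sub_distrib]
    exact Finset.sum_congr rfl fun a _ => Finset.sum_congr rfl fun b _ => by ring
  rw [h4, h3]; ring

lemma eps_antisymm (A B : Fin 2) : eps A B = -eps B A := by
  fin_cases A <;> fin_cases B <;> simp [eps]

/-- The totally symmetric part only depends on the trace-free symmetric part of `T`. -/
lemma symmPart_eq (l : ℂ) (i : Fin 4 → Fin 2) : symmPart T i = (1 / 6) * ∑ a, ∑ b,
    (sigma0 a (i 0) (i 1) * sigma0 b (i 2) (i 3) + sigma0 a (i 0) (i 2) * sigma0 b (i 1) (i 3)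
      + sigma0 a (i 0) (i 3) * sigma0 b (i 1) (i 2)) * (T a b + T b a - 2 * l * kron a b) := by
  have h1 := spinorOf_add_swap T (i 0) (i 1) (i 2) (i 3) l
  have h2 := spinorOf_add_swap T (i 0) (i 2) (i 1) (i 3) l
  have h3 := spinorOf_add_swap T (i 0) (i 3) (i 1) (i 2) l
  -- With these signs the `ε` terms of the three pairings cancel in the sum.
  rw [eps_antisymm (i 2) (i 1)] at h2
  rw [eps_antisymm (i 3) (i 1), eps_antisymm (i 3) (i 2)] at h3
  simp only [add_mul, Finset.sum_add_distrib]
  rw [symmPart_eq_six]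
  linear_combination (1 / 6) * (h1 + h2 + h3)

/-- A totally symmetric spinor of rank four has five components, as many as a trace-free symmetric
tensor. Uniqueness needs this converse direction to pass from decay of `ξ_{ABCD}` to decay of the
tensor. -/
lemma symmPart_inverse :
    T 0 0 - T 1 1 = symmPart T ![0, 0, 0, 0] + symmPart T ![1, 1, 1, 1] ∧
    T 0 1 + T 1 0 = -Complex.I * (symmPart T ![0, 0, 0, 0] - symmPart T ![1, 1, 1, 1]) ∧
    T 0 2 + T 2 0 = 2 * (symmPart T ![0, 1, 1, 1] - symmPart T ![0, 0, 0, 1]) ∧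
    T 1 2 + T 2 1 = 2 * Complex.I * (symmPart T ![0, 1, 1, 1] + symmPart T ![0, 0, 0, 1]) ∧
    2 * T 2 2 - T 0 0 - T 1 1 = 6 * symmPart T ![0, 0, 1, 1] := by
  have hI := Complex.I_sq
  simp only [symmPart_eq_six, spinorOf_eq]
  refine ⟨?_, ?_, ?_, ?_, ?_⟩ <;>
  simp [pauli, Fin.sum_univ_three] <;>
  ring_nf <;> (try simp only [Complex.I_sq]) <;> ring

end Decomposition

end SpinorAlgebra

/-! ## Partial derivatives -/

section PartialDerivatives

variable {F : Type*} [NormedAddCommGroup F] [NormedSpace ℝ F]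

lemma pd_congr {f g : E3 → F} {x : E3} (i : Fin 3) (h : f =ᶠ[𝓝 x] g) : pd i f x = pd i g x := by
  rw [pd, h.fderiv_eq, pd]

lemma pd_congr_endRegion {f g : E3 → F} {R : ℝ} (i : Fin 3) (h : Set.EqOn f g (endRegion R)) :
    Set.EqOn (pd i f) (pd i g) (endRegion R) := fun _ hx =>
  pd_congr i (h.eventuallyEq_of_mem ((isOpen_endRegion R).mem_nhds hx))

lemma pd_add {f g : E3 → F} {x : E3} (i : Fin 3) (hf : DifferentiableAt ℝ f x)
    (hg : DifferentiableAt ℝ g x) : pd i (fun y => f y + g y) x = pd i f x + pd i g x := by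
  simp [pd, fderiv_fun_add hf hg]

lemma pd_sub {f g : E3 → F} {x : E3} (i : Fin 3) (hf : DifferentiableAt ℝ f x)
    (hg : DifferentiableAt ℝ g x) : pd i (fun y => f y - g y) x = pd i f x - pd i g x := by
  simp [pd, fderiv_fun_sub hf hg]

lemma pd_const (c : F) (x : E3) (i : Fin 3) : pd i (fun _ => c) x = 0 := by
  simp [pd]

lemma pd_sum {ι : Type*} {s : Finset ι} {f : ι → E3 → F} {x : E3} (i : Fin 3)
    (hf : ∀ j ∈ s, DifferentiableAt ℝ (f j) x) :
    pd i (fun y => ∑ j ∈ s, f j y) x = ∑ j ∈ s, pd i (f j) x := by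
  simp [pd, fderiv_fun_sum hf]

lemma pd_mul {A : Type*} [NormedCommRing A] [NormedAlgebra ℝ A] {f g : E3 → A} {x : E3} (i : Fin 3)
    (hf : DifferentiableAt ℝ f x) (hg : DifferentiableAt ℝ g x) :
    pd i (fun y => f y * g y) x = pd i f x * g x + f x * pd i g x := by
  simp [pd, fderiv_fun_mul hf hg]; ring

lemma pd_clm_comp {G : Type*} [NormedAddCommGroup G] [NormedSpace ℝ G] (L : F →L[ℝ] G)
    {f : E3 → F} {x : E3} (i : Fin 3) (hf : DifferentiableAt ℝ f x) :
    pd i (fun y => L (f y)) x = L (pd i f x) := by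
  have := (L.hasFDerivAt.comp x hf.hasFDerivAt).fderiv
  simp only [pd]
  rw [show (fun y => L (f y)) = L ∘ f from rfl, this]
  rfl

lemma pd_ofReal {f : E3 → ℝ} {x : E3} (i : Fin 3) (hf : DifferentiableAt ℝ f x) :
    pd i (fun y => (f y : ℂ)) x = ((pd i f x : ℝ) : ℂ) :=
  pd_clm_comp Complex.ofRealCLM i hf

lemma differentiableAt_ofReal {f : E3 → ℝ} {x : E3} (hf : DifferentiableAt ℝ f x) :
    DifferentiableAt ℝ (fun y => (f y : ℂ)) x :=
  Complex.ofRealCLM.differentiableAt.comp x hf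

lemma pd_comm {f : E3 → F} {x : E3} (i j : Fin 3) (hf : ContDiffAt ℝ ∞ f x) :
    pd i (pd j f) x = pd j (pd i f) x := by
  have hsym := hf.isSymmSndFDerivAt (by
    rw [minSmoothness_of_isRCLikeNormedField]; exact WithTop.coe_le_coe.2 le_top)
  have hd : DifferentiableAt ℝ (fderiv ℝ f) x :=
    ((hf.fderiv_right (m := ∞) (by simp)).differentiableAt (by simp))
  have h (i j : Fin 3) : pd i (pd j f) x =
      fderiv ℝ (fderiv ℝ f) x (EuclideanSpace.single i 1) (EuclideanSpace.single j 1) :=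
    pd_clm_comp (ContinuousLinearMap.apply ℝ F (EuclideanSpace.single j 1)) i hd
  rw [h, h, hsym]

end PartialDerivatives

/-! ## The Levi-Civita and spin connections of an orthonormal frame -/

section Geometry

variable {R₀ : ℝ} {h K e : E3 → Matrix (Fin 3) (Fin 3) ℝ} {x : E3}

lemma IsVacuumData.symm_h (hd : IsVacuumData R₀ h K) (hx : x ∈ endRegion R₀) (i j : Fin 3) :
    h x i j = h x j i := by
  have := (hd.negDef x hx).isHermitian.apply i j
  simp at this; exact this.symm

lemma differentiableAt_of_smooth {F : Type*} [NormedAddCommGroup F] [NormedSpace ℝ F] {f : E3 → F}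
    (hf : ContDiffOn ℝ ∞ f (endRegion R₀)) (hx : x ∈ endRegion R₀) : DifferentiableAt ℝ f x :=
  (contDiffAt_endRegion hf hx).differentiableAt (by simp)

lemma IsVacuumData.pd_symm_h (hd : IsVacuumData R₀ h K) (hx : x ∈ endRegion R₀) (l i j : Fin 3) :
    pd l (fun y => h y i j) x = pd l (fun y => h y j i) x :=
  pd_congr_endRegion l (fun _ hy => hd.symm_h hy i j) hx

lemma frame_mul (he : IsCartesianFrame R₀ h e) (hx : x ∈ endRegion R₀) :
    e x * h x * (e x).transpose = -1 := by
  ext a b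
  have := he.orthonormal x hx a b
  simp only [Matrix.mul_apply, Matrix.transpose_apply, Matrix.neg_apply, Matrix.one_apply]
  simp only [kron] at this
  rw [← this, Finset.sum_comm]
  exact Finset.sum_congr rfl fun i _ => by
    rw [Finset.sum_mul]; exact Finset.sum_congr rfl fun j _ => by ring

lemma transpose_mul_frame_mul (he : IsCartesianFrame R₀ h e) (hx : x ∈ endRegion R₀) :
    (e x).transpose * (e x * h x) = -1 := by
  have h1 : (-(e x * h x)) * (e x).transpose = 1 := by
    rw [Matrix.neg_mul, frame_mul he hx, neg_neg]
  have h2 := mul_eq_one_comm.1 h1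
  rw [Matrix.mul_neg] at h2
  rw [← h2, neg_neg]

/-- Expressing the inverse metric as a polynomial in the frame means that its symbol class follows
from that of `e`, without inverting a function of `x`. -/
lemma inv_metric (he : IsCartesianFrame R₀ h e) (hx : x ∈ endRegion R₀) :
    (h x)⁻¹ = -((e x).transpose * e x) := by
  apply Matrix.inv_eq_left_inv
  rw [Matrix.neg_mul, Matrix.mul_assoc, transpose_mul_frame_mul he hx, neg_neg]

lemma sum_frame_mul_metric (he : IsCartesianFrame R₀ h e) (hx : x ∈ endRegion R₀) (i l : Fin 3) :
    ∑ a, e x a i * ∑ j, e x a j * h x j l = -kron i l := by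
  have := congrFun (congrFun (transpose_mul_frame_mul he hx) i) l
  simpa [Matrix.mul_apply, Matrix.one_apply, kron] using this

lemma metric_mul_christoffel (hd : IsVacuumData R₀ h K) (hx : x ∈ endRegion R₀) (k i j : Fin 3) :
    ∑ l, h x k l * christoffel h l i j x = (1 / 2) * (pd i (fun y => h y k j) x +
      pd j (fun y => h y k i) x - pd k (fun y => h y i j) x) := by
  have hdet : IsUnit (h x).det := by
    have h1 := (hd.negDef x hx).isUnit
    rw [← Matrix.isUnit_iff_isUnit_det]
    simpa using h1
  have hinv : ∀ k m, ∑ l, h x k l * (h x)⁻¹ l m = if k = m then 1 else 0 := fun k m => by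
    have := congrFun (congrFun (Matrix.mul_nonsing_inv _ hdet) k) m
    simpa [Matrix.mul_apply, Matrix.one_apply] using this
  simp only [christoffel]
  calc _ = (1 / 2) * ∑ m, (∑ l, h x k l * (h x)⁻¹ l m) * (pd i (fun y => h y m j) x +
        pd j (fun y => h y m i) x - pd m (fun y => h y i j) x) := by
        simp only [Finset.mul_sum, Finset.sum_mul]
        rw [Finset.sum_comm]
        exact Finset.sum_congr rfl fun m _ => Finset.sum_congr rfl fun l _ => by ring
    _ = _ := by simp [hinv]

/-- The components `(D_i e_a)^j`. -/
def frameDeriv (h e : E3 → Matrix (Fin 3) (Fin 3) ℝ) (i a j : Fin 3) (x : E3) : ℝ :=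
  pd i (fun y => e y a j) x + ∑ k, christoffel h j i k x * e x a k

/-- The connection coefficients `h(D_i e_a, e_b)`. -/
def connCoeff (h e : E3 → Matrix (Fin 3) (Fin 3) ℝ) (i a b : Fin 3) (x : E3) : ℝ :=
  ∑ j, (∑ k, h x j k * e x b k) * frameDeriv h e i a j x

lemma connCoeff_eq (hd : IsVacuumData R₀ h K) (hx : x ∈ endRegion R₀) (i a b : Fin 3) :
    connCoeff h e i a b x = ∑ j, ∑ k, h x j k * e x b k * pd i (fun y => e y a j) x +
      ∑ k, ∑ l, e x b k * e x a l * ((1 / 2) * (pd i (fun y => h y k l) x +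
        pd l (fun y => h y k i) x - pd k (fun y => h y l i) x)) := by
  have hc := fun k l => metric_mul_christoffel hd hx k i l
  have hs := hd.symm_h hx
  simp only [fun k l => hd.pd_symm_h hx k i l] at hc
  simp only [← hc, connCoeff, frameDeriv, mul_add, Finset.sum_add_distrib]
  congr 1
  · simp only [Finset.sum_mul]
  · simp only [Fin.sum_univ_three, hs 1 0, hs 2 0, hs 2 1]
    ring

/-- Metric compatibility: differentiate the constant `h(e_a, e_b) = -δ_{ab}`; the derivatives of `h`
enter through the lowered Christoffel symbols. -/
lemma connCoeff_antisymm (hd : IsVacuumData R₀ h K) (he : IsCartesianFrame R₀ h e)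
    (hx : x ∈ endRegion R₀) (i a b : Fin 3) : connCoeff h e i a b x = -connCoeff h e i b a x := by
  have hde (a j) := differentiableAt_of_smooth (he.smooth a j) hx
  have hdh (a j) := differentiableAt_of_smooth (hd.smooth_h a j) hx
  have h1 : pd i (fun y => ∑ j, ∑ k, h y j k * e y a j * e y b k) x = 0 := by
    rw [pd_congr_endRegion i (g := fun _ => -kron a b) (fun y hy => he.orthonormal y hy a b) hx,
      pd_const]
  have hd2 (j k) : DifferentiableAt ℝ (fun y => h y j k * e y a j) x := (hdh j k).mul (hde a j)
  have hd3 (j k) : DifferentiableAt ℝ (fun y => h y j k * e y a j * e y b k) x :=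
    (hd2 j k).mul (hde b k)
  rw [pd_sum i fun j _ => DifferentiableAt.fun_sum fun k _ => hd3 j k] at h1
  simp only [pd_sum i fun k _ => hd3 _ k, pd_mul i (hd2 _ _) (hde _ _),
    pd_mul i (hdh _ _) (hde _ _)] at h1
  have hs := hd.symm_h hx
  have hps := hd.pd_symm_h hx
  rw [connCoeff_eq hd hx, connCoeff_eq hd hx]
  simp only [Fin.sum_univ_three, hs 1 0, hs 2 0, hs 2 1, hps _ 1 0, hps _ 2 0, hps _ 2 1] at h1 ⊢
  linear_combination h1

lemma sum_metric_frame_mul_frame (hd : IsVacuumData R₀ h K) (he : IsCartesianFrame R₀ h e)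
    (hx : x ∈ endRegion R₀) (l j : Fin 3) :
    ∑ b, (∑ k, h x l k * e x b k) * e x b j = -kron l j := by
  have hkron : kron l j = kron j l := by simp only [kron, eq_comm]
  rw [hkron, ← sum_frame_mul_metric he hx j l]
  refine Finset.sum_congr rfl fun b _ => ?_
  rw [mul_comm]
  exact congrArg _ (Finset.sum_congr rfl fun k _ => by rw [hd.symm_h hx l k, mul_comm])

/-- Expansion of `D_i e_a` in the frame; the minus sign comes from `h(e_b, e_b) = -1`. -/
lemma frameDeriv_eq (hd : IsVacuumData R₀ h K) (he : IsCartesianFrame R₀ h e)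
    (hx : x ∈ endRegion R₀) (i a j : Fin 3) :
    frameDeriv h e i a j x = -∑ b, connCoeff h e i a b x * e x b j := by
  have h1 : ∑ b, connCoeff h e i a b x * e x b j =
      ∑ l, (∑ b, (∑ k, h x l k * e x b k) * e x b j) * frameDeriv h e i a l x := by
    simp only [connCoeff, Finset.sum_mul]
    rw [Finset.sum_comm]
    refine Finset.sum_congr rfl fun l _ => Finset.sum_congr rfl fun b _ =>
      Finset.sum_congr rfl fun k _ => by ring
  rw [h1]
  simp only [sum_metric_frame_mul_frame hd he hx]
  simp [kron]

lemma differentiableAt_solder (he : IsCartesianFrame R₀ h e) (hx : x ∈ endRegion R₀)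
    (j : Fin 3) (A B : Fin 2) : DifferentiableAt ℝ (solder e j A B) x :=
  DifferentiableAt.fun_sum fun a _ =>
    (differentiableAt_ofReal (differentiableAt_of_smooth (he.smooth a j) hx)).mul_const _

lemma pd_solder (he : IsCartesianFrame R₀ h e) (hx : x ∈ endRegion R₀)
    (i j : Fin 3) (A B : Fin 2) : pd i (solder e j A B) x =
      ∑ a, ((pd i (fun y => e y a j) x : ℝ) : ℂ) * sigma0 a A B := by
  have hd (a) := differentiableAt_of_smooth (he.smooth a j) hx
  have : solder e j A B = fun y => ∑ a, (e y a j : ℂ) * sigma0 a A B := rfl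
  rw [this, pd_sum i fun a _ => (differentiableAt_ofReal (hd a)).mul_const _]
  refine Finset.sum_congr rfl fun a _ => ?_
  rw [pd_mul i (differentiableAt_ofReal (hd a)) (differentiableAt_const _), pd_const, pd_ofReal i (hd a)]
  ring

lemma solderUp_eq (j : Fin 3) (C B : Fin 2) : solderUp h e j C B x =
    ∑ b, ((∑ k, h x j k * e x b k : ℝ) : ℂ) * sigmaUp b C B := by
  simp only [solderUp, solder, sigmaUp, Fin.sum_univ_two, Fin.sum_univ_three]
  push_cast
  ring

/-- The spin connection is the frame connection carried over by the constants `connSym`, so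
`connSym_action` computes its effect on symmetric spinors. -/
lemma spinConn_eq (he : IsCartesianFrame R₀ h e) (hx : x ∈ endRegion R₀) (i : Fin 3)
    (A C : Fin 2) : spinConn h e i A C x =
      ∑ a, ∑ b, (connCoeff h e i a b x : ℂ) * connSym a b A C := by
  have h1 (j B) : pd i (solder e j A B) x +
      ∑ k, (christoffel h j i k x : ℂ) * solder e k A B x =
      ∑ a, (frameDeriv h e i a j x : ℂ) * sigma0 a A B := by
    rw [pd_solder he hx]
    simp only [frameDeriv, solder, Fin.sum_univ_three]
    push_cast
    ring
  have h2 (u f : Fin 3 → Fin 3 → ℂ) (g q : Fin 3 → Fin 2 → ℂ) :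
      (1 / 2) * ∑ j, ∑ B, (∑ b, u j b * g b B) * (∑ a, f a j * q a B) =
      ∑ a, ∑ b, (∑ j, u j b * f a j) * ((1 / 2) * ∑ B, g b B * q a B) := by
    simp only [Fin.sum_univ_three, Fin.sum_univ_two]
    ring
  simp only [spinConn, h1, solderUp_eq, connSym, connCoeff]
  rw [h2]
  push_cast
  rfl

/-- The Levi-Civita derivative `D_i k_j` of a complex covector field. -/
def covGrad (h : E3 → Matrix (Fin 3) (Fin 3) ℝ) (k : Fin 3 → E3 → ℂ) (i j : Fin 3) (x : E3) : ℂ :=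
  pd i (k j) x - ∑ l, (christoffel h l i j x : ℂ) * k l x

/-- The soldering form is parallel: the derivatives of the frame, the spin connection and the
Christoffel symbols combine so that only `D_i k_j` is left. -/
lemma covDeriv_eq (hd : IsVacuumData R₀ h K) (he : IsCartesianFrame R₀ h e)
    (hx : x ∈ endRegion R₀) {κ : E3 → Matrix (Fin 2) (Fin 2) ℂ} {k : Fin 3 → E3 → ℂ}
    (hk : ∀ j, DifferentiableAt ℝ (k j) x)
    (hκ : ∀ y ∈ endRegion R₀, ∀ C D, κ y C D = ∑ j, k j y * solder e j C D y) (i : Fin 3)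
    (C D : Fin 2) :
    covDeriv h e κ i C D x = ∑ j, solder e j C D x * covGrad h k i j x := by
  have hs (j) := differentiableAt_solder he hx j C D
  have hpd : pd i (fun y => κ y C D) x = ∑ j, (pd i (k j) x * solder e j C D x +
      k j x * ∑ a, ((pd i (fun y => e y a j) x : ℝ) : ℂ) * sigma0 a C D) := by
    rw [pd_congr_endRegion i (fun y hy => hκ y hy C D) hx, pd_sum i fun j _ => (hk j).fun_mul (hs j)]
    simp only [pd_mul i (hk _) (hs _), pd_solder he hx]
  have hframe (F G) : κ x F G = ∑ a, (∑ j, k j x * e x a j) * sigma0 a F G := by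
    rw [hκ x hx]
    simp only [solder, Fin.sum_univ_three]
    ring
  have hspin : ∑ F, (spinConn h e i C F x * κ x F D + spinConn h e i D F x * κ x C F) =
      -∑ a, (∑ b, (connCoeff h e i a b x : ℂ) * ∑ j, k j x * e x b j) * sigma0 a C D := by
    simp only [spinConn_eq he hx, hframe]
    exact connSym_action _ (fun a b => by rw [connCoeff_antisymm hd he hx]; push_cast; rfl) _ C D
  have hω (a j : Fin 3) : ((pd i (fun y => e y a j) x : ℝ) : ℂ) =
      -∑ b, (connCoeff h e i a b x : ℂ) * e x b j - ∑ l, (christoffel h j i l x : ℂ) * e x a l := by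
    have := frameDeriv_eq hd he hx i a j
    rw [frameDeriv, ← eq_sub_iff_add_eq] at this
    exact_mod_cast this
  rw [covDeriv, hpd, hspin]
  simp only [hω, covGrad, solder]
  have halg (P k q : Fin 3 → ℂ) (w f G : Fin 3 → Fin 3 → ℂ) :
      ∑ j, (P j * ∑ a, f a j * q a + k j * ∑ a, (-∑ b, w a b * f b j - ∑ l, G j l * f a l) * q a)
        - -∑ a, (∑ b, w a b * ∑ j, k j * f b j) * q a =
      ∑ j, (∑ a, f a j * q a) * (P j - ∑ l, G l j * k l) := by
    simp only [Fin.sum_univ_three]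
    ring
  exact halg (fun j => pd i (k j) x) (fun j => k j x) (fun a => sigma0 a C D)
    (fun a b => connCoeff h e i a b x) (fun a j => e x a j) (fun j l => christoffel h j i l x)

/-- The frame components `K_{ab}`. -/
def frameK (K e : E3 → Matrix (Fin 3) (Fin 3) ℝ) (a b : Fin 3) (x : E3) : ℂ :=
  ∑ i, ∑ j, (e x a i : ℂ) * e x b j * K x i j

/-- The frame components `k_a` of a covector field. -/
def frameCov (e : E3 → Matrix (Fin 3) (Fin 3) ℝ) (k : Fin 3 → E3 → ℂ) (a : Fin 3) (x : E3) : ℂ :=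
  ∑ j, k j x * e x a j

/-- The frame components of the Sen derivative of the spinor corresponding to the covector `k`. -/
def senTensor (h K e : E3 → Matrix (Fin 3) (Fin 3) ℝ) (k : Fin 3 → E3 → ℂ) (a b : Fin 3) (x : E3) :
    ℂ :=
  (∑ i, ∑ j, (e x a i : ℂ) * e x b j * covGrad h k i j x) +
    rtHalf * Complex.I * crossProduct (fun c => frameK K e a c x) (fun c => frameCov e k c x) b

/-- The bridge from spinors to tensors: `D_{AB}` gives the covariant gradient of `k` in the frame,
and the two `K` terms give the cross product by `cross_action`. -/
lemma sen_eq (hd : IsVacuumData R₀ h K) (he : IsCartesianFrame R₀ h e)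
    (hx : x ∈ endRegion R₀) {κ : E3 → Matrix (Fin 2) (Fin 2) ℂ} {k : Fin 3 → E3 → ℂ}
    (hk : ∀ j, DifferentiableAt ℝ (k j) x)
    (hκ : ∀ y ∈ endRegion R₀, ∀ C D, κ y C D = ∑ j, k j y * solder e j C D y) (A B C D : Fin 2) :
    sen h K e κ A B C D x = spinorOf (fun a b => senTensor h K e k a b x) A B C D := by
  have hframe (F G) : κ x F G = ∑ a, frameCov e k a x * sigma0 a F G := by
    rw [hκ x hx]
    simp only [solder, frameCov, Fin.sum_univ_three]
    ring
  have hK (C F) : spinKUp K e A B C F x =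
      ∑ a, sigma0 a A B * -∑ G, eps F G * ∑ b, frameK K e a b x * sigma0 b C G := by
    have hsum (f M : Fin 3 → Fin 3 → ℂ) (q r : Fin 3 → ℂ) :
        ∑ i, ∑ j, (∑ a, f a i * q a) * (∑ a, f a j * r a) * M i j =
          ∑ a, q a * ∑ b, (∑ i, ∑ j, f a i * f b j * M i j) * r b := by
      simp only [Fin.sum_univ_three]
      ring
    have hspin (G) : spinK K e A B C G x =
        -∑ a, sigma0 a A B * ∑ b, frameK K e a b x * sigma0 b C G :=
      congrArg _ (hsum (fun a i => e x a i) (fun i j => K x i j) (fun a => sigma0 a A B)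
        fun a => sigma0 a C G)
    simp only [spinKUp, hspin, Fin.sum_univ_two, Fin.sum_univ_three (fun a => sigma0 a A B * _)]
    ring
  have hfirst (f M : Fin 3 → Fin 3 → ℂ) (q r : Fin 3 → ℂ) :
      ∑ i, (∑ a, f a i * q a) * ∑ j, (∑ a, f a j * r a) * M i j =
        ∑ a, ∑ b, q a * r b * ∑ i, ∑ j, f a i * f b j * M i j := by
    simp only [Fin.sum_univ_three]
    ring
  have hsecond (q : Fin 3 → ℂ) (X Y : Fin 3 → Fin 2 → ℂ) (u v : Fin 2 → ℂ) :
      (1 / 2) * ∑ F, ((∑ a, q a * -X a F) * u F + (∑ a, q a * -Y a F) * v F) =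
        ∑ a, q a * ((1 / 2) * ∑ F, (-X a F * u F + -Y a F * v F)) := by
    simp only [Fin.sum_univ_three, Fin.sum_univ_two]
    ring
  rw [sen]
  simp only [covDeriv_eq hd he hx hk hκ, hK, hframe, hsecond, cross_action]
  simp only [solder]
  rw [hfirst]
  simp only [spinorOf, senTensor, mul_add, Finset.sum_add_distrib, Finset.mul_sum]
  congr 1
  exact Finset.sum_congr rfl fun a _ => Finset.sum_congr rfl fun b _ => by ring

end Geometry

/-! ## Irreducible parts of the Sen derivative -/

section IrreducibleParts

variable {R₀ : ℝ} {h K e : E3 → Matrix (Fin 3) (Fin 3) ℝ} {x : E3}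
  {κ : E3 → Matrix (Fin 2) (Fin 2) ℂ} {k : Fin 3 → E3 → ℂ}

/-- `κ_{CD} = k_j σ^j_{CD}` on the end, for a smooth covector field `k`. -/
structure IsSpinorOf (R₀ : ℝ) (e : E3 → Matrix (Fin 3) (Fin 3) ℝ) (k : Fin 3 → E3 → ℂ)
    (κ : E3 → Matrix (Fin 2) (Fin 2) ℂ) : Prop where
  smooth : ∀ j, ContDiffOn ℝ ∞ (k j) (endRegion R₀)
  eq : ∀ y ∈ endRegion R₀, ∀ C D, κ y C D = ∑ j, k j y * solder e j C D y

lemma IsSpinorOf.sen_eq (hκ : IsSpinorOf R₀ e k κ) (hd : IsVacuumData R₀ h K)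
    (he : IsCartesianFrame R₀ h e) (hx : x ∈ endRegion R₀) (A B C D : Fin 2) :
    sen h K e κ A B C D x = spinorOf (fun a b => senTensor h K e k a b x) A B C D :=
  KillingSpinorEnd.sen_eq hd he hx (fun j => differentiableAt_of_smooth (hκ.smooth j) hx) hκ.eq
    A B C D

lemma IsSpinorOf.xi0_eq (hκ : IsSpinorOf R₀ e k κ) (hd : IsVacuumData R₀ h K)
    (he : IsCartesianFrame R₀ h e) (hx : x ∈ endRegion R₀) :
    xi0 h K e κ x = -∑ a, senTensor h K e k a a x := by
  rw [← trace_spinorOf (fun a b => senTensor h K e k a b x)]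
  simp only [xi0, hκ.sen_eq hd he hx]

lemma IsSpinorOf.xi2_eq (hκ : IsSpinorOf R₀ e k κ) (hd : IsVacuumData R₀ h K)
    (he : IsCartesianFrame R₀ h e) (hx : x ∈ endRegion R₀) (A B : Fin 2) :
    xi2 h K e κ A B x = -(3 / 2) * (rtHalf * Complex.I) *
      ((senTensor h K e k 1 2 x - senTensor h K e k 2 1 x) * sigma0 0 A B +
       (senTensor h K e k 2 0 x - senTensor h K e k 0 2 x) * sigma0 1 A B +
       (senTensor h K e k 0 1 x - senTensor h K e k 1 0 x) * sigma0 2 A B) := by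
  rw [← curl_spinorOf (fun a b => senTensor h K e k a b x)]
  simp only [xi2, senContr, hκ.sen_eq hd he hx]

lemma IsSpinorOf.xi4_eq (hκ : IsSpinorOf R₀ e k κ) (hd : IsVacuumData R₀ h K)
    (he : IsCartesianFrame R₀ h e) (hx : x ∈ endRegion R₀) (a : Fin 4 → Fin 2) :
    xi4 h K e κ a x = symmPart (fun a b => senTensor h K e k a b x) a := by
  simp only [xi4, symmPart, hκ.sen_eq hd he hx]

/-- The covector field of a symmetric spinor field. -/
def covOf (h e : E3 → Matrix (Fin 3) (Fin 3) ℝ) (κ : E3 → Matrix (Fin 2) (Fin 2) ℂ) (j : Fin 3)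
    (x : E3) : ℂ :=
  -∑ a, (∑ l, (h x j l : ℂ) * e x a l) * frameComp (κ x) a

lemma covOf_mul_frame (he : IsCartesianFrame R₀ h e) (hx : x ∈ endRegion R₀) (b : Fin 3) :
    ∑ j, covOf h e κ j x * e x b j = frameComp (κ x) b := by
  have h1 (a) : ∑ i, ∑ j, (h x i j : ℂ) * e x b i * e x a j = -(kron b a : ℂ) := by
    exact_mod_cast he.orthonormal x hx b a
  have h2 : ∑ j, covOf h e κ j x * e x b j =
      -∑ a, (∑ i, ∑ j, (h x i j : ℂ) * e x b i * e x a j) * frameComp (κ x) a := by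
    simp only [covOf, Fin.sum_univ_three]
    ring
  rw [h2]
  simp only [h1, ofReal_kron]
  simp

/-- Every smooth symmetric spinor comes from a smooth covector, so the tensor description loses
nothing and applies to arbitrary solutions. -/
lemma isSpinorOf_covOf (hd : IsVacuumData R₀ h K) (he : IsCartesianFrame R₀ h e)
    (hs : ∀ A B, ContDiffOn ℝ ∞ (fun x => κ x A B) (endRegion R₀))
    (hsymm : ∀ x ∈ endRegion R₀, (κ x).IsSymm) : IsSpinorOf R₀ e (covOf h e κ) κ where
  smooth j := by
    have hc {f : E3 → ℝ} (hf : ContDiffOn ℝ ∞ f (endRegion R₀)) :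
        ContDiffOn ℝ ∞ (fun x => (f x : ℂ)) (endRegion R₀) :=
      Complex.ofRealCLM.contDiff.comp_contDiffOn hf
    have h00 := hs 0 0
    have h01 := hs 0 1
    have h10 := hs 1 0
    have h11 := hs 1 1
    have hf (a) : ContDiffOn ℝ ∞ (fun x => frameComp (κ x) a) (endRegion R₀) := by
      fin_cases a
      · exact contDiffOn_const.mul (h11.sub h00)
      · exact contDiffOn_const.mul (h00.add h11)
      · exact contDiffOn_const.mul (h01.add h10)
    exact (ContDiffOn.sum fun a _ => (ContDiffOn.sum fun l _ =>
      (hc (hd.smooth_h j l)).mul (hc (he.smooth a l))).mul (hf a)).neg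
  eq y hy C D := by
    have : ∑ j, covOf h e κ j y * solder e j C D y =
        ∑ a, (∑ j, covOf h e κ j y * e y a j) * sigma0 a C D := by
      simp only [solder, Fin.sum_univ_three]
      ring
    rw [this]
    simp only [covOf_mul_frame he hy]
    exact sum_frameComp (hsymm y hy) C D

end IrreducibleParts

/-! ## Leading-order approximations -/

section Approx

/-- `f` is a symbol of order `a` with leading part `g`, up to `o_∞(r^{a-1/2})`. -/
def Approx (a : ℝ) (f g : E3 → ℂ) : Prop :=
  IsSymbol a g ∧ IsLittleInf (a - 1 / 2) fun x => f x - g x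

variable {a b c : ℝ} {f f₀ g g₀ : E3 → ℂ}

lemma IsSymbol.mul' (hf : IsSymbol a f) (hg : IsSymbol b g) (hc : a + b = c) :
    IsSymbol c fun x => f x * g x := hc ▸ hf.mul hg

lemma IsSymbol.pd' (hf : IsSymbol a f) (i : Fin 3) (hc : a - 1 = b) :
    IsSymbol b (KillingSpinorEnd.pd i f) :=
  hc ▸ hf.pd i

lemma IsSymbol.eventually_differentiableAt (hf : IsSymbol a f) :
    ∀ᶠ R in atTop, ∀ x ∈ endRegion R, DifferentiableAt ℝ f x :=
  Filter.Eventually.mono hf fun _ hR _ hx => differentiableAt_of_smooth hR.1 hx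

/-- The remainder is an `o_∞` function and hence a symbol, by the weighted Sobolev embedding. -/
lemma Approx.isSymbol (h : Approx a f f₀) : IsSymbol a f :=
  ((h.2.isSymbol.mono (by linarith)).add h.1).congr (R := 0) fun x _ => by simp

lemma Approx.congr {R : ℝ} (hf : Approx a f f₀) (h : Set.EqOn f g (endRegion R))
    (h₀ : Set.EqOn f₀ g₀ (endRegion R)) : Approx a g g₀ :=
  ⟨hf.1.congr h₀, hf.2.congr (R := R) fun x hx => by simp [h hx, h₀ hx]⟩

lemma IsSymbol.approx_self (h : IsSymbol a f) : Approx a f f :=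
  ⟨h, by simpa using isLittleInf_zero (a - 1 / 2)⟩

lemma IsLittleInf.approx_zero (h : IsLittleInf (a - 1 / 2) f) : Approx a f fun _ => 0 :=
  ⟨isSymbol_zero a, by simpa using h⟩

lemma IsSymbol.approx_zero (h : IsSymbol b f) (hb : b < a - 1 / 2) : Approx a f fun _ => 0 :=
  (h.isLittleInf hb).approx_zero

lemma Approx.isLittleInf (h : Approx a f fun _ => 0) : IsLittleInf (a - 1 / 2) f := by
  simpa using h.2

lemma Approx.add (hf : Approx a f f₀) (hg : Approx a g g₀) :
    Approx a (fun x => f x + g x) fun x => f₀ x + g₀ x :=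
  ⟨hf.1.add hg.1, (hf.2.add hg.2).congr (R := 0) fun x _ => by ring⟩

lemma Approx.neg (hf : Approx a f f₀) : Approx a (fun x => -f x) fun x => -f₀ x :=
  ⟨hf.1.neg, hf.2.neg.congr (R := 0) fun x _ => by ring⟩

lemma Approx.sub (hf : Approx a f f₀) (hg : Approx a g g₀) :
    Approx a (fun x => f x - g x) fun x => f₀ x - g₀ x :=
  ⟨hf.1.sub hg.1, (hf.2.sub hg.2).congr (R := 0) fun x _ => by ring⟩

lemma Approx.sum {ι : Type*} {s : Finset ι} {f f₀ : ι → E3 → ℂ}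
    (hf : ∀ i ∈ s, Approx a (f i) (f₀ i)) :
    Approx a (fun x => ∑ i ∈ s, f i x) fun x => ∑ i ∈ s, f₀ i x :=
  ⟨IsSymbol.sum s fun i hi => (hf i hi).1, (IsLittleInf.sum s fun i hi => (hf i hi).2).congr
    (R := 0) fun x _ => by simp⟩

/-- Write `f g - f₀ g₀ = (f - f₀) g + (g - g₀) f₀`; each term is an `o_∞` remainder times a symbol.
-/
lemma Approx.mul (hf : Approx a f f₀) (hg : Approx b g g₀) (hc : a + b = c) :
    Approx c (fun x => f x * g x) fun x => f₀ x * g₀ x := by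
  subst hc
  refine ⟨hf.1.mul hg.1, (((hf.2.mul_isSymbol hg.isSymbol).mono (by linarith)).add
    ((hg.2.mul_isSymbol hf.1).mono (δ' := a + b - 1 / 2) (by linarith))).congr (R := 0)
    fun x _ => by ring⟩

lemma Approx.const_mul (z : ℂ) (hf : Approx a f f₀) :
    Approx a (fun x => z * f x) fun x => z * f₀ x :=
  (isSymbol_const z).approx_self.mul hf (zero_add a)

lemma Approx.pd (hf : Approx a f f₀) (i : Fin 3) (hb : a - 1 = b) :
    Approx b (pd i f) (KillingSpinorEnd.pd i f₀) := by
  subst hb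
  obtain ⟨R, h1, h2⟩ := (hf.isSymbol.eventually_differentiableAt.and
    hf.1.eventually_differentiableAt).exists
  refine ⟨hf.1.pd i, ((hf.2.pd i).mono (by linarith)).congr (R := R) fun x hx => ?_⟩
  exact pd_sub i (h1 x hx) (h2 x hx)

end Approx

/-! ## The leading parts of boosted data -/

section Explicit

lemma contDiff_coord (i : Fin 3) : ContDiff ℝ ∞ fun x : E3 => x i :=
  (EuclideanSpace.proj (𝕜 := ℝ) i : E3 →L[ℝ] ℝ).contDiff

lemma contDiffOn_norm_compl : ContDiffOn ℝ ∞ (fun x : E3 => ‖x‖) {0}ᶜ := fun _ hx =>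
  (contDiffAt_norm ℝ hx).contDiffWithinAt

lemma contDiffOn_nDot (p : Fin 3 → ℝ) : ContDiffOn ℝ ∞ (nDot p) {0}ᶜ :=
  (ContDiff.sum fun i _ => (contDiff_coord i).mul contDiff_const).contDiffOn.div
    contDiffOn_norm_compl fun _ hx => norm_ne_zero_iff.2 hx

lemma sqrt_massSq_add_pos {E : ℝ} {p : Fin 3 → ℝ} (hm : 0 < massSq E p) (t : ℝ) :
    0 < Real.sqrt (massSq E p + t ^ 2) := Real.sqrt_pos.2 (by positivity)

lemma contDiffOn_sqrt_massSq_add {E : ℝ} {p : Fin 3 → ℝ} (hm : 0 < massSq E p) :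
    ContDiffOn ℝ ∞ (fun x => Real.sqrt (massSq E p + nDot p x ^ 2)) {0}ᶜ :=
  (contDiffOn_const.add ((contDiffOn_nDot p).pow 2)).sqrt fun _ _ => by positivity

lemma contDiffOn_alphaBoost {E : ℝ} {p : Fin 3 → ℝ} (hm : 0 < massSq E p) :
    ContDiffOn ℝ ∞ (alphaBoost E p) {0}ᶜ :=
  ((contDiffOn_const.add (contDiffOn_const.mul ((contDiffOn_nDot p).pow 2))).div
    (contDiffOn_sqrt_massSq_add hm) fun _ _ => (sqrt_massSq_add_pos hm _).ne').sub contDiffOn_const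

lemma contDiffOn_betaBoost {E : ℝ} {p : Fin 3 → ℝ} (hm : 0 < massSq E p) :
    ContDiffOn ℝ ∞ (betaBoost E p) {0}ᶜ :=
  (((contDiffOn_nDot p).mul contDiffOn_const).mul
    (contDiffOn_const.add (contDiffOn_const.mul ((contDiffOn_nDot p).pow 2)))).div
    ((contDiffOn_sqrt_massSq_add hm).pow 3) fun _ _ => (pow_pos (sqrt_massSq_add_pos hm _) 3).ne'

lemma nDot_smul (p : Fin 3 → ℝ) {c : ℝ} (hc : 0 < c) (x : E3) : nDot p (c • x) = nDot p x := by
  simp only [nDot, norm_smul, Real.norm_of_nonneg hc.le, PiLp.smul_apply, smul_eq_mul, mul_assoc,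
    ← Finset.mul_sum]
  rw [mul_div_mul_left _ _ hc.ne']

lemma alphaBoost_smul (E : ℝ) (p : Fin 3 → ℝ) {c : ℝ} (hc : 0 < c) (x : E3) :
    alphaBoost E p (c • x) = alphaBoost E p x := by simp only [alphaBoost, nDot_smul p hc]

lemma betaBoost_smul (E : ℝ) (p : Fin 3 → ℝ) {c : ℝ} (hc : 0 < c) (x : E3) :
    betaBoost E p (c • x) = betaBoost E p x := by simp only [betaBoost, nDot_smul p hc]

/-- The `r^{-1}` part of the metric. -/
def metricTail (E : ℝ) (p : Fin 3 → ℝ) (i j : Fin 3) (x : E3) : ℝ :=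
  -(2 * E / ‖x‖) * kron i j - alphaBoost E p x / ‖x‖ * (2 * x i * x j / ‖x‖ ^ 2 - kron i j)

/-- The `r^{-2}` part of the extrinsic curvature. -/
def extrinsicTail (E : ℝ) (p : Fin 3 → ℝ) (i j : Fin 3) (x : E3) : ℝ :=
  betaBoost E p x / ‖x‖ ^ 2 * (2 * x i * x j / ‖x‖ ^ 2 - kron i j)

lemma isSymbol_ofReal_of_homogeneous {f : E3 → ℝ} {a : ℝ} (hf : ContDiffOn ℝ ∞ f {0}ᶜ)
    (hh : ∀ c : ℝ, 0 < c → ∀ x ≠ 0, f (c • x) = c ^ a * f x) : IsSymbol a fun x => (f x : ℂ) :=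
  (isSymbol_of_homogeneous hf hh).clm_comp Complex.ofRealCLM

lemma isSymbol_metricTail {E : ℝ} {p : Fin 3 → ℝ} (hm : 0 < massSq E p) (i j : Fin 3) :
    IsSymbol (-1) fun x => (metricTail E p i j x : ℂ) := by
  have hn := contDiffOn_norm_compl
  have h0 : ∀ x ∈ ({0}ᶜ : Set E3), ‖x‖ ≠ 0 := fun x hx => norm_ne_zero_iff.2 hx
  refine isSymbol_ofReal_of_homogeneous ?_ fun c hc x hx => ?_
  · exact ((contDiffOn_const.div hn h0).neg.mul contDiffOn_const).sub
      (((contDiffOn_alphaBoost hm).div hn h0).mul ((((contDiffOn_const.mul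
      (contDiff_coord i).contDiffOn).mul (contDiff_coord j).contDiffOn).div (hn.pow 2)
      fun x hx => pow_ne_zero 2 (h0 x hx)).sub contDiffOn_const))
  · have := norm_ne_zero_iff.2 hx
    simp only [metricTail, alphaBoost_smul E p hc, norm_smul, Real.norm_of_nonneg hc.le,
      PiLp.smul_apply, smul_eq_mul, Real.rpow_neg_one]
    field_simp

lemma isSymbol_extrinsicTail {E : ℝ} {p : Fin 3 → ℝ} (hm : 0 < massSq E p) (i j : Fin 3) :
    IsSymbol (-2) fun x => (extrinsicTail E p i j x : ℂ) := by
  have hn := contDiffOn_norm_compl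
  have h0 : ∀ x ∈ ({0}ᶜ : Set E3), ‖x‖ ≠ 0 := fun x hx => norm_ne_zero_iff.2 hx
  have h2 : ∀ x ∈ ({0}ᶜ : Set E3), ‖x‖ ^ 2 ≠ 0 := fun x hx => pow_ne_zero 2 (h0 x hx)
  refine isSymbol_ofReal_of_homogeneous ?_ fun c hc x hx => ?_
  · exact ((contDiffOn_betaBoost hm).div (hn.pow 2) h2).mul ((((contDiffOn_const.mul
      (contDiff_coord i).contDiffOn).mul (contDiff_coord j).contDiffOn).div (hn.pow 2) h2).sub
      contDiffOn_const)
  · have := norm_ne_zero_iff.2 hx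
    have hc2 : c ^ (-2 : ℝ) = (c ^ 2)⁻¹ := by rw [Real.rpow_neg hc.le]; norm_cast
    simp only [extrinsicTail, betaBoost_smul E p hc, norm_smul, Real.norm_of_nonneg hc.le,
      PiLp.smul_apply, smul_eq_mul, hc2]
    field_simp

lemma isSymbol_coord (i : Fin 3) : IsSymbol 1 fun x : E3 => ((x i : ℝ) : ℂ) :=
  isSymbol_ofReal_of_homogeneous (contDiff_coord i).contDiffOn fun c _ x _ => by simp

lemma isSymbol_inv_norm : IsSymbol (-1) fun x : E3 => ((‖x‖⁻¹ : ℝ) : ℂ) :=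
  isSymbol_ofReal_of_homogeneous
    (contDiffOn_norm_compl.inv fun x hx => norm_ne_zero_iff.2 hx) fun c hc x _ => by
      rw [norm_smul, Real.norm_of_nonneg hc.le, mul_inv, Real.rpow_neg_one]

lemma isSymbol_alphaBoost {E : ℝ} {p : Fin 3 → ℝ} (hm : 0 < massSq E p) :
    IsSymbol 0 fun x => (alphaBoost E p x : ℂ) :=
  isSymbol_ofReal_of_homogeneous (contDiffOn_alphaBoost hm) fun c hc x _ => by
    rw [alphaBoost_smul E p hc, Real.rpow_zero, one_mul]

lemma differentiableAt_of_contDiffOn_compl {f : E3 → ℝ} (hf : ContDiffOn ℝ ∞ f {0}ᶜ) {x : E3}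
    (hx : x ≠ 0) : DifferentiableAt ℝ f x :=
  (hf.contDiffAt (isOpen_compl_singleton.mem_nhds hx)).differentiableAt (by simp)

lemma pd_coord (i j : Fin 3) (x : E3) : pd i (fun y : E3 => y j) x = kron i j := by
  have := (EuclideanSpace.proj (𝕜 := ℝ) j : E3 →L[ℝ] ℝ).hasFDerivAt (x := x)
  rw [pd, show (fun y : E3 => y j) = (EuclideanSpace.proj (𝕜 := ℝ) j : E3 →L[ℝ] ℝ) from rfl,
    this.fderiv]
  simp [kron, eq_comm]

lemma norm_sq_eq_sum (x : E3) : ‖x‖ ^ 2 = x 0 * x 0 + x 1 * x 1 + x 2 * x 2 := by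
  rw [EuclideanSpace.real_norm_sq_eq, Fin.sum_univ_three]; ring

lemma pd_inv_norm {x : E3} (hx : x ≠ 0) (i : Fin 3) :
    pd i (fun y : E3 => ‖y‖⁻¹) x = -x i * ‖x‖⁻¹ ^ 3 := by
  have h0 := norm_ne_zero_iff.2 hx
  have h1 : HasFDerivAt (fun y : E3 => ‖y‖ ^ 2) _ x := (hasStrictFDerivAt_norm_sq x).hasFDerivAt
  have hd : DifferentiableAt ℝ (fun y : E3 => ‖y‖) x :=
    differentiableAt_of_contDiffOn_compl contDiffOn_norm_compl hx
  have h2 : pd i (fun y : E3 => ‖y‖ * ‖y‖) x = 2 * x i := by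
    have : (fun y : E3 => ‖y‖ * ‖y‖) = fun y => ‖y‖ ^ 2 := by ext; ring
    rw [this, pd, h1.fderiv]
    simp [innerSL_apply_apply, EuclideanSpace.inner_single_right]
  rw [pd_mul i hd hd] at h2
  have h3 : pd i (fun y : E3 => ‖y‖ * ‖y‖⁻¹) x = 0 := by
    rw [pd_congr (g := fun _ => (1 : ℝ)) i, pd_const]
    filter_upwards [isOpen_compl_singleton.mem_nhds hx] with y hy
    exact mul_inv_cancel₀ (norm_ne_zero_iff.2 hy)
  rw [pd_mul i hd (hd.fun_inv h0)] at h3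
  have h4 : pd i (fun y : E3 => ‖y‖) x = x i * ‖x‖⁻¹ := by
    field_simp; linarith
  rw [h4] at h3
  field_simp at h3 ⊢
  linarith

lemma pd_nDot {x : E3} (hx : x ≠ 0) (p : Fin 3 → ℝ) (i : Fin 3) :
    pd i (nDot p) x = (p i - nDot p x * x i * ‖x‖⁻¹) * ‖x‖⁻¹ := by
  have hd : DifferentiableAt ℝ (fun y : E3 => ‖y‖⁻¹) x := differentiableAt_of_contDiffOn_compl
    (contDiffOn_norm_compl.inv fun x hx => norm_ne_zero_iff.2 hx) hx
  have hc (j : Fin 3) : DifferentiableAt ℝ (fun y : E3 => y j) x :=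
    (contDiff_coord j).differentiable (by simp) x
  have h1 : nDot p = fun y : E3 => (∑ j, y j * p j) * ‖y‖⁻¹ := by ext; rw [nDot, div_eq_mul_inv]
  have h2 (j) : pd i (fun y : E3 => y j * p j) x = kron i j * p j := by
    rw [pd_mul i (hc j) (differentiableAt_const _), pd_coord, pd_const, mul_zero, add_zero]
  have hj (j) : DifferentiableAt ℝ (fun y : E3 => y j * p j) x :=
    (hc j).mul (differentiableAt_const _)
  rw [h1, pd_mul i (DifferentiableAt.fun_sum fun j _ => hj j) hd, pd_sum i fun j _ => hj j,
    pd_inv_norm hx]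
  simp only [h2, kron, ite_mul, one_mul, zero_mul, Finset.sum_ite_eq, Finset.mem_univ, if_true]
  ring

/-- The derivative of `α` with respect to `n·p`. -/
def alphaSlope (E : ℝ) (p : Fin 3 → ℝ) (x : E3) : ℝ :=
  2 * nDot p x * (3 * massSq E p + 2 * nDot p x ^ 2) / Real.sqrt (massSq E p + nDot p x ^ 2) ^ 3

/-- The one relation between metric and extrinsic curvature on which the construction rests: `E α' =
2β`. -/
lemma mul_alphaSlope (E : ℝ) (p : Fin 3 → ℝ) (x : E3) :
    E * alphaSlope E p x = 2 * betaBoost E p x := by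
  rw [alphaSlope, betaBoost]; ring

lemma pd_alphaBoost {E : ℝ} {p : Fin 3 → ℝ} (hm : 0 < massSq E p) {x : E3} (hx : x ≠ 0)
    (i : Fin 3) : pd i (alphaBoost E p) x =
      alphaSlope E p x * ((p i - nDot p x * x i * ‖x‖⁻¹) * ‖x‖⁻¹) := by
  set M := massSq E p
  have hpos (t : ℝ) : 0 < M + t ^ 2 := by positivity
  have hF (t : ℝ) : HasDerivAt (fun t => (2 * M + 4 * t ^ 2) / Real.sqrt (M + t ^ 2) - 2 * E)
      (2 * t * (3 * M + 2 * t ^ 2) / Real.sqrt (M + t ^ 2) ^ 3) t := by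
    have h1 : HasDerivAt (fun t : ℝ => t ^ 2) (2 * t) t := by simpa using hasDerivAt_pow 2 t
    have hs := Real.sq_sqrt (hpos t).le
    have hs0 := (Real.sqrt_pos.2 (hpos t)).ne'
    refine ((((h1.const_mul 4).const_add (2 * M)).div
      ((h1.const_add M).sqrt (hpos t).ne') hs0).sub_const (2 * E)).congr_deriv ?_
    field_simp
    rw [hs]
    ring
  have hd := (differentiableAt_of_contDiffOn_compl (contDiffOn_nDot p) hx).hasFDerivAt
  have := ((hF (nDot p x)).comp_hasFDerivAt x hd).fderiv
  have h2 : alphaBoost E p = (fun t => (2 * M + 4 * t ^ 2) / Real.sqrt (M + t ^ 2) - 2 * E) ∘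
    nDot p := rfl
  rw [← pd_nDot hx, pd, h2, this, alphaSlope]
  rfl

end Explicit

/-! ## The order `r^{-1}` identity -/

section LeadingIdentity

variable {E : ℝ} {p : Fin 3 → ℝ} {x : E3}

/-- The rotation field `p × x`. -/
def rotation (p : Fin 3 → ℝ) (l : Fin 3) (x : E3) : ℝ := crossProduct p (fun i => x i) l

/-- The radial field `α n`. -/
def radial (E : ℝ) (p : Fin 3 → ℝ) (l : Fin 3) (x : E3) : ℝ := alphaBoost E p x * (x l * ‖x‖⁻¹)

lemma fin_three_cases (i : Fin 3) : i = 0 ∨ i = 1 ∨ i = 2 := by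
  fin_cases i <;> simp

lemma kron_comm (i j : Fin 3) : kron i j = kron j i := by simp only [kron, eq_comm]

lemma sum_mul_kron (f : Fin 3 → ℝ) (i : Fin 3) : ∑ l, f l * kron l i = f i := by simp [kron]

lemma metricTail_eq (i j : Fin 3) : metricTail E p i j = fun y => -(2 * E * ‖y‖⁻¹ * kron i j) -
    alphaBoost E p y * ‖y‖⁻¹ * (2 * (y i * y j) * (‖y‖⁻¹ * ‖y‖⁻¹) - kron i j) := by
  ext y
  rw [metricTail]
  ring

lemma differentiableAt_coord (i : Fin 3) : DifferentiableAt ℝ (fun y : E3 => y i) x :=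
  (contDiff_coord i).differentiable (by simp) x

lemma differentiableAt_inv_norm (hx : x ≠ 0) : DifferentiableAt ℝ (fun y : E3 => ‖y‖⁻¹) x :=
  differentiableAt_of_contDiffOn_compl
    (contDiffOn_norm_compl.inv fun _ hx => norm_ne_zero_iff.2 hx) hx

lemma pd_metricTail (hm : 0 < massSq E p) (hx : x ≠ 0) (l i j : Fin 3) :
    pd l (metricTail E p i j) x = 2 * E * x l * ‖x‖⁻¹ ^ 3 * kron i j -
      (alphaSlope E p x * ((p l - nDot p x * x l * ‖x‖⁻¹) * ‖x‖⁻¹) * ‖x‖⁻¹ -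
        alphaBoost E p x * x l * ‖x‖⁻¹ ^ 3) * (2 * x i * x j * ‖x‖⁻¹ ^ 2 - kron i j) -
      alphaBoost E p x * ‖x‖⁻¹ * (2 * (kron l i * x j + x i * kron l j) * ‖x‖⁻¹ ^ 2 -
        4 * x i * x j * x l * ‖x‖⁻¹ ^ 4) := by
  have hu := differentiableAt_inv_norm hx
  have hc (i) : DifferentiableAt ℝ (fun y : E3 => y i) x := differentiableAt_coord i
  have ha : DifferentiableAt ℝ (alphaBoost E p) x :=
    differentiableAt_of_contDiffOn_compl (contDiffOn_alphaBoost hm) hx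
  have hk (z : ℝ) : DifferentiableAt ℝ (fun _ : E3 => z) x := differentiableAt_const z
  have hu2 := hu.fun_mul hu
  have hxx := (hc i).fun_mul (hc j)
  have hau := ha.fun_mul hu
  have h2 := ((hk 2).fun_mul hxx).fun_mul hu2
  have h1 := ((hk (2 * E)).fun_mul hu).fun_mul (hk (kron i j))
  have h3 := hau.fun_mul (h2.fun_sub (hk (kron i j)))
  have hneg : pd l (fun y : E3 => -(2 * E * ‖y‖⁻¹ * kron i j)) x =
      -pd l (fun y : E3 => 2 * E * ‖y‖⁻¹ * kron i j) x := by simp [pd]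
  rw [metricTail_eq, pd_sub l h1.fun_neg h3, hneg, pd_mul l ((hk (2 * E)).fun_mul hu) (hk _),
    pd_mul l (hk (2 * E)) hu, pd_mul l hau (h2.fun_sub (hk _)), pd_mul l ha hu, pd_sub l h2 (hk _),
    pd_mul l ((hk 2).fun_mul hxx) hu2, pd_mul l (hk 2) hxx, pd_mul l (hc i) (hc j),
    pd_mul l hu hu, pd_coord, pd_coord, pd_inv_norm hx, pd_alphaBoost hm hx]
  simp only [pd_const]
  ring

lemma norm_inv_sq_mul (hx : x ≠ 0) :
    ‖x‖⁻¹ ^ 2 * (x 0 * x 0 + x 1 * x 1 + x 2 * x 2) = 1 := by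
  rw [← norm_sq_eq_sum, inv_pow, inv_mul_cancel₀ (pow_ne_zero 2 (norm_ne_zero_iff.2 hx))]

lemma nDot_eq (p : Fin 3 → ℝ) (x : E3) :
    (x 0 * p 0 + x 1 * p 1 + x 2 * p 2) * ‖x‖⁻¹ = nDot p x := by
  rw [nDot, Fin.sum_univ_three, div_eq_mul_inv]

/-- Euler's identity for homogeneity of degree `-1`, here checked from the explicit derivatives. -/
lemma euler_metricTail (hm : 0 < massSq E p) (hx : x ≠ 0) (i j : Fin 3) :
    ∑ l, x l * pd l (metricTail E p i j) x = -metricTail E p i j x := by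
  have hu := norm_inv_sq_mul hx
  have ht := nDot_eq p x
  have hi := sum_mul_kron (fun l => x l) i
  have hj := sum_mul_kron (fun l => x l) j
  simp only [pd_metricTail hm hx]
  simp only [metricTail_eq]
  simp only [Fin.sum_univ_three] at hi hj ⊢
  set u := ‖x‖⁻¹
  set d := kron i j
  set a := alphaBoost E p x
  linear_combination (2 * E * d * u + a * u * (2 * x i * x j * u ^ 2 - d) + 4 * a * u ^ 3 * x i * x j
    + alphaSlope E p x * nDot p x * u * (2 * x i * x j * u ^ 2 - d)) * hu
    - alphaSlope E p x * u * (2 * x i * x j * u ^ 2 - d) * ht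
    - 2 * a * u ^ 3 * x j * hi - 2 * a * u ^ 3 * x i * hj

lemma pd_rotation (i l : Fin 3) : pd i (rotation p l) x = crossProduct p (Pi.single i 1) l := by
  have hc (a b) : DifferentiableAt ℝ (fun y : E3 => p a * y b) x :=
    (differentiableAt_const _).mul (differentiableAt_coord b)
  have h (a b) : pd i (fun y : E3 => p a * y b) x = p a * kron i b := by
    rw [pd_mul i (differentiableAt_const _) (differentiableAt_coord b), pd_const, pd_coord,
      zero_mul, zero_add]
  have hr : rotation p l = fun y => ![p 1 * y 2 - p 2 * y 1, p 2 * y 0 - p 0 * y 2,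
    p 0 * y 1 - p 1 * y 0] l := by ext y; simp [rotation, cross_apply]
  rw [hr]
  rcases fin_three_cases l with rfl | rfl | rfl
  · exact (pd_sub i (hc 1 2) (hc 2 1)).trans (by
      rw [h, h]; simp [cross_apply, kron, Pi.single_apply, eq_comm])
  · exact (pd_sub i (hc 2 0) (hc 0 2)).trans (by
      rw [h, h]; simp [cross_apply, kron, Pi.single_apply, eq_comm])
  · exact (pd_sub i (hc 0 1) (hc 1 0)).trans (by
      rw [h, h]; simp [cross_apply, kron, Pi.single_apply, eq_comm])

/-- The tail is built from `‖x‖`, `n·p`, `x_i x_j` and `δ`, all invariant under rotations about `p`.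
-/
lemma lie_rotation_metricTail (hm : 0 < massSq E p) (hx : x ≠ 0) (i j : Fin 3) :
    ∑ l, (rotation p l x * pd l (metricTail E p i j) x +
      metricTail E p l j x * pd i (rotation p l) x +
      metricTail E p i l x * pd j (rotation p l) x) = 0 := by
  simp only [pd_metricTail hm hx, pd_rotation]
  simp only [metricTail_eq, rotation]
  rcases fin_three_cases i with rfl | rfl | rfl <;> rcases fin_three_cases j with rfl | rfl | rfl <;>
  simp [Fin.sum_univ_three, kron, cross_apply] <;> ring

lemma pd_radial (hm : 0 < massSq E p) (hx : x ≠ 0) (i j : Fin 3) :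
    pd i (radial E p j) x = alphaSlope E p x * ((p i - nDot p x * x i * ‖x‖⁻¹) * ‖x‖⁻¹) *
      (x j * ‖x‖⁻¹) + alphaBoost E p x * (kron i j * ‖x‖⁻¹ - x i * x j * ‖x‖⁻¹ ^ 3) := by
  have hu := differentiableAt_inv_norm hx
  have hc : DifferentiableAt ℝ (fun y : E3 => y j) x := differentiableAt_coord j
  have ha : DifferentiableAt ℝ (alphaBoost E p) x :=
    differentiableAt_of_contDiffOn_compl (contDiffOn_alphaBoost hm) hx
  have : radial E p j = fun y => alphaBoost E p y * (y j * ‖y‖⁻¹) := rfl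
  rw [this, pd_mul i ha (hc.fun_mul hu), pd_mul i hc hu, pd_alphaBoost hm hx, pd_coord,
    pd_inv_norm hx]
  ring

/-- The part of row `a` parallel to `x` has no cross product with `x`, and the part along the basis
vector gives a tensor antisymmetric in `a, b`. Hence the dilation does not see `K` at leading order.
-/
lemma cross_extrinsicTail_coord (a b : Fin 3) :
    crossProduct (fun c => extrinsicTail E p a c x) (fun i => x i) b +
      crossProduct (fun c => extrinsicTail E p b c x) (fun i => x i) a = 0 := by
  simp only [extrinsicTail]
  rcases fin_three_cases a with rfl | rfl | rfl <;> rcases fin_three_cases b with rfl | rfl | rfl <;>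
  simp [kron, cross_apply] <;> ring

/-- From `n × (p × n) = p - (n·p) n`; the remaining double cross product is antisymmetric in `a, b`.
The result is the tensor that also multiplies `α'` in the symmetrised gradient of `α n`. -/
lemma cross_extrinsicTail_rotation (hx : x ≠ 0) (a b : Fin 3) :
    crossProduct (fun c => extrinsicTail E p a c x) (fun i => rotation p i x) b +
      crossProduct (fun c => extrinsicTail E p b c x) (fun i => rotation p i x) a =
      2 * betaBoost E p x * ‖x‖⁻¹ ^ 2 *
        (x a * p b + x b * p a - 2 * nDot p x * x a * x b * ‖x‖⁻¹) := by
  have hu := norm_inv_sq_mul hx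
  have ht := nDot_eq p x
  have hK (a c) : extrinsicTail E p a c x = betaBoost E p x * ‖x‖⁻¹ ^ 2 *
      (2 * x a * x c * ‖x‖⁻¹ ^ 2 - kron a c) := by rw [extrinsicTail]; ring
  simp only [hK, rotation]
  set u := ‖x‖⁻¹
  set β := betaBoost E p x
  have hgoal : 2 * β * u ^ 4 * ((x 0 * x 0 + x 1 * x 1 + x 2 * x 2) * (x a * p b + x b * p a) -
      2 * x a * x b * (x 0 * p 0 + x 1 * p 1 + x 2 * p 2)) =
      2 * β * u ^ 2 * (x a * p b + x b * p a - 2 * nDot p x * x a * x b * u) := by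
    linear_combination 2 * β * u ^ 2 * (x a * p b + x b * p a) * hu -
      4 * β * u ^ 3 * x a * x b * ht
  rw [← hgoal]
  rcases fin_three_cases a with rfl | rfl | rfl <;> rcases fin_three_cases b with rfl | rfl | rfl <;>
  simp [kron, cross_apply] <;> ring

/-- The cancellation at order `r⁻¹`. On the left the terms with `α` undifferentiated cancel against
the tail and the trace correction, leaving `E α'` times the tensor that appears on the right with
factor `2β`. -/
lemma leading_real (hm : 0 < massSq E p) (hx : x ≠ 0) (a b : Fin 3) :
    E * (-metricTail E p a b x + (pd a (radial E p b) x + pd b (radial E p a) x) -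
      (2 * E + alphaBoost E p x) * ‖x‖⁻¹ * kron a b) =
    crossProduct (fun c => extrinsicTail E p a c x) (fun i => rotation p i x) b +
      crossProduct (fun c => extrinsicTail E p b c x) (fun i => rotation p i x) a := by
  have hA := mul_alphaSlope E p x
  rw [cross_extrinsicTail_rotation hx, pd_radial hm hx, pd_radial hm hx, kron_comm b a,
    metricTail_eq]
  set u := ‖x‖⁻¹
  linear_combination u ^ 2 * (x a * p b + x b * p a - 2 * nDot p x * x a * x b * u) * hA

end LeadingIdentity

/-! ## Asymptotics of the geometric fields -/

section Fields

variable {R₀ : ℝ} {h K e : E3 → Matrix (Fin 3) (Fin 3) ℝ} {E : ℝ} {p : Fin 3 → ℝ}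

lemma IsLittleInf.ofReal {f : E3 → ℝ} {δ : ℝ} (hf : IsLittleInf δ f) :
    IsLittleInf δ fun x => (f x : ℂ) := hf.clm_comp Complex.ofRealCLM

lemma approx_extrinsic (hb : BoostedDecay h K E p) (hm : 0 < massSq E p) (i j : Fin 3) :
    Approx (-2) (fun x => (K x i j : ℂ)) fun x => (extrinsicTail E p i j x : ℂ) := by
  refine ⟨isSymbol_extrinsicTail hm i j, ?_⟩
  have := (hb.extrinsic i j).ofReal
  rw [show (-2 : ℝ) - 1 / 2 = -5 / 2 by norm_num]
  exact this.congr (R := 0) fun x _ => Complex.ofReal_sub _ _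

lemma approx_metric_tail (hb : BoostedDecay h K E p) (hm : 0 < massSq E p) (i j : Fin 3) :
    Approx (-1) (fun x => (h x i j : ℂ) + kron i j) fun x => (metricTail E p i j x : ℂ) := by
  refine ⟨isSymbol_metricTail hm i j, ?_⟩
  have := (hb.metric i j).ofReal
  rw [show (-1 : ℝ) - 1 / 2 = -3 / 2 by norm_num]
  refine this.congr (R := 0) fun x _ => ?_
  simp only [metricTail]
  push_cast
  ring

lemma approx_metric (hb : BoostedDecay h K E p) (hm : 0 < massSq E p) (i j : Fin 3) :
    Approx 0 (fun x => (h x i j : ℂ)) fun _ => -(kron i j : ℂ) :=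
  ⟨isSymbol_const _, ((approx_metric_tail hb hm i j).isSymbol.isLittleInf (by norm_num)).congr
    (R := 0) fun x _ => by simp⟩

lemma approx_frame (he : IsCartesianFrame R₀ h e) (a i : Fin 3) :
    Approx 0 (fun x => (e x a i : ℂ)) fun _ => (kron a i : ℂ) := by
  refine ⟨isSymbol_const _, ?_⟩
  rw [show (0 : ℝ) - 1 / 2 = -1 / 2 by norm_num]
  exact (he.asymptotic a i).ofReal.congr (R := 0) fun x _ => Complex.ofReal_sub _ _

lemma pd_add_const (f : E3 → ℂ) (c : ℂ) (i : Fin 3) : pd i (fun x => f x + c) = pd i f := by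
  ext x
  simp [pd]

lemma isSymbol_pd_metric (hd : IsVacuumData R₀ h K) (hb : BoostedDecay h K E p)
    (hm : 0 < massSq E p) (l i j : Fin 3) :
    IsSymbol (-2) fun x => ((pd l (fun y => h y i j) x : ℝ) : ℂ) := by
  have h1 := (approx_metric_tail hb hm i j).isSymbol.pd' (b := -2) l (by norm_num)
  rw [pd_add_const] at h1
  exact h1.congr (R := R₀) fun x hx => pd_ofReal l (differentiableAt_of_smooth (hd.smooth_h i j) hx)

/-- Derivatives of `h` have order `-2` because `h + δ` has order `-1`, and the inverse metric has
order `0`. -/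
lemma isSymbol_christoffel (hd : IsVacuumData R₀ h K) (he : IsCartesianFrame R₀ h e)
    (hb : BoostedDecay h K E p) (hm : 0 < massSq E p) (k i j : Fin 3) :
    IsSymbol (-2) fun x => (christoffel h k i j x : ℂ) := by
  have h1 (k l) : IsSymbol 0 fun x => -∑ a, (e x a k : ℂ) * e x a l :=
    (IsSymbol.sum _ fun a _ => (approx_frame he a k).isSymbol.mul' (approx_frame he a l).isSymbol
      (add_zero 0)).neg
  have hp := isSymbol_pd_metric hd hb hm
  refine ((isSymbol_const (1 / 2 : ℂ)).mul' (c := -2) (IsSymbol.sum Finset.univ fun l _ =>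
    (h1 k l).mul' (((hp i l j).add (hp j l i)).sub (hp l i j)) (zero_add (-2))) (by norm_num)).congr
    (R := R₀) fun x hx => ?_
  simp only [christoffel, inv_metric he hx, Matrix.neg_apply, Matrix.mul_apply,
    Matrix.transpose_apply]
  push_cast
  rfl

lemma approx_frameK (he : IsCartesianFrame R₀ h e) (hb : BoostedDecay h K E p)
    (hm : 0 < massSq E p) (a b : Fin 3) : Approx (-2) (frameK K e a b)
      fun x => (extrinsicTail E p a b x : ℂ) := by
  refine (Approx.sum fun i _ => Approx.sum fun j _ => ((approx_frame he a i).mul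
    (approx_frame he b j) (add_zero 0)).mul (approx_extrinsic hb hm i j) (zero_add (-2))).congr
    (R := 0) (fun x _ => rfl) fun x _ => ?_
  simp [ofReal_kron]

lemma cross_add_mul (u f g : Fin 3 → ℂ) (z w : ℂ) (b : Fin 3) :
    crossProduct u (fun i => z * f i + w * g i) b =
      z * crossProduct u f b + w * crossProduct u g b := by
  rcases fin_three_cases b with rfl | rfl | rfl <;> simp [cross_apply] <;> ring

lemma ofReal_cross (u f : Fin 3 → ℝ) (b : Fin 3) :
    crossProduct (fun i => (u i : ℂ)) (fun i => (f i : ℂ)) b = ((crossProduct u f b : ℝ) : ℂ) := by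
  rcases fin_three_cases b with rfl | rfl | rfl <;> simp [cross_apply]

lemma Approx.cross {a b c : ℝ} {u u₀ f f₀ : Fin 3 → E3 → ℂ} (hu : ∀ i, Approx a (u i) (u₀ i))
    (hf : ∀ i, Approx b (f i) (f₀ i)) (hc : a + b = c) (d : Fin 3) :
    Approx c (fun x => crossProduct (fun i => u i x) (fun i => f i x) d)
      fun x => crossProduct (fun i => u₀ i x) (fun i => f₀ i x) d := by
  rcases fin_three_cases d with rfl | rfl | rfl <;> simp only [cross_apply]
  · exact ((hu 1).mul (hf 2) hc).sub ((hu 2).mul (hf 1) hc)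
  · exact ((hu 2).mul (hf 0) hc).sub ((hu 0).mul (hf 2) hc)
  · exact ((hu 0).mul (hf 1) hc).sub ((hu 1).mul (hf 0) hc)

/-- The components of the Lie derivative of `H` along `v`. -/
def lieMetric (v : Fin 3 → E3 → ℂ) (H : Fin 3 → Fin 3 → E3 → ℂ) (i j : Fin 3) (x : E3) : ℂ :=
  ∑ l, (v l x * pd l (H i j) x + H l j x * pd i (v l) x + H i l x * pd j (v l) x)

/-- The symmetrised covariant gradient of the lowered field is the Lie derivative of the metric, in
which the Christoffel symbols have disappeared. -/
lemma covGrad_add_swap (hd : IsVacuumData R₀ h K) {x : E3} (hx : x ∈ endRegion R₀)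
    {v : Fin 3 → E3 → ℂ} (hv : ∀ i, DifferentiableAt ℝ (v i) x) (i j : Fin 3) :
    covGrad h (fun j y => ∑ l, (h y l j : ℂ) * v l y) i j x +
      covGrad h (fun j y => ∑ l, (h y l j : ℂ) * v l y) j i x =
      lieMetric v (fun i j y => (h y i j : ℂ)) i j x := by
  have hh (a b) : DifferentiableAt ℝ (fun y => h y a b) x :=
    differentiableAt_of_smooth (hd.smooth_h a b) hx
  have hhc (a b) : DifferentiableAt ℝ (fun y => (h y a b : ℂ)) x := differentiableAt_ofReal (hh a b)
  have hpd (i j) : pd i (fun y => ∑ l, (h y l j : ℂ) * v l y) x =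
      ∑ l, (((pd i (fun y => h y l j) x : ℝ) : ℂ) * v l x + h x l j * pd i (v l) x) := by
    rw [pd_sum i fun l _ => (hhc l j).fun_mul (hv l)]
    exact Finset.sum_congr rfl fun l _ => by rw [pd_mul i (hhc l j) (hv l), pd_ofReal i (hh l j)]
  have hchr (i j) : ∑ l, (christoffel h l i j x : ℂ) * ∑ m, (h x m l : ℂ) * v m x =
      ∑ m, v m x * ((1 / 2) * (((pd i (fun y => h y m j) x : ℝ) : ℂ) +
        ((pd j (fun y => h y m i) x : ℝ) : ℂ) - ((pd m (fun y => h y i j) x : ℝ) : ℂ))) := by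
    have hc (m) : ∑ l, (h x m l : ℂ) * christoffel h l i j x = (1 / 2) *
        (((pd i (fun y => h y m j) x : ℝ) : ℂ) + ((pd j (fun y => h y m i) x : ℝ) : ℂ) -
          ((pd m (fun y => h y i j) x : ℝ) : ℂ)) := by
      have := congrArg (fun r : ℝ => (r : ℂ)) (metric_mul_christoffel hd hx m i j)
      push_cast at this
      exact this
    simp only [← hc, Finset.mul_sum]
    rw [Finset.sum_comm]
    exact Finset.sum_congr rfl fun _ _ => Finset.sum_congr rfl fun _ _ => by ring
  have hs := hd.symm_h hx
  have hps := hd.pd_symm_h hx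
  simp only [covGrad, lieMetric, hpd, hchr, pd_ofReal _ (hh _ _)]
  simp only [hs i, fun m => hps m j i]
  rw [← sub_eq_zero]
  simp only [Fin.sum_univ_three]
  ring

end Fields

/-! ## Existence -/

section Existence

variable {R₀ : ℝ} {h K e : E3 → Matrix (Fin 3) (Fin 3) ℝ} {E : ℝ} {p : Fin 3 → ℝ} {c : ℝ}

/-- The linear part of the approximate Killing field: a dilation plus a rotation about `p`. -/
def linearField (c E : ℝ) (p : Fin 3 → ℝ) (l : Fin 3) (x : E3) : ℂ :=
  (c * E : ℂ) * (x l : ℝ) + (-(Complex.I * Real.sqrt 2 * c)) * (rotation p l x : ℝ)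

/-- The approximate conformal Killing field. -/
def killingField (c E : ℝ) (p : Fin 3 → ℝ) (l : Fin 3) (x : E3) : ℂ :=
  linearField c E p l x - (c * E : ℂ) * (radial E p l x : ℝ)

lemma ne_zero_of_mem_endRegion (hR₀ : 0 ≤ R₀) {x : E3} (hx : x ∈ endRegion R₀) : x ≠ 0 := by
  rintro rfl
  have : R₀ < ‖(0 : E3)‖ := hx
  rw [norm_zero] at this
  linarith

lemma contDiff_rotation (p : Fin 3 → ℝ) (l : Fin 3) : ContDiff ℝ ∞ (rotation p l) := by
  have hc (a b) : ContDiff ℝ ∞ fun y : E3 => p a * y b := contDiff_const.mul (contDiff_coord b)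
  unfold rotation
  rcases fin_three_cases l with rfl | rfl | rfl <;> simp only [cross_apply]
  · exact (hc 1 2).sub (hc 2 1)
  · exact (hc 2 0).sub (hc 0 2)
  · exact (hc 0 1).sub (hc 1 0)

lemma contDiffOn_radial (hm : 0 < massSq E p) (l : Fin 3) : ContDiffOn ℝ ∞ (radial E p l) {0}ᶜ :=
  (contDiffOn_alphaBoost hm).mul ((contDiff_coord l).contDiffOn.mul
    (contDiffOn_norm_compl.inv fun _ hx => norm_ne_zero_iff.2 hx))

lemma contDiff_linearField (l : Fin 3) : ContDiff ℝ ∞ (linearField c E p l) :=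
  (contDiff_const.mul (Complex.ofRealCLM.contDiff.comp (contDiff_coord l))).add
    (contDiff_const.mul (Complex.ofRealCLM.contDiff.comp (contDiff_rotation p l)))

lemma contDiffOn_killingField (hm : 0 < massSq E p) (l : Fin 3) :
    ContDiffOn ℝ ∞ (killingField c E p l) {0}ᶜ :=
  (contDiff_linearField l).contDiffOn.sub
    (contDiffOn_const.mul (Complex.ofRealCLM.contDiff.comp_contDiffOn (contDiffOn_radial hm l)))

lemma isSymbol_linearField (l : Fin 3) : IsSymbol 1 (linearField c E p l) := by
  have hr : IsSymbol 1 fun x => ((rotation p l x : ℝ) : ℂ) := by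
    refine isSymbol_ofReal_of_homogeneous (contDiff_rotation p l).contDiffOn fun c _ x _ => ?_
    have : (fun i => (c • x) i) = c • fun i => x i := by ext i; simp
    rw [rotation, rotation, this]
    simp
  exact ((isSymbol_const _).mul' (isSymbol_coord l) (zero_add 1)).add
    ((isSymbol_const _).mul' hr (zero_add 1))

lemma isSymbol_radial (hm : 0 < massSq E p) (l : Fin 3) :
    IsSymbol 0 fun x => ((c * E : ℂ) * (radial E p l x : ℝ)) := by
  refine ((isSymbol_const (c * E : ℂ)).mul' ((isSymbol_alphaBoost hm).mul' ((isSymbol_coord l).mul'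
    isSymbol_inv_norm (c := 0) (by norm_num)) (zero_add 0)) (zero_add 0)).congr (R := 0)
    fun x _ => ?_
  simp only [radial]
  push_cast
  rfl

lemma approx_killingField (hm : 0 < massSq E p) (l : Fin 3) :
    Approx 1 (killingField c E p l) (linearField c E p l) :=
  ⟨isSymbol_linearField l, ((isSymbol_radial (c := c) hm l).isLittleInf (by norm_num)).neg.congr
    (R := 0) fun x _ => by simp [killingField]⟩

lemma pd_linearField (i l : Fin 3) (x : E3) : pd i (linearField c E p l) x =
    (c * E : ℂ) * (kron i l : ℝ) +
      (-(Complex.I * Real.sqrt 2 * c)) * ((crossProduct p (Pi.single i 1) l : ℝ) : ℂ) := by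
  have h1 : DifferentiableAt ℝ (fun y : E3 => y l) x := differentiableAt_coord l
  have h2 : DifferentiableAt ℝ (rotation p l) x :=
    (contDiff_rotation p l).differentiable (by simp) x
  have k1 := differentiableAt_ofReal h1
  have k2 := differentiableAt_ofReal h2
  have hk (z : ℂ) : DifferentiableAt ℝ (fun _ : E3 => z) x := differentiableAt_const z
  refine (pd_add i ((hk _).fun_mul k1) ((hk _).fun_mul k2)).trans ?_
  rw [pd_mul i (hk _) k1, pd_mul i (hk _) k2, pd_ofReal i h1, pd_ofReal i h2, pd_coord,
    pd_rotation, pd_const, pd_const]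
  ring

lemma pd_killingField (hm : 0 < massSq E p) {x : E3} (hx : x ≠ 0) (i l : Fin 3) :
    pd i (killingField c E p l) x =
      pd i (linearField c E p l) x - (c * E : ℂ) * ((pd i (radial E p l) x : ℝ) : ℂ) := by
  have h1 : DifferentiableAt ℝ (linearField c E p l) x :=
    (contDiff_linearField l).differentiable (by simp) x
  have h2 := differentiableAt_of_contDiffOn_compl (contDiffOn_radial hm l) hx
  have k2 := differentiableAt_ofReal h2
  have hk (z : ℂ) : DifferentiableAt ℝ (fun _ : E3 => z) x := differentiableAt_const z
  refine (pd_sub i h1 ((hk _).fun_mul k2)).trans ?_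
  rw [pd_mul i (hk _) k2, pd_ofReal i h2, pd_const]
  ring

lemma pd_linearField_add_swap (i j : Fin 3) (x : E3) :
    pd i (linearField c E p j) x + pd j (linearField c E p i) x = 2 * (c * E : ℂ) * kron i j := by
  rw [pd_linearField, pd_linearField]
  rcases fin_three_cases i with rfl | rfl | rfl <;> rcases fin_three_cases j with rfl | rfl | rfl <;>
  simp [kron, cross_apply] <;> ring

/-- For the dilation, Euler's identity contributes `-1` and the two lower indices `+2`; the rotation
contributes zero. -/
lemma lieMetric_linearField (hm : 0 < massSq E p) {x : E3} (hx : x ≠ 0) (i j : Fin 3) :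
    lieMetric (linearField c E p) (fun i j y => (metricTail E p i j y : ℂ)) i j x =
      (c * E : ℂ) * metricTail E p i j x := by
  have hd (i j) : DifferentiableAt ℝ (metricTail E p i j) x := by
    have hn := contDiffOn_norm_compl
    have h0 : ∀ x ∈ ({0}ᶜ : Set E3), ‖x‖ ≠ 0 := fun x hx => norm_ne_zero_iff.2 hx
    exact differentiableAt_of_contDiffOn_compl (((contDiffOn_const.div hn h0).neg.mul
      contDiffOn_const).sub (((contDiffOn_alphaBoost hm).div hn h0).mul ((((contDiffOn_const.mul
      (contDiff_coord i).contDiffOn).mul (contDiff_coord j).contDiffOn).div (hn.pow 2)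
      fun x hx => pow_ne_zero 2 (h0 x hx)).sub contDiffOn_const))) hx
  have he := congrArg (fun r : ℝ => (r : ℂ)) (euler_metricTail hm hx i j)
  have hr := congrArg (fun r : ℝ => (r : ℂ)) (lie_rotation_metricTail hm hx i j)
  have hi := congrArg (fun r : ℝ => (r : ℂ)) (sum_mul_kron (fun l => metricTail E p l j x) i)
  have hj := congrArg (fun r : ℝ => (r : ℂ)) (sum_mul_kron (fun l => metricTail E p i l x) j)
  simp only [kron_comm _ i] at hi
  simp only [kron_comm _ j] at hj
  simp only [pd_rotation] at hr
  push_cast at he hr hi hj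
  simp only [lieMetric, pd_ofReal _ (hd _ _), pd_linearField]
  simp only [linearField]
  simp only [Fin.sum_univ_three] at he hr hi hj ⊢
  linear_combination (c * E : ℂ) * (he + hi + hj) + (-(Complex.I * Real.sqrt 2 * c)) * hr

/-- The trace part `T_{(ab)} = λ δ_{ab}` of the approximate solution. -/
def traceFun (c E : ℝ) (p : Fin 3 → ℝ) (x : E3) : ℂ :=
  -(c * E : ℂ) + (1 / 2) * ((c * E : ℂ) * ((2 * E + alphaBoost E p x : ℂ) * ((‖x‖⁻¹ : ℝ) : ℂ)))

/-- The constant part of the trace function cancels the order-zero Lie derivative exactly, and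
`leading_real` evaluates what is left at order `r⁻¹`. -/
lemma approx_lieMetric (hb : BoostedDecay h K E p)
    (hm : 0 < massSq E p) (i j : Fin 3) :
    Approx (-1) (fun x => lieMetric (killingField c E p) (fun i j y => (h y i j : ℂ)) i j x +
      2 * traceFun c E p x * h x i j)
      fun x => (c : ℂ) * ((crossProduct (fun a => extrinsicTail E p i a x)
        (fun a => rotation p a x) j + crossProduct (fun a => extrinsicTail E p j a x)
        (fun a => rotation p a x) i : ℝ) : ℂ) := by
  -- Splitting `h = -δ + H'` leaves `H'` of order `-1`; the Lie derivative of `-δ` is an exact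
  -- expression in `∂v`.
  set H' : Fin 3 → Fin 3 → E3 → ℂ := fun i j y => (h y i j : ℂ) + kron i j with hH'
  have hH (i j) := approx_metric_tail hb hm i j
  have hv (l) := approx_killingField (c := c) hm l
  have hlie : Approx (-1) (lieMetric (killingField c E p) H' i j)
      (lieMetric (linearField c E p) (fun i j y => (metricTail E p i j y : ℂ)) i j) :=
    Approx.sum fun l _ => (((hv l).mul ((hH i j).pd l (b := -2) (by norm_num)) (by norm_num)).add
      ((hH l j).mul ((hv l).pd i (b := 0) (by norm_num)) (by norm_num))).add
      ((hH i l).mul ((hv l).pd j (b := 0) (by norm_num)) (by norm_num))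
  have hrad (i j) := ((isSymbol_radial (c := c) hm j).pd' i (b := -1) (by norm_num)).approx_self
  have hs : IsSymbol (-1) fun x => (c * E : ℂ) *
      ((2 * E + alphaBoost E p x : ℂ) * ((‖x‖⁻¹ : ℝ) : ℂ)) :=
    (isSymbol_const _).mul' (((isSymbol_const (2 * E : ℂ)).add (isSymbol_alphaBoost hm)).mul'
      isSymbol_inv_norm (zero_add (-1))) (zero_add (-1))
  have hsk := (hs.mul' (isSymbol_const (kron i j : ℂ)) (add_zero (-1))).approx_self
  have hsH := (hs.mul' (hH i j).isSymbol (c := -2) (by norm_num)).approx_zero (a := -1)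
    (by norm_num)
  -- In turn: the Lie derivative of `H'`, the gradient of the radial correction, the constant trace
  -- against `H'`, and the `r⁻¹` trace against `-δ` and against `H'`, the last of these being of
  -- order `-2` and negligible.
  have htot := (((hlie.add ((hrad i j).add (hrad j i))).sub
    ((hH i j).const_mul (2 * (c * E) : ℂ))).sub hsk).add hsH
  have hmul {x : E3} (hx : x ≠ 0) (i j : Fin 3) :
      pd i (fun y => (c * E : ℂ) * ((radial E p j y : ℝ) : ℂ)) x =
        (c * E : ℂ) * ((pd i (radial E p j) x : ℝ) : ℂ) := by
    have h2 := differentiableAt_of_contDiffOn_compl (contDiffOn_radial hm j) hx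
    rw [pd_mul i (differentiableAt_const _) (differentiableAt_ofReal h2), pd_ofReal i h2, pd_const]
    ring
  refine htot.congr (R := 0) (fun x hx => ?_) fun x hx => ?_
  · have hx0 := ne_zero_of_mem_endRegion le_rfl hx
    have hi : ∑ l, (kron l i : ℂ) * pd j (killingField c E p l) x =
      pd j (killingField c E p i) x := by simp [ofReal_kron]
    have hj : ∑ l, (kron l j : ℂ) * pd i (killingField c E p l) x =
      pd i (killingField c E p j) x := by simp [ofReal_kron]
    have hlin := pd_linearField_add_swap (c := c) (E := E) (p := p) i j x
    rw [pd_killingField hm hx0] at hi hj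
    have hlie' : lieMetric (killingField c E p) H' i j x =
        lieMetric (killingField c E p) (fun i j y => (h y i j : ℂ)) i j x +
        ∑ l, (kron l j : ℂ) * pd i (killingField c E p l) x +
        ∑ l, (kron l i : ℂ) * pd j (killingField c E p l) x := by
      simp only [lieMetric, hH', pd_add_const, ← Finset.sum_add_distrib, kron_comm _ i]
      exact Finset.sum_congr rfl fun l _ => by ring
    simp only [hmul hx0, hlie', hi, hj, traceFun, H']
    linear_combination hlin
  · have hx0 := ne_zero_of_mem_endRegion le_rfl hx
    have hlead := congrArg (fun r : ℝ => (c : ℂ) * r) (leading_real hm hx0 i j)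
    simp only [hmul hx0, lieMetric_linearField hm hx0]
    rw [← hlead]
    push_cast
    ring

/-- The covector field of the approximate Killing field. -/
def killingCov (h : E3 → Matrix (Fin 3) (Fin 3) ℝ) (c E : ℝ) (p : Fin 3 → ℝ) (j : Fin 3)
    (x : E3) : ℂ :=
  ∑ l, (h x l j : ℂ) * killingField c E p l x

lemma approx_killingCov (hb : BoostedDecay h K E p) (hm : 0 < massSq E p) (j : Fin 3) :
    Approx 1 (killingCov h c E p j) fun x => -linearField c E p j x :=
  (Approx.sum fun l _ => (approx_metric hb hm l j).mul (approx_killingField (c := c) hm l)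
    (zero_add 1)).congr (R := 0) (fun x _ => rfl) fun x _ => by simp [ofReal_kron]

lemma approx_frameCov (he : IsCartesianFrame R₀ h e) {k k₀ : Fin 3 → E3 → ℂ} {a : ℝ}
    (hk : ∀ j, Approx a (k j) (k₀ j)) (b : Fin 3) : Approx a (frameCov e k b) (k₀ b) :=
  (Approx.sum fun j _ => (hk j).mul (approx_frame he b j) (add_zero a)).congr (R := 0)
    (fun x _ => rfl) fun x _ => by simp [ofReal_kron]

lemma rtHalf_mul_sqrt : rtHalf * Real.sqrt 2 = 1 := by
  rw [rtHalf, ← Complex.ofReal_mul, one_div, inv_mul_cancel₀ (by positivity), Complex.ofReal_one]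

/-- The dilation drops out by symmetry, and for the rotation `(i/√2)(i√2 c) = -c`. This is the
negative of the leading part in `approx_lieMetric`. -/
lemma approx_cross_killingCov (he : IsCartesianFrame R₀ h e)
    (hb : BoostedDecay h K E p) (hm : 0 < massSq E p) (a b : Fin 3) :
    Approx (-1) (fun x => rtHalf * Complex.I *
      (crossProduct (fun d => frameK K e a d x) (fun d => frameCov e (killingCov h c E p) d x) b +
       crossProduct (fun d => frameK K e b d x) (fun d => frameCov e (killingCov h c E p) d x) a))
      fun x => -(c : ℂ) * ((crossProduct (fun d => extrinsicTail E p a d x)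
        (fun d => rotation p d x) b + crossProduct (fun d => extrinsicTail E p b d x)
        (fun d => rotation p d x) a : ℝ) : ℂ) := by
  have hcr (a b) := Approx.cross (c := -1) (approx_frameK he hb hm a)
    (approx_frameCov he (approx_killingCov (c := c) hb hm)) (by norm_num) b
  refine (((hcr a b).add (hcr b a)).const_mul (rtHalf * Complex.I)).congr (R := 0)
    (fun x _ => rfl) fun x _ => ?_
  have hlin (d) : -linearField c E p d x = (-(c * E : ℂ)) * (x d : ℝ) +
      (Complex.I * Real.sqrt 2 * c) * (rotation p d x : ℝ) := by
    rw [linearField]; ring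
  have hsymm := congrArg (fun r : ℝ => (r : ℂ)) (cross_extrinsicTail_coord (E := E) (p := p)
    (x := x) a b)
  have hr := rtHalf_mul_sqrt
  have hI := Complex.I_mul_I
  simp only [hlin, cross_add_mul, ofReal_cross]
  push_cast at hsymm ⊢
  set X := ((crossProduct (fun d => extrinsicTail E p a d x) (fun d => rotation p d x) b : ℝ) : ℂ)
  set Y := ((crossProduct (fun d => extrinsicTail E p b d x) (fun d => rotation p d x) a : ℝ) : ℂ)
  linear_combination (-(c * E : ℂ) * rtHalf * Complex.I) * hsymm +
    Complex.I * Complex.I * c * (X + Y) * hr + c * (X + Y) * hI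

/-- Orthonormality turns the subtracted trace `2 l δ_{ab}` into the frame components of a multiple
of `h`, so that it can be combined with the Lie derivative. -/
lemma senTensor_add_swap (he : IsCartesianFrame R₀ h e) {x : E3}
    (hx : x ∈ endRegion R₀) (k : Fin 3 → E3 → ℂ) (l : ℂ) (a b : Fin 3) :
    senTensor h K e k a b x + senTensor h K e k b a x - 2 * l * kron a b =
      (∑ i, ∑ j, ((e x a i : ℂ) * e x b j) *
        (covGrad h k i j x + covGrad h k j i x + 2 * l * h x i j)) +
      rtHalf * Complex.I * (crossProduct (fun d => frameK K e a d x) (fun d => frameCov e k d x) b +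
        crossProduct (fun d => frameK K e b d x) (fun d => frameCov e k d x) a) := by
  have h1 : ∑ i, ∑ j, (h x i j : ℂ) * e x a i * e x b j = -(kron a b : ℂ) := by
    exact_mod_cast he.orthonormal x hx a b
  simp only [senTensor]
  simp only [Fin.sum_univ_three] at h1 ⊢
  linear_combination (-2 * l) * h1

/-- The leading parts of the Lie derivative and of the curvature term cancel, so an approximation of
order `-1` with zero leading part remains. -/
lemma isLittleInf_senTensor_killingCov (hR₀ : 0 ≤ R₀) (hd : IsVacuumData R₀ h K)
    (he : IsCartesianFrame R₀ h e) (hb : BoostedDecay h K E p) (hm : 0 < massSq E p)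
    (a b : Fin 3) : IsLittleInf (-3 / 2) fun x => senTensor h K e (killingCov h c E p) a b x +
      senTensor h K e (killingCov h c E p) b a x - 2 * traceFun c E p x * kron a b := by
  have h1 := (Approx.sum fun i (_ : i ∈ Finset.univ) => Approx.sum fun j (_ : j ∈ Finset.univ) =>
    ((approx_frame he a i).mul (approx_frame he b j) (add_zero 0)).mul
    (approx_lieMetric (c := c) hb hm i j) (zero_add (-1))).add
    (approx_cross_killingCov (c := c) he hb hm a b)
  have h2 := h1.congr (R := R₀) (g := fun x => senTensor h K e (killingCov h c E p) a b x +
      senTensor h K e (killingCov h c E p) b a x - 2 * traceFun c E p x * kron a b)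
      (g₀ := fun _ => 0) (fun x hx => ?_) fun x _ => ?_
  · have := h2.isLittleInf
    rwa [show (-1 : ℝ) - 1 / 2 = -3 / 2 by norm_num] at this
  · have hv (l) : DifferentiableAt ℝ (killingField c E p l) x :=
      ((contDiffOn_killingField hm l).contDiffAt (isOpen_compl_singleton.mem_nhds
        (ne_zero_of_mem_endRegion hR₀ hx))).differentiableAt (by simp)
    have hg := covGrad_add_swap hd hx hv
    simp only [senTensor_add_swap he hx, ← hg]
    rfl
  · simp [ofReal_kron]

end Existence

/-! ### The approximate Killing spinor -/

section ExistenceOfSpinor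

variable {R₀ : ℝ} {h K e : E3 → Matrix (Fin 3) (Fin 3) ℝ} {E : ℝ} {p : Fin 3 → ℝ} {c : ℝ}

/-- At order zero only the flat gradient of the linear field counts: `Γ k` and `K × k` have order
`-1`. -/
lemma approx_senTensor_killingCov (hd : IsVacuumData R₀ h K)
    (he : IsCartesianFrame R₀ h e) (hb : BoostedDecay h K E p) (hm : 0 < massSq E p)
    (a b : Fin 3) : Approx 0 (senTensor h K e (killingCov h c E p) a b) fun _ =>
      Complex.I * Real.sqrt 2 * c * ((crossProduct p (Pi.single a 1) b : ℝ) : ℂ) -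
        (c * E : ℂ) * kron a b := by
  have hk := approx_killingCov (c := c) hb hm
  have hg (i j) : Approx 0 (covGrad h (killingCov h c E p) i j)
      fun x => pd i (fun x => -linearField c E p j x) x - ∑ l : Fin 3, 0 :=
    ((hk j).pd i (by norm_num)).sub (Approx.sum fun l _ =>
      ((isSymbol_christoffel hd he hb hm l i j).mul' (c := -1) (hk l).isSymbol
        (by norm_num)).approx_zero (by norm_num))
  have hcr := (((Approx.cross (c := -1) (approx_frameK he hb hm a)
    (approx_frameCov he hk) (by norm_num) b).const_mul (rtHalf * Complex.I)).isSymbol).approx_zero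
    (a := 0) (by norm_num)
  refine ((Approx.sum fun i _ => Approx.sum fun j _ => ((approx_frame he a i).mul
    (approx_frame he b j) (add_zero 0)).mul (hg i j) (add_zero 0)).add hcr).congr (R := 0)
    (fun x _ => rfl) fun x _ => ?_
  have hneg (i j) : pd i (fun x => -linearField c E p j x) x = -pd i (linearField c E p j) x := by
    simp [pd]
  simp only [hneg, pd_linearField]
  simp [ofReal_kron]
  ring

lemma IsLittleInf.mul_const {δ : ℝ} {f : E3 → ℂ} (hf : IsLittleInf δ f) (z : ℂ) :
    IsLittleInf δ fun x => f x * z := by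
  simpa using hf.mul_isSymbol (isSymbol_const z)

lemma IsLittleInf.const_mul {δ : ℝ} {f : E3 → ℂ} (z : ℂ) (hf : IsLittleInf δ f) :
    IsLittleInf δ fun x => z * f x := by
  simpa [mul_comm] using hf.mul_const z

lemma contDiffOn_ofReal {f : E3 → ℝ} {s : Set E3} (hf : ContDiffOn ℝ ∞ f s) :
    ContDiffOn ℝ ∞ (fun x => (f x : ℂ)) s :=
  Complex.ofRealCLM.contDiff.comp_contDiffOn hf

lemma contDiffOn_solder (he : IsCartesianFrame R₀ h e) (j : Fin 3) (A B : Fin 2) :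
    ContDiffOn ℝ ∞ (solder e j A B) (endRegion R₀) :=
  ContDiffOn.sum fun a _ => (contDiffOn_ofReal (he.smooth a j)).mul contDiffOn_const

lemma contDiffOn_killingCov (hR₀ : 0 ≤ R₀) (hd : IsVacuumData R₀ h K) (hm : 0 < massSq E p)
    (j : Fin 3) : ContDiffOn ℝ ∞ (killingCov h c E p j) (endRegion R₀) :=
  ContDiffOn.sum fun l _ => (contDiffOn_ofReal (hd.smooth_h l j)).mul
    ((contDiffOn_killingField hm l).mono fun _ hx => ne_zero_of_mem_endRegion hR₀ hx)

lemma isSymbol_solder (he : IsCartesianFrame R₀ h e) (j : Fin 3) (A B : Fin 2) :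
    IsSymbol 0 (solder e j A B) :=
  IsSymbol.sum _ fun a _ => (approx_frame he a j).isSymbol.mul' (isSymbol_const _) (add_zero 0)

lemma exists_hasKillingSpinorAsymptotics (hR₀ : 0 ≤ R₀) (hd : IsVacuumData R₀ h K)
    (he : IsCartesianFrame R₀ h e) (hb : BoostedDecay h K E p) (hm : 0 < massSq E p) (s : ℝ) :
    ∃ κ, HasKillingSpinorAsymptotics R₀ h K e E p s κ := by
  -- Both the trace over three dimensions and the coefficient `3/2` in `ξ_{AB}` produce `3c`, giving
  -- `ξ → 3cE` and `ξ_{AB} → 3c p_{AB}`.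
  set c : ℝ := s * Real.sqrt 2 / (3 * mass E p) with hc
  have hmass : mass E p ≠ 0 := (Real.sqrt_pos.2 hm).ne'
  have hc3 : 3 * c = s * Real.sqrt 2 / mass E p := by rw [hc]; field_simp
  have hc3' : (3 * c : ℂ) = ((s * Real.sqrt 2 / mass E p : ℝ) : ℂ) := by
    rw [← hc3]; push_cast; rfl
  set k := killingCov h c E p with hk
  set κ : E3 → Matrix (Fin 2) (Fin 2) ℂ := fun x => .of fun C D => ∑ j, k j x * solder e j C D x
  have hsp : IsSpinorOf R₀ e k κ := ⟨contDiffOn_killingCov hR₀ hd hm, fun _ _ _ _ => rfl⟩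
  have hT := approx_senTensor_killingCov (c := c) hd he hb hm
  refine ⟨κ, fun A B => ?_, fun x _ => ?_, fun A B => ?_, fun i => ?_, fun A B => ?_, ?_⟩
  · show ContDiffOn ℝ ∞ (fun x => ∑ j, k j x * solder e j A B x) _
    exact ContDiffOn.sum fun j _ => (hsp.smooth j).mul (contDiffOn_solder he j A B)
  · ext A B
    simp only [Matrix.transpose_apply, κ, Matrix.of_apply, solder, sigma0_symm _ A B]
  · have : IsSymbol 1 fun x => ∑ j, k j x * solder e j A B x := IsSymbol.sum _ fun j _ =>
      (approx_killingCov hb hm j).isSymbol.mul' (isSymbol_solder he j A B) (add_zero 1)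
    exact this.isLittleInf (by norm_num)
  · have hl := isLittleInf_senTensor_killingCov (c := c) hR₀ hd he hb hm
    -- The trace function is free in `symmPart_eq`; choosing `traceFun` exposes the combination
    -- already known to decay.
    refine (IsLittleInf.const_mul (1 / 6) (IsLittleInf.sum Finset.univ fun a _ => IsLittleInf.sum
      Finset.univ fun b _ => (hl a b).const_mul (sigma0 a (i 0) (i 1) * sigma0 b (i 2) (i 3) +
      sigma0 a (i 0) (i 2) * sigma0 b (i 1) (i 3) +
      sigma0 a (i 0) (i 3) * sigma0 b (i 1) (i 2)))).congr (R := R₀) fun x hx => ?_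
    rw [hsp.xi4_eq hd he hx, symmPart_eq _ (traceFun c E p x)]
  · have h0 : IsSymbol 0 fun _ : E3 => sigma0 0 A B := isSymbol_const _
    have h1 : IsSymbol 0 fun _ : E3 => sigma0 1 A B := isSymbol_const _
    have h2 : IsSymbol 0 fun _ : E3 => sigma0 2 A B := isSymbol_const _
    have := (((((hT 1 2).sub (hT 2 1)).mul h0.approx_self (add_zero 0)).add
      (((hT 2 0).sub (hT 0 2)).mul h1.approx_self (add_zero 0))).add
      (((hT 0 1).sub (hT 1 0)).mul h2.approx_self (add_zero 0))).const_mul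
      (-(3 / 2) * (rtHalf * Complex.I))
    have h3 := this.2
    rw [show (0 : ℝ) - 1 / 2 = -1 / 2 by norm_num] at h3
    refine h3.congr (R := R₀) fun x hx => ?_
    rw [hsp.xi2_eq hd he hx, ← hc3']
    have hr := rtHalf_mul_sqrt
    have hI := Complex.I_mul_I
    simp [kron, cross_apply, constSpinor, Fin.sum_univ_three]
    set S := p 0 * sigma0 0 A B + p 1 * sigma0 1 A B + p 2 * sigma0 2 A B with hS
    linear_combination (3 * Complex.I * Complex.I * c * S) * hr + 3 * c * S * hI
  · have h3 := (Approx.sum fun a (_ : a ∈ Finset.univ) => hT a a).neg.2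
    rw [show (0 : ℝ) - 1 / 2 = -1 / 2 by norm_num] at h3
    refine h3.congr (R := R₀) fun x hx => ?_
    rw [hsp.xi0_eq hd he hx]
    have : ((s * Real.sqrt 2 * E / mass E p : ℝ) : ℂ) = 3 * c * E := by
      rw [hc3', ← Complex.ofReal_mul]; congr 1; ring
    rw [this]
    simp [kron, cross_apply, Fin.sum_univ_three]
    ring

end ExistenceOfSpinor

/-! ## Asymptotically conformal Killing covectors in flat space -/

section FlatConformalKilling

variable {R₀ : ℝ} {k : Fin 3 → E3 → ℂ}

lemma contDiffOn_pd {f : E3 → ℂ} (hf : ContDiffOn ℝ ∞ f (endRegion R₀)) (i : Fin 3) :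
    ContDiffOn ℝ ∞ (pd i f) (endRegion R₀) :=
  (hf.fderiv_of_isOpen (isOpen_endRegion R₀) (by simp)).clm_apply contDiffOn_const

/-- The symmetrised gradient `∂_i k_j + ∂_j k_i`. -/
def symGrad (k : Fin 3 → E3 → ℂ) (i j : Fin 3) (x : E3) : ℂ := pd i (k j) x + pd j (k i) x

lemma contDiffOn_symGrad (hk : ∀ j, ContDiffOn ℝ ∞ (k j) (endRegion R₀)) (i j : Fin 3) :
    ContDiffOn ℝ ∞ (symGrad k i j) (endRegion R₀) :=
  (contDiffOn_pd (hk j) i).add (contDiffOn_pd (hk i) j)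

lemma pd_pd_comb {f g : E3 → ℂ} (hf : ContDiffOn ℝ ∞ f (endRegion R₀))
    (hg : ContDiffOn ℝ ∞ g (endRegion R₀)) (c : ℂ) (a b : Fin 3) {x : E3}
    (hx : x ∈ endRegion R₀) : pd a (pd b fun y => f y + c * g y) x =
      pd a (pd b f) x + c * pd a (pd b g) x := by
  have h1 {f g : E3 → ℂ} (hf : ContDiffOn ℝ ∞ f (endRegion R₀))
      (hg : ContDiffOn ℝ ∞ g (endRegion R₀)) (a : Fin 3) {x : E3} (hx : x ∈ endRegion R₀) :
      pd a (fun y => f y + c * g y) x = pd a f x + c * pd a g x := by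
    have hg' := differentiableAt_of_smooth hg hx
    rw [pd_add a (differentiableAt_of_smooth hf hx) ((differentiableAt_const c).fun_mul hg'),
      pd_mul a (differentiableAt_const c) hg', pd_const]
    ring
  rw [pd_congr_endRegion a (fun y hy => h1 hf hg b hy) hx,
    h1 (contDiffOn_pd hf b) (contDiffOn_pd hg b) a hx]

/-- The compatibility conditions of a symmetrised gradient: after commuting partial derivatives, all
third derivatives of `k` cancel. -/
lemma saintVenant (hk : ∀ j, ContDiffOn ℝ ∞ (k j) (endRegion R₀)) {x : E3}
    (hx : x ∈ endRegion R₀) (i j m l : Fin 3) :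
    pd m (pd l (symGrad k i j)) x + pd i (pd j (symGrad k m l)) x -
      pd i (pd l (symGrad k m j)) x - pd m (pd j (symGrad k i l)) x = 0 := by
  have hs (a b i j) : pd a (pd b (symGrad k i j)) x =
      pd a (pd b (pd i (k j))) x + pd a (pd b (pd j (k i))) x := by
    have := pd_pd_comb (contDiffOn_pd (hk j) i) (contDiffOn_pd (hk i) j) 1 a b hx
    simp only [one_mul] at this
    exact this
  have h1 (a b c j) : pd a (pd b (pd c (k j))) x = pd b (pd a (pd c (k j))) x :=
    pd_comm a b (contDiffAt_endRegion (contDiffOn_pd (hk j) c) hx)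
  have h2 (a b c j) : pd a (pd b (pd c (k j))) x = pd a (pd c (pd b (k j))) x :=
    pd_congr_endRegion a (fun y hy => pd_comm b c (contDiffAt_endRegion (hk j) hy)) hx
  simp only [hs]
  linear_combination h2 m l i j + h1 m i l j + h2 i m l j + h2 m l j i +
    h1 i j m l + h2 j i m l + h1 j m i l + h2 i j l m

/-- The trace-free part `q` of the symmetrised gradient determines the Hessian of its trace through
Saint-Venant. Integrating from infinity, with every integration constant killed by the decay known
beforehand, bounds all of `∂∂k`, then `∂k`, then `k` up to a constant. -/
lemma exists_const_of_symGrad (hk : ∀ j, ContDiffOn ℝ ∞ (k j) (endRegion R₀))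
    (hg : ∀ i j, IsLittleInf (-1 / 2) (pd i (k j)))
    (hq : ∀ i j, IsLittleInf (-3 / 2) fun x => symGrad k i j x - kron i j * symGrad k 0 0 x) :
    ∃ c : Fin 3 → ℂ, ∀ j, IsLittleInf (-1 / 2) fun x => k j x - c j := by
  have hsm := contDiffOn_symGrad hk
  set q : Fin 3 → Fin 3 → E3 → ℂ := fun i j x =>
    symGrad k i j x + -(kron i j : ℂ) * symGrad k 0 0 x with hqdef
  have hq' (i j) : IsLittleInf (-3 / 2) (q i j) :=
    (hq i j).congr (R := R₀) fun x _ => by simp only [hqdef]; ring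
  have hqq (a b i j) : IsLittleInf (-7 / 2) (pd a (pd b (q i j))) := by
    have := ((hq' i j).pd b).pd a
    rwa [show (-3 / 2 : ℝ) - 1 - 1 = -7 / 2 by norm_num] at this
  have hs0 : IsLittleInf (-1 / 2) (symGrad k 0 0) := (hg 0 0).add (hg 0 0)
  -- The once contracted Saint-Venant operator applied to `q = symGrad - δ s`, where `s` is the `00`
  -- component. It annihilates the gradient and leaves `-(δ Δs + ∂∂s)`.
  set Z : Fin 3 → Fin 3 → E3 → ℂ := fun i j x => ∑ m, (pd m (pd m (q i j)) x +
    pd i (pd j (q m m)) x - pd i (pd m (q m j)) x - pd m (pd j (q i m)) x) with hZdef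
  have hZ (i j) : IsLittleInf (-7 / 2) (Z i j) := IsLittleInf.sum _ fun m _ =>
    (((hqq m m i j).add (hqq i j m m)).sub (hqq i m m j)).sub (hqq m j i m)
  have hZeq {x} (hx : x ∈ endRegion R₀) (i j) : Z i j x =
      -((kron i j : ℂ) * (∑ m, pd m (pd m (symGrad k 0 0)) x) + pd i (pd j (symGrad k 0 0)) x) := by
    have hpp (a b i j) := pd_pd_comb (hsm i j) (hsm 0 0) (-(kron i j : ℂ)) a b hx
    have hSV := saintVenant hk hx i j
    have hi : ∑ m, (kron i m : ℂ) * pd m (pd j (symGrad k 0 0)) x =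
        pd i (pd j (symGrad k 0 0)) x := by simp [ofReal_kron]
    have hj : ∑ m, (kron m j : ℂ) * pd i (pd m (symGrad k 0 0)) x =
        pd i (pd j (symGrad k 0 0)) x := by simp [ofReal_kron]
    have h3 : ∑ m : Fin 3, (kron m m : ℂ) = 3 := by simp [ofReal_kron]
    simp only [hZdef, hqdef, hpp]
    have h0 := hSV 0 0
    have h1 := hSV 1 1
    have h2 := hSV 2 2
    simp only [Fin.sum_univ_three] at hi hj h3 ⊢
    linear_combination h0 + h1 + h2 + hi + hj - h3 * pd i (pd j (symGrad k 0 0)) x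
  -- The trace of `Z` is `-4Δs`, whence the coefficient `1/4` that eliminates the Laplacian.
  have hss (i j) : IsLittleInf (-7 / 2) (pd i (pd j (symGrad k 0 0))) := by
    refine (((IsLittleInf.sum Finset.univ fun m _ => hZ m m).const_mul
      (1 / 4 * (kron i j : ℂ))).sub (hZ i j)).congr (R := R₀) fun x hx => ?_
    simp only [hZeq hx, Fin.sum_univ_three]
    simp only [kron, if_true]
    push_cast
    ring
  have hds (j) : IsLittleInf (-5 / 2) (pd j (symGrad k 0 0)) := by
    obtain ⟨c, hc⟩ := exists_const_isLittleInf_of_pd (δ := -5 / 2) (by norm_num)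
      (contDiffOn_pd (hsm 0 0) j) fun i => by
        rw [show (-5 / 2 : ℝ) - 1 = -7 / 2 by norm_num]; exact hss i j
    have h1 := hs0.pd j
    rw [show (-1 / 2 : ℝ) - 1 = -3 / 2 by norm_num] at h1
    -- The gradient of `s` already decays, which leaves no room for a constant.
    have hc0 : c = 0 := eq_zero_of_isLittleInf_const (δ := -3 / 2) (by norm_num)
      ((h1.sub (hc.mono (by norm_num))).congr (R := 0) fun x _ => by simp)
    simpa [hc0] using hc
  have hdsym (l i j) : IsLittleInf (-5 / 2) (pd l (symGrad k i j)) := by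
    have h1 := (hq' i j).pd l
    rw [show (-3 / 2 : ℝ) - 1 = -5 / 2 by norm_num] at h1
    refine (h1.add ((hds l).const_mul (kron i j : ℂ))).congr (R := R₀) fun x hx => ?_
    have hd0 := differentiableAt_of_smooth (hsm 0 0) hx
    have hd := differentiableAt_of_smooth (hsm i j) hx
    have : pd l (q i j) x = pd l (symGrad k i j) x - kron i j * pd l (symGrad k 0 0) x := by
      refine (pd_add l hd ((differentiableAt_const _).fun_mul hd0)).trans ?_
      rw [pd_mul l (differentiableAt_const _) hd0, pd_const]
      ring
    simp only [this]
    ring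
  -- As for Christoffel symbols, `2 ∂_i ∂_j k_l` is a signed sum of three derivatives of the
  -- symmetrised gradient.
  have hdd (i j l) : IsLittleInf (-5 / 2) (pd i (pd j (k l))) := by
    refine (((hdsym i j l).add (hdsym j i l)).sub (hdsym l i j)).const_mul (1 / 2) |>.congr
      (R := R₀) fun x hx => ?_
    have hd (i j) := differentiableAt_of_smooth (contDiffOn_pd (hk j) i) hx
    have hs (a i j) : pd a (symGrad k i j) x = pd a (pd i (k j)) x + pd a (pd j (k i)) x :=
      pd_add a (hd i j) (hd j i)
    have hc (a b j) : pd a (pd b (k j)) x = pd b (pd a (k j)) x :=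
      pd_comm a b (contDiffAt_endRegion (hk j) hx)
    simp only [hs]
    linear_combination (1 / 2) * (hc i l j + hc j i l + hc j l i)
  have hd (j l) : IsLittleInf (-3 / 2) (pd j (k l)) := by
    obtain ⟨c, hc⟩ := exists_const_isLittleInf_of_pd (δ := -3 / 2) (by norm_num)
      (contDiffOn_pd (hk l) j) fun i => by
        rw [show (-3 / 2 : ℝ) - 1 = -5 / 2 by norm_num]; exact hdd i j l
    have hc0 : c = 0 := eq_zero_of_isLittleInf_const (δ := -1 / 2) (by norm_num)
      (((hg j l).sub (hc.mono (by norm_num))).congr (R := 0) fun x _ => by simp)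
    simpa [hc0] using hc
  choose c hc using fun j => exists_const_isLittleInf_of_pd (δ := -1 / 2) (by norm_num) (hk j)
    fun i => by rw [show (-1 / 2 : ℝ) - 1 = -3 / 2 by norm_num]; exact hd i j
  exact ⟨c, hc⟩

end FlatConformalKilling

/-! ## Uniqueness -/

section Uniqueness

variable {R₀ : ℝ} {h K e : E3 → Matrix (Fin 3) (Fin 3) ℝ} {E : ℝ} {p : Fin 3 → ℝ}
  {k : Fin 3 → E3 → ℂ}

lemma IsSymbol.mul_isLittleInf {a b c : ℝ} {f g : E3 → ℂ} (hf : IsSymbol a f)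
    (hg : IsLittleInf b g) (hc : a + b = c) : IsLittleInf c fun x => f x * g x := by
  have := hg.mul_isSymbol hf
  rw [add_comm, hc] at this
  exact this.congr (R := 0) fun x _ => mul_comm _ _

lemma isLittleInf_cross {a b c : ℝ} {u f : Fin 3 → E3 → ℂ} (hu : ∀ i, IsSymbol a (u i))
    (hf : ∀ i, IsLittleInf b (f i)) (hc : a + b = c) (d : Fin 3) :
    IsLittleInf c fun x => crossProduct (fun i => u i x) (fun i => f i x) d := by
  rcases fin_three_cases d with rfl | rfl | rfl <;> simp only [cross_apply]
  · exact ((hu 1).mul_isLittleInf (hf 2) hc).sub ((hu 2).mul_isLittleInf (hf 1) hc)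
  · exact ((hu 2).mul_isLittleInf (hf 0) hc).sub ((hu 0).mul_isLittleInf (hf 2) hc)
  · exact ((hu 0).mul_isLittleInf (hf 1) hc).sub ((hu 1).mul_isLittleInf (hf 0) hc)

/-- The term of the Sen derivative that involves the extrinsic curvature. -/
def crossTerm (K e : E3 → Matrix (Fin 3) (Fin 3) ℝ) (k : Fin 3 → E3 → ℂ) (a b : Fin 3) (x : E3) :
    ℂ :=
  rtHalf * Complex.I * crossProduct (fun c => frameK K e a c x) (fun c => frameCov e k c x) b

lemma isLittleInf_crossTerm (he : IsCartesianFrame R₀ h e) (hb : BoostedDecay h K E p)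
    (hm : 0 < massSq E p) {δ δ' : ℝ} (hk : ∀ j, IsLittleInf δ (k j)) (hδ : δ - 2 = δ')
    (a b : Fin 3) : IsLittleInf δ' (crossTerm K e k a b) :=
  (isLittleInf_cross (fun c => (approx_frameK he hb hm a c).isSymbol) (fun c =>
    IsLittleInf.sum _ fun j _ => by
      simpa using (hk j).mul_isSymbol (approx_frame he c j).isSymbol) (by linarith) b).const_mul _

/-- The coframe components `θ_i^a`. -/
def coframe (h e : E3 → Matrix (Fin 3) (Fin 3) ℝ) (i a : Fin 3) (x : E3) : ℝ :=
  -∑ l, h x i l * e x a l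

lemma coframe_mul_frame (hd : IsVacuumData R₀ h K) (he : IsCartesianFrame R₀ h e) {x : E3}
    (hx : x ∈ endRegion R₀) (i j : Fin 3) : ∑ a, coframe h e i a x * e x a j = kron i j := by
  simp only [coframe, neg_mul, Finset.sum_neg_distrib, sum_metric_frame_mul_frame hd he hx, neg_neg]

lemma coframe_mul_coframe (hd : IsVacuumData R₀ h K) (he : IsCartesianFrame R₀ h e) {x : E3}
    (hx : x ∈ endRegion R₀) (i j : Fin 3) :
    ∑ a, coframe h e i a x * coframe h e j a x = -h x i j := by
  have h1 : ∑ a, coframe h e i a x * coframe h e j a x =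
      -∑ l, h x j l * ∑ a, coframe h e i a x * e x a l := by
    have h2 (a) : coframe h e i a x * coframe h e j a x =
        -∑ l, h x j l * (coframe h e i a x * e x a l) := by
      conv_lhs => enter [2]; rw [coframe]
      rw [mul_neg, Finset.mul_sum]
      exact congrArg _ (Finset.sum_congr rfl fun l _ => by ring)
    simp only [h2, Finset.sum_neg_distrib, Finset.mul_sum]
    rw [Finset.sum_comm]
  rw [h1, hd.symm_h hx i j]
  simp only [coframe_mul_frame hd he hx]
  simp [kron]

lemma isSymbol_coframe (he : IsCartesianFrame R₀ h e) (hb : BoostedDecay h K E p)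
    (hm : 0 < massSq E p) (i a : Fin 3) : IsSymbol 0 fun x => (coframe h e i a x : ℂ) := by
  refine (IsSymbol.sum Finset.univ fun l _ => (approx_metric hb hm i l).isSymbol.mul'
    (approx_frame he a l).isSymbol (add_zero 0)).neg.congr (R := 0) fun x _ => ?_
  simp only [coframe]
  push_cast
  rfl

/-- The frame description inverted with the coframe, so that decay of `T` gives decay of coordinate
derivatives. -/
lemma covGrad_eq_sum (hd : IsVacuumData R₀ h K) (he : IsCartesianFrame R₀ h e) {x : E3}
    (hx : x ∈ endRegion R₀) (i j : Fin 3) : covGrad h k i j x = ∑ a, ∑ b,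
      ((coframe h e i a x : ℂ) * coframe h e j b x) *
        (senTensor h K e k a b x - crossTerm K e k a b x) := by
  have hk (i j) : ∑ a, (coframe h e i a x : ℂ) * e x a j = (kron i j : ℂ) := by
    exact_mod_cast congrArg (fun r : ℝ => (r : ℂ)) (coframe_mul_frame hd he hx i j)
  have hsum (u v : Fin 3 → ℂ) (f G : Fin 3 → Fin 3 → ℂ) :
      ∑ a, ∑ b, (u a * v b) * ∑ i, ∑ j, f a i * f b j * G i j =
        ∑ i, ∑ j, (∑ a, u a * f a i) * (∑ b, v b * f b j) * G i j := by
    simp only [Fin.sum_univ_three]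
    ring
  simp only [senTensor, crossTerm, add_sub_cancel_right]
  rw [hsum]
  simp only [hk, ofReal_kron]
  simp

lemma pd_eq_covGrad_add (i j : Fin 3) (x : E3) :
    pd i (k j) x = covGrad h k i j x + ∑ l, (christoffel h l i j x : ℂ) * k l x := by
  rw [covGrad]; ring

/-- A two-pass bootstrap. The assumed growth `o_∞(r^{3/2})` makes `Γ k` and `K × k` only
`o_∞(r^{-1/2})`, which is enough to improve `k` to `o_∞(r^{1/2})`; then they become `o_∞(r^{-3/2})`
and the flat result applies. -/
lemma exists_const_of_senTensor (hd : IsVacuumData R₀ h K) (he : IsCartesianFrame R₀ h e)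
    (hb : BoostedDecay h K E p) (hm : 0 < massSq E p)
    (hs : ∀ j, ContDiffOn ℝ ∞ (k j) (endRegion R₀)) (hk : ∀ j, IsLittleInf (3 / 2) (k j))
    (hT : ∀ a b, IsLittleInf (-1 / 2) (senTensor h K e k a b))
    (hS : ∀ a b, IsLittleInf (-3 / 2) fun x => senTensor h K e k a b x + senTensor h K e k b a x -
      kron a b * (senTensor h K e k 0 0 x + senTensor h K e k 0 0 x)) :
    ∃ c : Fin 3 → ℂ, ∀ j, IsLittleInf (-1 / 2) fun x => k j x - c j := by
  have hθ := isSymbol_coframe he hb hm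
  have hθθ (i j a b) := (hθ i a).mul' (hθ j b) (add_zero 0)
  have hΓ (l i j) := isSymbol_christoffel hd he hb hm l i j
  have hpd (i j) : IsLittleInf (-1 / 2) (pd i (k j)) := by
    refine ((IsLittleInf.sum Finset.univ fun a _ => IsLittleInf.sum Finset.univ fun b _ =>
      (hθθ i j a b).mul_isLittleInf ((hT a b).sub
      (isLittleInf_crossTerm he hb hm hk (by norm_num) a b)) (zero_add _)).add
      (IsLittleInf.sum Finset.univ fun l _ => (hΓ l i j).mul_isLittleInf (hk l)
        (by norm_num))).congr (R := R₀) fun x hx => ?_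
    rw [pd_eq_covGrad_add (h := h), covGrad_eq_sum (K := K) hd he hx]
  -- One power of `r` is gained by integrating the gradient; the positive order permits this without
  -- a constant.
  have hk' (j) : IsLittleInf (1 / 2) (k j) := isLittleInf_of_pd (by norm_num) (hs j) fun i => by
    rw [show (1 / 2 : ℝ) - 1 = -1 / 2 by norm_num]; exact hpd i j
  set S : E3 → ℂ := fun x => senTensor h K e k 0 0 x + senTensor h K e k 0 0 x with hSdef
  have hS0 : IsLittleInf (-1 / 2) S := (hT 0 0).add (hT 0 0)
  -- Passing from frame to coordinates replaces `δ S` by `-h S`; the discrepancy `(h + δ) S` has the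
  -- required decay.
  have hsym (i j) : IsLittleInf (-3 / 2) fun x => symGrad k i j x - kron i j * S x := by
    have hc (a b) := isLittleInf_crossTerm he hb hm hk' (δ' := -3 / 2) (by norm_num) a b
    refine (((IsLittleInf.sum Finset.univ fun a _ => IsLittleInf.sum Finset.univ fun b _ =>
      (hθθ i j a b).mul_isLittleInf (((hS a b).sub (hc a b)).sub (hc b a)) (zero_add _)).sub
      ((approx_metric_tail hb hm i j).isSymbol.mul_isLittleInf hS0 (by norm_num))).add
      (IsLittleInf.sum Finset.univ fun l _ => ((hΓ l i j).add (hΓ l j i)).mul_isLittleInf (hk' l)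
        (by norm_num))).congr (R := R₀) fun x hx => ?_
    have hcc : ∑ a, (coframe h e i a x : ℂ) * coframe h e j a x = -(h x i j : ℂ) := by
      exact_mod_cast congrArg (fun r : ℝ => (r : ℂ)) (coframe_mul_coframe hd he hx i j)
    have h00 : ∑ a, ∑ b, ((coframe h e i a x : ℂ) * coframe h e j b x) * (kron a b : ℂ) =
        -(h x i j : ℂ) := by
      rw [← hcc]
      simp [ofReal_kron]
    simp only [symGrad, pd_eq_covGrad_add (h := h), covGrad_eq_sum (K := K) hd he hx]
    simp only [Fin.sum_univ_three] at h00 ⊢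
    linear_combination (-S x) * h00
  refine exists_const_of_symGrad hs hpd fun i j => ?_
  refine ((hsym i j).sub ((hsym 0 0).const_mul (kron i j : ℂ))).congr (R := 0) fun x _ => ?_
  simp only [kron, if_true]
  push_cast
  ring

end Uniqueness

/-! ### From the spinor conditions to the tensor conditions, and the theorem -/

section MainTheorem

variable {R₀ : ℝ} {h K e : E3 → Matrix (Fin 3) (Fin 3) ℝ} {E : ℝ} {p : Fin 3 → ℝ}

/-- The three components of a symmetric spinor determine its vector, so decay of `ξ_{AB}` yields
decay of the antisymmetric part of `T`. -/
lemma curl_inverse {w : Fin 3 → ℂ} {X : Fin 2 → Fin 2 → ℂ}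
    (hX : ∀ A B, X A B = -(3 / 2) * (rtHalf * Complex.I) *
      (w 0 * sigma0 0 A B + w 1 * sigma0 1 A B + w 2 * sigma0 2 A B)) :
    w 0 = 2 / 3 * Complex.I * (X 1 1 - X 0 0) ∧ w 1 = -(2 / 3) * (X 0 0 + X 1 1) ∧
      w 2 = 2 / 3 * Complex.I * (X 0 1 + X 1 0) := by
  have hX' (A B) : X A B = -(3 / 4) * Complex.I *
      (w 0 * pauli 0 A B + w 1 * pauli 1 A B + w 2 * pauli 2 A B) := by
    rw [hX]
    simp only [sigma0_eq]
    linear_combination (-(3 / 2) * Complex.I *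
      (w 0 * pauli 0 A B + w 1 * pauli 1 A B + w 2 * pauli 2 A B)) * rtHalf_mul_self
  have hI := Complex.I_mul_I
  simp only [hX']
  simp only [pauli, Matrix.cons_val_zero, Matrix.cons_val_one, Matrix.cons_val, Matrix.of_apply,
    Matrix.cons_val']
  refine ⟨?_, ?_, ?_⟩
  · linear_combination w 0 * hI
  · linear_combination w 1 * hI
  · linear_combination w 2 * hI

lemma IsSpinorOf.symm_part_eq {κ : E3 → Matrix (Fin 2) (Fin 2) ℂ} {k : Fin 3 → E3 → ℂ}
    (hκ : IsSpinorOf R₀ e k κ) (hd : IsVacuumData R₀ h K) (he : IsCartesianFrame R₀ h e) {x : E3}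
    (hx : x ∈ endRegion R₀) :
    senTensor h K e k 0 0 x - senTensor h K e k 1 1 x =
      xi4 h K e κ ![0, 0, 0, 0] x + xi4 h K e κ ![1, 1, 1, 1] x ∧
    senTensor h K e k 0 1 x + senTensor h K e k 1 0 x =
      -Complex.I * (xi4 h K e κ ![0, 0, 0, 0] x - xi4 h K e κ ![1, 1, 1, 1] x) ∧
    senTensor h K e k 0 2 x + senTensor h K e k 2 0 x =
      2 * (xi4 h K e κ ![0, 1, 1, 1] x - xi4 h K e κ ![0, 0, 0, 1] x) ∧
    senTensor h K e k 1 2 x + senTensor h K e k 2 1 x =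
      2 * Complex.I * (xi4 h K e κ ![0, 1, 1, 1] x + xi4 h K e κ ![0, 0, 0, 1] x) ∧
    2 * senTensor h K e k 2 2 x - senTensor h K e k 0 0 x - senTensor h K e k 1 1 x =
      6 * xi4 h K e κ ![0, 0, 1, 1] x := by
  simp only [hκ.xi4_eq hd he hx]
  exact symmPart_inverse fun a b => senTensor h K e k a b x

/-- The irreducible parts are recombined, keeping the better decay of the trace-free symmetric part.
The trace is normalised by the `00` component, as the flat argument expects. -/
lemma isLittleInf_of_parts {T : Fin 3 → Fin 3 → E3 → ℂ}
    (htr : IsLittleInf (-1 / 2) fun x => ∑ a, T a a x)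
    (h12 : IsLittleInf (-1 / 2) fun x => T 1 2 x - T 2 1 x)
    (h20 : IsLittleInf (-1 / 2) fun x => T 2 0 x - T 0 2 x)
    (h01 : IsLittleInf (-1 / 2) fun x => T 0 1 x - T 1 0 x)
    (s1 : IsLittleInf (-3 / 2) fun x => T 0 0 x - T 1 1 x)
    (s2 : IsLittleInf (-3 / 2) fun x => T 0 1 x + T 1 0 x)
    (s3 : IsLittleInf (-3 / 2) fun x => T 0 2 x + T 2 0 x)
    (s4 : IsLittleInf (-3 / 2) fun x => T 1 2 x + T 2 1 x)
    (s5 : IsLittleInf (-3 / 2) fun x => 2 * T 2 2 x - T 0 0 x - T 1 1 x) :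
    (∀ a b, IsLittleInf (-1 / 2) (T a b)) ∧ ∀ a b, IsLittleInf (-3 / 2) fun x =>
      T a b x + T b a x - kron a b * (T 0 0 x + T 0 0 x) := by
  have hm : (-3 / 2 : ℝ) ≤ -1 / 2 := by norm_num
  simp only [Fin.sum_univ_three] at htr
  constructor <;> intro a b
  · rcases fin_three_cases a with rfl | rfl | rfl <;>
    rcases fin_three_cases b with rfl | rfl | rfl
    · exact (((htr.const_mul (1 / 3)).add ((s1.mono hm).const_mul (1 / 2))).sub
        ((s5.mono hm).const_mul (1 / 6))).congr (R := 0) fun x _ => by ring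
    · exact ((h01.add (s2.mono hm)).const_mul (1 / 2)).congr (R := 0) fun x _ => by ring
    · exact (((s3.mono hm).sub h20).const_mul (1 / 2)).congr (R := 0) fun x _ => by ring
    · exact (((s2.mono hm).sub h01).const_mul (1 / 2)).congr (R := 0) fun x _ => by ring
    · exact (((htr.const_mul (1 / 3)).sub ((s1.mono hm).const_mul (1 / 2))).sub
        ((s5.mono hm).const_mul (1 / 6))).congr (R := 0) fun x _ => by ring
    · exact ((h12.add (s4.mono hm)).const_mul (1 / 2)).congr (R := 0) fun x _ => by ring
    · exact ((h20.add (s3.mono hm)).const_mul (1 / 2)).congr (R := 0) fun x _ => by ring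
    · exact (((s4.mono hm).sub h12).const_mul (1 / 2)).congr (R := 0) fun x _ => by ring
    · exact ((htr.const_mul (1 / 3)).add ((s5.mono hm).const_mul (1 / 3))).congr (R := 0)
        fun x _ => by ring
  · rcases fin_three_cases a with rfl | rfl | rfl <;>
    rcases fin_three_cases b with rfl | rfl | rfl <;> simp [kron]
    · exact isLittleInf_zero _
    · exact s2
    · exact s3
    · exact s2.congr (R := 0) fun x _ => by ring
    · exact (s1.const_mul (-2)).congr (R := 0) fun x _ => by ring
    · exact s4
    · exact s3.congr (R := 0) fun x _ => by ring
    · exact s4.congr (R := 0) fun x _ => by ring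
    · exact (s5.sub s1).congr (R := 0) fun x _ => by ring

lemma senTensor_sub {k k' : Fin 3 → E3 → ℂ} {x : E3} (hk : ∀ j, DifferentiableAt ℝ (k j) x)
    (hk' : ∀ j, DifferentiableAt ℝ (k' j) x) (a b : Fin 3) :
    senTensor h K e (fun j y => k j y - k' j y) a b x =
      senTensor h K e k a b x - senTensor h K e k' a b x := by
  have hg (i j) : covGrad h (fun j y => k j y - k' j y) i j x =
      covGrad h k i j x - covGrad h k' i j x := by
    simp only [covGrad, pd_sub _ (hk _) (hk' _), mul_sub, Finset.sum_sub_distrib]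
    ring
  have hf (c) : frameCov e (fun j y => k j y - k' j y) c x =
      1 * frameCov e k c x + (-1) * frameCov e k' c x := by
    simp only [frameCov, sub_mul, Finset.sum_sub_distrib]
    ring
  simp only [senTensor, hg, hf, cross_add_mul, mul_sub, Finset.sum_sub_distrib]
  ring

lemma isLittleInf_covOf (he : IsCartesianFrame R₀ h e) (hb : BoostedDecay h K E p)
    (hm : 0 < massSq E p) {κ : E3 → Matrix (Fin 2) (Fin 2) ℂ} {δ : ℝ}
    (hκ : ∀ A B, IsLittleInf δ fun x => κ x A B) (j : Fin 3) : IsLittleInf δ (covOf h e κ j) := by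
  have hf (a) : IsLittleInf δ fun x => frameComp (κ x) a := by
    rcases fin_three_cases a with rfl | rfl | rfl
    · exact ((hκ 1 1).sub (hκ 0 0)).const_mul _
    · exact ((hκ 0 0).add (hκ 1 1)).const_mul _
    · exact ((hκ 0 1).add (hκ 1 0)).const_mul _
  exact (IsLittleInf.sum _ fun a _ => (IsSymbol.sum _ fun l _ =>
    (approx_metric hb hm j l).isSymbol.mul' (approx_frame he a l).isSymbol
      (add_zero 0)).mul_isLittleInf (hf a) (zero_add δ)).neg

/-- The prescribed limits of `ξ` and `ξ_{AB}` cancel in the difference, and `T` is linear in `k`, so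
the difference of the covectors satisfies the bootstrap hypotheses. -/
lemma exists_const_of_hasKillingSpinorAsymptotics (hd : IsVacuumData R₀ h K)
    (he : IsCartesianFrame R₀ h e) (hb : BoostedDecay h K E p) (hm : 0 < massSq E p) {s : ℝ}
    {κ κ' : E3 → Matrix (Fin 2) (Fin 2) ℂ} (hκ : HasKillingSpinorAsymptotics R₀ h K e E p s κ)
    (hκ' : HasKillingSpinorAsymptotics R₀ h K e E p s κ') :
    ∃ C : Matrix (Fin 2) (Fin 2) ℂ, C.IsSymm ∧
      ∀ A B, IsLittleInf (-1 / 2) fun x => κ x A B - κ' x A B - C A B := by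
  have hs := isSpinorOf_covOf hd he hκ.smooth hκ.symm
  have hs' := isSpinorOf_covOf hd he hκ'.smooth hκ'.symm
  set k := covOf h e κ
  set k' := covOf h e κ'
  set T : Fin 3 → Fin 3 → E3 → ℂ := fun a b x =>
    senTensor h K e k a b x - senTensor h K e k' a b x with hT
  have h4 (i) : IsLittleInf (-3 / 2) fun x => xi4 h K e κ i x - xi4 h K e κ' i x :=
    (hκ.decay_xi4 i).sub (hκ'.decay_xi4 i)
  have h2 (A B) : IsLittleInf (-1 / 2) fun x => xi2 h K e κ A B x - xi2 h K e κ' A B x :=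
    ((hκ.asymp_xi2 A B).sub (hκ'.asymp_xi2 A B)).congr (R := 0) fun x _ => by ring
  have h0 : IsLittleInf (-1 / 2) fun x => xi0 h K e κ x - xi0 h K e κ' x :=
    (hκ.asymp_xi0.sub hκ'.asymp_xi0).congr (R := 0) fun x _ => by ring
  have hc {x} (hx : x ∈ endRegion R₀) := curl_inverse
    (w := ![T 1 2 x - T 2 1 x, T 2 0 x - T 0 2 x, T 0 1 x - T 1 0 x])
    (X := fun A B => xi2 h K e κ A B x - xi2 h K e κ' A B x) fun A B => by
      rw [hs.xi2_eq hd he hx, hs'.xi2_eq hd he hx]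
      simp only [hT, Matrix.cons_val_zero, Matrix.cons_val_one, Matrix.cons_val]
      ring
  have hi {x} (hx : x ∈ endRegion R₀) := hs.symm_part_eq hd he hx
  have hi' {x} (hx : x ∈ endRegion R₀) := hs'.symm_part_eq hd he hx
  obtain ⟨hT1, hT2⟩ := isLittleInf_of_parts (T := T)
    (h0.neg.congr (R := R₀) fun x hx => by
      simp only [hT, hs.xi0_eq hd he hx, hs'.xi0_eq hd he hx, Finset.sum_sub_distrib]; ring)
    (((h2 1 1).sub (h2 0 0)).const_mul (2 / 3 * Complex.I) |>.congr (R := R₀) fun x hx =>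
      (hc hx).1.symm)
    (((h2 0 0).add (h2 1 1)).const_mul (-(2 / 3)) |>.congr (R := R₀) fun x hx =>
      (hc hx).2.1.symm)
    (((h2 0 1).add (h2 1 0)).const_mul (2 / 3 * Complex.I) |>.congr (R := R₀) fun x hx =>
      (hc hx).2.2.symm)
    (((h4 ![0, 0, 0, 0]).add (h4 ![1, 1, 1, 1])).congr (R := R₀) fun x hx => by
      simp only [hT]; linear_combination (hi' hx).1 - (hi hx).1)
    (((h4 ![0, 0, 0, 0]).sub (h4 ![1, 1, 1, 1])).const_mul (-Complex.I) |>.congr (R := R₀)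
      fun x hx => by simp only [hT]; linear_combination (hi' hx).2.1 - (hi hx).2.1)
    (((h4 ![0, 1, 1, 1]).sub (h4 ![0, 0, 0, 1])).const_mul 2 |>.congr (R := R₀)
      fun x hx => by simp only [hT]; linear_combination (hi' hx).2.2.1 - (hi hx).2.2.1)
    (((h4 ![0, 1, 1, 1]).add (h4 ![0, 0, 0, 1])).const_mul (2 * Complex.I) |>.congr (R := R₀)
      fun x hx => by simp only [hT]; linear_combination (hi' hx).2.2.2.1 - (hi hx).2.2.2.1)
    ((h4 ![0, 0, 1, 1]).const_mul 6 |>.congr (R := R₀)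
      fun x hx => by simp only [hT]; linear_combination (hi' hx).2.2.2.2 - (hi hx).2.2.2.2)
  have hlin {x} (hx : x ∈ endRegion R₀) (a b) :
      senTensor h K e (fun j y => k j y - k' j y) a b x = T a b x :=
    senTensor_sub (fun j => differentiableAt_of_smooth (hs.smooth j) hx)
      (fun j => differentiableAt_of_smooth (hs'.smooth j) hx) a b
  obtain ⟨c, hc⟩ := exists_const_of_senTensor hd he hb hm (k := fun j y => k j y - k' j y)
    (fun j => (hs.smooth j).sub (hs'.smooth j))
    (fun j => (isLittleInf_covOf he hb hm hκ.decay j).sub (isLittleInf_covOf he hb hm hκ'.decay j))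
    (fun a b => (hT1 a b).congr (R := R₀) fun x hx => (hlin hx a b).symm)
    (fun a b => (hT2 a b).congr (R := R₀) fun x hx => by simp only [hlin hx])
  -- The constant covector read in the limiting frame. Replacing the soldering form by its limit
  -- costs `o_∞(r^{-1/2})`, the rate at which the frame converges.
  refine ⟨.of fun A B => ∑ j, c j * sigma0 j A B, ?_, fun A B => ?_⟩
  · ext A B
    simp only [Matrix.transpose_apply, Matrix.of_apply, sigma0_symm _ A B]
  · have hsol (j) : IsLittleInf (-1 / 2) fun x => solder e j A B x - sigma0 j A B := by
      have := IsLittleInf.sum Finset.univ fun a _ => ((he.asymptotic a j).ofReal).mul_const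
        (sigma0 a A B)
      refine this.congr (R := 0) fun x _ => ?_
      simp only [solder, Complex.ofReal_sub, sub_mul, Finset.sum_sub_distrib, ofReal_kron]
      simp
    refine (IsLittleInf.sum Finset.univ fun j _ => ((isSymbol_solder he j A B).mul_isLittleInf (hc j)
      (zero_add _)).add ((hsol j).const_mul (c j))).congr (R := R₀) fun x hx => ?_
    rw [hs.eq x hx, hs'.eq x hx]
    simp only [Matrix.of_apply, ← Finset.sum_sub_distrib]
    exact Finset.sum_congr rfl fun j _ => by ring

end MainTheorem

end KillingSpinorEnd

end

theorem mainTheorem6 (R₀ : ℝ) (hR₀ : 0 < R₀)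
    (h K : KillingSpinorEnd.E3 → Matrix (Fin 3) (Fin 3) ℝ)
    (hdata : KillingSpinorEnd.IsVacuumData R₀ h K)
    (E : ℝ) (p : Fin 3 → ℝ)
    (hE : KillingSpinorEnd.HasADMEnergy h E)
    (hp : KillingSpinorEnd.HasADMMomentum h K p)
    (htimelike : 0 < KillingSpinorEnd.massSq E p)
    (hdecay : KillingSpinorEnd.BoostedDecay h K E p)
    (e : KillingSpinorEnd.E3 → Matrix (Fin 3) (Fin 3) ℝ)
    (he : KillingSpinorEnd.IsCartesianFrame R₀ h e)
    (s : ℝ) (hs : s = 1 ∨ s = -1) :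
    (∃ κ : KillingSpinorEnd.E3 → Matrix (Fin 2) (Fin 2) ℂ,
      KillingSpinorEnd.HasKillingSpinorAsymptotics R₀ h K e E p s κ) ∧
    (∀ κ κ' : KillingSpinorEnd.E3 → Matrix (Fin 2) (Fin 2) ℂ,
      KillingSpinorEnd.HasKillingSpinorAsymptotics R₀ h K e E p s κ →
      KillingSpinorEnd.HasKillingSpinorAsymptotics R₀ h K e E p s κ' →
      ∃ C : Matrix (Fin 2) (Fin 2) ℂ, C.IsSymm ∧
        ∀ A B, KillingSpinorEnd.IsLittleInf (-1 / 2) (fun x => κ x A B - κ' x A B - C A B)) := by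
  exact ⟨KillingSpinorEnd.exists_hasKillingSpinorAsymptotics hR₀.le hdata he hdecay htimelike s,
    fun _ _ hκ hκ' => KillingSpinorEnd.exists_const_of_hasKillingSpinorAsymptotics hdata he hdecay
      htimelike hκ hκ'⟩
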